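/- **Setting.** Let $\mathbb{T}^2=\mathbb{R}^2/2\pi\mathbb{Z}^2$ with Lebesgue measure, $e_p(x)=(2\pi)^{-1}e^{ip\cdot x}$ for $p\in\mathbb{Z}^2$, and let $\mathcal{F}=\bigoplus_{n\ge 0}L^2(\mathbb{T}^2)^{\otimes_{\mathrm a}n}$ be the fermionic Fock space with vacuum $\Omega$, annihilation operators $a_p=a(e_p)$ and creation operators $a_p^*$. Let $V:\mathbb{T}^2\to\mathbb{R}$ be integrable with $\hat V(k)=\int_{\mathbb{T}^2}V(x)e^{-ik\cdot x}\,dx\ge 0$ for all $k\in\mathbb{Z}^2$ and $\sum_{k\in\mathbb{Z}^2}|k|\hat V(k)<\infty$. Let $N\ge 1$ and $k_{\mathrm F}>0$ be such that the Fermi ball $B_{\mathrm F}=\{k\in\mathbb{Z}^2:|k|<k_{\mathrm F}\}$ has exactly $N$ elements and $k_{\mathrm F}^2=\tfrac12\big(\inf_{p\notin B_{\mathrm F}}|p|^2+\sup_{q\in B_{\mathrm F}}|q|^2\big)$. Put $\hbar=N^{-1/2}$ and $$H_N=\hbar^2\sum_{j=1}^N(-\Delta_{x_j})+\frac1N\sum_{1\le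 i<j\le N}V(x_i-x_j)\quad\text{on } L^2(\mathbb{T}^2)^{\otimes_{\mathrm a}N}.$$ Let $\psi_{\mathrm{FS}}$ be the Slater determinant of the plane waves $e_k$, $k\in B_{\mathrm F}$, let $E_{\mathrm{FS}}=\langle\psi_{\mathrm{FS}},H_N\psi_{\mathrm{FS}}\rangle$, and let $R:\mathcal{F}\to\mathcal{F}$ be the unitary particle–hole transformation: $R\Omega=\psi_{\mathrm{FS}}$, $R^*a_pR=a_p$ for $p\notin B_{\mathrm F}$ and $R^*a_pR=a_p^*$ for $p\in B_{\mathrm F}$. Define $$\mathcal{N}=\sum_{p\in\mathbb{Z}^2}a_p^*a_p,\qquad \mathbb{H}_0=\sum_{p\in\mathbb{Z}^2}e(p)\,a_p^*a_p,\quad e(p)=\hbar^2\big||p|^2-k_{\mathrm F}^2\big|,\qquad \mathcal{N}_\delta=\sum_{p:\,e(p)>\hbar N^{-\delta}}a_p^*a_p .$$ Given a constant $C_0\in\mathbb{R}$, we say that $\xi\in\mathcal{F}$ *belongs to an approximate ground state* if $\|\xi\|=1$, $R\xi\in L^2(\mathbb{T}^2)^{\otimes_{\mathrm a}N}$, and (with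 $R\xi$ of finite kinetic energy) $\langle R\xi,H_NR\xi\rangle-E_{\mathrm{FS}}\le C_0\hbar$. **Lemma (A priori bounds).** Let $V$ be as above and let $C_0\in\mathbb{R}$. There is a constant $C>0$, and for every $\varepsilon>0$ there is a constant $C_\varepsilon>0$, depending only on $V$, $C_0$ (and $\varepsilon$), such that for all $N,k_{\mathrm F}$ as above, all $\xi$ belonging to an approximate ground state with constant $C_0$, and all $\delta\in[0,\tfrac12]$, $$\langle\xi,\mathcal{N}_\delta\xi\rangle\le CN^{\delta},\qquad \langle\xi,\mathcal{N}\xi\rangle\le C_\varepsilon N^{\frac14+\varepsilon}.$$ If in addition $R\xi$ is an eigenvector of $H_N$, then $$\langle\xi,\mathcal{N}^2\xi\rangle\le C_\varepsilon N^{\frac12+\varepsilon},\qquad \langle\xi,\mathcal{N}\mathbb{H}_0\xi\rangle\le C_\varepsilon N^{-\frac14+\varepsilon},\qquad \langle\xi,\mathcal{N}^2\mathbb{H}_0\xi\rangle\le C_\varepsilon N^{\varepsilon},$$ $$\langle\xi,\mathcal{N}\mathcal{N}_\delta\xi\rangle\le C_\varepsilon N^{\frac14+\delta+\varepsilon},\qquad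 \langle\xi,\mathcal{N}^2\mathcal{N}_\delta\xi\rangle\le C_\varepsilon N^{\frac12+\delta+\varepsilon}.$$ -/

import Mathlib

namespace FermiGas

open MeasureTheory Set
open scoped ENNReal ComplexConjugate

noncomputable section

/-! ### The torus and its plane waves -/

instance fact_two_pi_pos : Fact (0 < 2 * Real.pi) := ⟨Real.two_pi_pos⟩

/-- The torus `ℝ² / 2πℤ²`, carrying the Lebesgue measure of total mass `(2π)²`. -/
abbrev Torus2 : Type := AddCircle (2 * Real.pi) × AddCircle (2 * Real.pi)

/-- Momenta `p ∈ ℤ²`. The lexicographic order only serves to fix the signs of Slater determinants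
and of the creation and annihilation operators. -/
abbrev Mom : Type := ℤ ×ₗ ℤ

/-- `|p|²` -/
def normSq (p : Mom) : ℝ := ((ofLex p).1 : ℝ) ^ 2 + ((ofLex p).2 : ℝ) ^ 2

/-- The character `x ↦ exp(i k·x)` of the torus. -/
def character (k : Mom) : C(Torus2, ℂ) where
  toFun x := fourier (ofLex k).1 x.1 * fourier (ofLex k).2 x.2
  continuous_toFun := by fun_prop

/-- `V̂(k) = ∫ V(x) exp(-i k·x) dx`, the integral being over the torus. -/
def Vhat (V : Torus2 → ℝ) (k : Mom) : ℂ := ∫ x : Torus2, (V x : ℂ) * conj (character k x)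

/-- Configurations of `n` particles on the torus. -/
abbrev Config (n : ℕ) : Type := Fin n → Torus2

/-- The space `L²((𝕋²)ⁿ)`. -/
abbrev L2 (n : ℕ) : Type := Lp ℂ 2 (volume : Measure (Config n))

/-- The one-particle plane wave `e_k(x) = (2π)⁻¹ exp(i k·x)`. -/
def planeWave (k : Mom) : C(Torus2, ℂ) := ((2 * Real.pi : ℂ))⁻¹ • character k

/-- The product `e_{K₁} ⊗ ⋯ ⊗ e_{Kₙ}` of plane waves. -/
def planeWaves {n : ℕ} (K : Fin n → Mom) : C(Config n, ℂ) where
  toFun x := ∏ j, planeWave (K j) (x j)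
  continuous_toFun := by fun_prop

/-- The product of plane waves as an element of `L²((𝕋²)ⁿ)`. -/
def planeWavesL2 {n : ℕ} (K : Fin n → Mom) : L2 n :=
  ContinuousMap.toLp (E := ℂ) 2 volume ℂ (planeWaves K)

lemma integral_fourier (m : ℤ) :
    ∫ x : AddCircle (2 * Real.pi), fourier m x = if m = 0 then 2 * Real.pi else 0 := by
  have h1 := orthonormal_iff_ite.mp (orthonormal_fourier (T := 2 * Real.pi)) 0 m
  rw [ContinuousMap.inner_toLp] at h1
  simp only [fourier_zero, map_one, mul_one] at h1
  have h2 : (volume : Measure (AddCircle (2 * Real.pi)))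
      = ENNReal.ofReal (2 * Real.pi) • AddCircle.haarAddCircle :=
    AddCircle.volume_eq_smul_haarAddCircle
  rw [h2, integral_smul_measure, h1]
  by_cases hm : m = 0
  · simp [hm, Real.pi_nonneg]
  · simp [hm, Ne.symm hm]

lemma integral_planeWave (k l : Mom) :
    ∫ x : Torus2, planeWave l x * conj (planeWave k x) = if k = l then 1 else 0 := by
  have h : ∀ x : Torus2, planeWave l x * conj (planeWave k x)
      = (((2 * Real.pi : ℂ))⁻¹ ^ 2) * (fourier ((ofLex l).1 - (ofLex k).1) x.1
        * fourier ((ofLex l).2 - (ofLex k).2) x.2) := by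
    intro x
    simp only [planeWave, character, ContinuousMap.coe_smul, ContinuousMap.coe_mk, Pi.smul_apply,
      smul_eq_mul, map_mul, map_inv₀, sub_eq_add_neg, fourier_add, fourier_neg, map_ofNat,
      Complex.conj_ofReal]
    ring
  simp_rw [h]
  rw [integral_const_mul, Measure.volume_eq_prod,
    integral_prod_mul (fun x => fourier ((ofLex l).1 - (ofLex k).1) x)
      (fun x => fourier ((ofLex l).2 - (ofLex k).2) x),
    integral_fourier, integral_fourier]
  have hpi : (Real.pi : ℂ) ≠ 0 := by exact_mod_cast Real.pi_ne_zero
  by_cases hkl : k = l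
  · subst hkl
    simp
    field_simp
  · have : ¬ ((ofLex l).1 - (ofLex k).1 = 0 ∧ (ofLex l).2 - (ofLex k).2 = 0) := by
      rintro ⟨h1, h2⟩
      apply hkl
      apply ofLex.injective
      ext <;> omega
    rw [not_and_or] at this
    rcases this with h | h <;> simp [hkl, h]

lemma orthonormal_planeWavesL2 (n : ℕ) :
    Orthonormal ℂ (planeWavesL2 : (Fin n → Mom) → L2 n) := by
  rw [orthonormal_iff_ite]
  intro K L
  simp only [planeWavesL2, ContinuousMap.inner_toLp]
  have : ∀ x : Config n, planeWaves L x * conj (planeWaves K x)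
      = ∏ j, planeWave (L j) (x j) * conj (planeWave (K j) (x j)) := by
    intro x
    simp [planeWaves, map_prod, Finset.prod_mul_distrib]
  simp_rw [this]
  rw [integral_fintype_prod_volume_eq_prod
    (fun j (y : Torus2) => planeWave (L j) y * conj (planeWave (K j) y))]
  simp_rw [integral_planeWave]
  by_cases h : K = L
  · simp [h]
  · obtain ⟨i, hi⟩ := Function.ne_iff.mp h
    rw [if_neg h]
    exact Finset.prod_eq_zero (Finset.mem_univ i) (by simp [hi])

/-- The characters of `(𝕋²)ⁿ` -/
def characters {n : ℕ} (K : Fin n → Mom) : C(Config n, ℂ) where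
  toFun x := ∏ j, character (K j) (x j)
  continuous_toFun := by fun_prop

lemma planeWaves_eq {n : ℕ} (K : Fin n → Mom) :
    planeWaves K = ((2 * Real.pi : ℂ)⁻¹ ^ n) • characters K := by
  ext x
  simp [planeWaves, characters, planeWave, Finset.prod_mul_distrib]

lemma character_zero (x : Torus2) : character 0 x = 1 := by
  simp [character]

lemma character_add (k l : Mom) (x : Torus2) :
    character (k + l) x = character k x * character l x := by
  simp only [character, ContinuousMap.coe_mk, ofLex_add, Prod.fst_add, Prod.snd_add, fourier_add]
  ring

lemma character_neg (k : Mom) (x : Torus2) : character (-k) x = conj (character k x) := by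
  simp [character]

/-- The star subalgebra generated by the characters. -/
def charactersSubalgebra (n : ℕ) : StarSubalgebra ℂ C(Config n, ℂ) where
  toSubalgebra := Algebra.adjoin ℂ (range characters)
  star_mem' := by
    change Algebra.adjoin ℂ (range characters) ≤ star (Algebra.adjoin ℂ (range characters))
    refine Algebra.adjoin_le ?_
    rintro _ ⟨K, rfl⟩
    refine Algebra.subset_adjoin ⟨-K, ?_⟩
    ext1 x
    simp [characters, character_neg]

lemma charactersSubalgebra_coe (n : ℕ) :
    (charactersSubalgebra n).toSubalgebra.toSubmodule = Submodule.span ℂ (range characters) := by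
  apply Algebra.adjoin_eq_span_of_subset
  refine .trans (fun x ↦ Submonoid.closure_induction (fun _ ↦ id) ⟨0, ?_⟩ ?_) Submodule.subset_span
  · ext z
    simp [characters, character_zero]
  · rintro _ _ _ _ ⟨m, rfl⟩ ⟨k, rfl⟩
    refine ⟨m + k, ?_⟩
    ext z
    simp [characters, character_add, Finset.prod_mul_distrib]

lemma charactersSubalgebra_separatesPoints (n : ℕ) : (charactersSubalgebra n).SeparatesPoints := by
  intro x y hxy
  rw [Ne, funext_iff, not_forall] at hxy
  obtain ⟨i, hi⟩ := hxy
  have key : ∀ (k : Mom) (z : Config n), characters (Pi.single i k) z = character k (z i) := by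
    intro k z
    simp only [characters, ContinuousMap.coe_mk]
    rw [Finset.prod_eq_single i]
    · simp
    · intro j _ hj
      rw [Pi.single_eq_of_ne hj, character_zero]
    · simp
  have hinj : ∀ a b : AddCircle (2 * Real.pi), (fourier 1 a : ℂ) = fourier 1 b → a = b := by
    intro a b h
    rw [fourier_one, fourier_one] at h
    exact AddCircle.injective_toCircle Real.two_pi_pos.ne' (Circle.ext h)
  by_cases h1 : (x i).1 = (y i).1
  · have h2 : (x i).2 ≠ (y i).2 := fun h2 => hi (Prod.ext h1 h2)
    refine ⟨_, ⟨characters (Pi.single i (toLex (0, 1))),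
      Algebra.subset_adjoin ⟨_, rfl⟩, rfl⟩, ?_⟩
    change characters _ x ≠ characters _ y
    rw [key, key]
    intro h
    apply h2
    apply hinj
    simpa [character] using h
  · refine ⟨_, ⟨characters (Pi.single i (toLex (1, 0))),
      Algebra.subset_adjoin ⟨_, rfl⟩, rfl⟩, ?_⟩
    change characters _ x ≠ characters _ y
    rw [key, key]
    intro h
    apply h1
    apply hinj
    simpa [character] using h

lemma span_planeWavesL2 (n : ℕ) :
    (Submodule.span ℂ (range (planeWavesL2 : (Fin n → Mom) → L2 n))).topologicalClosure = ⊤ := by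
  have h1 : (Submodule.span ℂ (range (characters (n := n)))).topologicalClosure = ⊤ := by
    rw [← charactersSubalgebra_coe]
    exact congr_arg (Subalgebra.toSubmodule <| StarSubalgebra.toSubalgebra ·)
      (ContinuousMap.starSubalgebra_topologicalClosure_eq_top_of_separatesPoints _
        (charactersSubalgebra_separatesPoints n))
  have h0 : Submodule.span ℂ (range (characters (n := n)))
      = Submodule.span ℂ (range (planeWaves (n := n))) := by
    have hc : ((2 * Real.pi : ℂ)⁻¹ ^ n) ≠ 0 := by
      have hpi : (Real.pi : ℂ) ≠ 0 := by exact_mod_cast Real.pi_ne_zero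
      exact pow_ne_zero _ (inv_ne_zero (mul_ne_zero two_ne_zero hpi))
    apply le_antisymm <;> rw [Submodule.span_le] <;> rintro _ ⟨K, rfl⟩
    · have : characters K = ((2 * Real.pi : ℂ)⁻¹ ^ n)⁻¹ • planeWaves K := by
        rw [planeWaves_eq, smul_smul, inv_mul_cancel₀ hc, one_smul]
      rw [this]
      exact Submodule.smul_mem _ _ (Submodule.subset_span ⟨K, rfl⟩)
    · rw [planeWaves_eq]
      exact Submodule.smul_mem _ _ (Submodule.subset_span ⟨K, rfl⟩)
  rw [h0] at h1
  have h2 := (ContinuousMap.toLp_denseRange ℂ (volume : Measure (Config n)) ℂ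
    (p := 2) (by simp)).topologicalClosure_map_submodule h1
  simpa only [Submodule.map_span, ContinuousLinearMap.coe_coe, ← range_comp, Function.comp_def,
    planeWavesL2] using! h2

/-! ### Antisymmetric wave functions and Fock space -/

lemma measurePreserving_permute {n : ℕ} (σ : Equiv.Perm (Fin n)) :
    MeasurePreserving (fun x : Config n => x ∘ σ) volume volume := by
  have h := volume_measurePreserving_piCongrLeft (fun _ : Fin n => Torus2) σ.symm
  convert! h using 1
  ext1 x
  ext1 i
  simp [MeasurableEquiv.piCongrLeft, Equiv.piCongrLeft, Equiv.piCongrLeft']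

/-- The action `(σ ψ)(x₁, …, xₙ) = ψ(x_{σ(1)}, …, x_{σ(n)})` of permutations. -/
def permute {n : ℕ} (σ : Equiv.Perm (Fin n)) : L2 n →ₗᵢ[ℂ] L2 n :=
  Lp.compMeasurePreservingₗᵢ ℂ (fun x : Config n => x ∘ σ) (measurePreserving_permute σ)

/-- The space of antisymmetric square integrable wave functions of `n` particles. -/
def antisym (n : ℕ) : Submodule ℂ (L2 n) where
  carrier := {ψ | ∀ σ : Equiv.Perm (Fin n), permute σ ψ = ((Equiv.Perm.sign σ : ℤ) : ℂ) • ψ}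
  add_mem' := by
    intro a b ha hb σ
    rw [map_add, ha σ, hb σ, smul_add]
  zero_mem' := by
    intro σ
    simp
  smul_mem' := by
    intro c a ha σ
    rw [map_smul, ha σ, smul_comm]

instance completeSpace_antisym (n : ℕ) : CompleteSpace (antisym n) := by
  have : IsClosed (antisym n : Set (L2 n)) := by
    have : (antisym n : Set (L2 n))
        = ⋂ σ : Equiv.Perm (Fin n), {ψ | permute σ ψ = ((Equiv.Perm.sign σ : ℤ) : ℂ) • ψ} := by
      ext ψ
      simp [antisym]
    rw [this]
    refine isClosed_iInter fun σ => isClosed_eq (permute σ).continuous ?_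
    exact continuous_const_smul _
  exact this.completeSpace_coe

/-- The fermionic Fock space: the Hilbert sum over `n` of the antisymmetric `n`-particle spaces. -/
abbrev Fock : Type := lp (fun n : ℕ => antisym n) 2

lemma permute_planeWavesL2 {n : ℕ} (σ : Equiv.Perm (Fin n)) (K : Fin n → Mom) :
    permute σ (planeWavesL2 (K ∘ σ)) = planeWavesL2 K := by
  apply Lp.ext
  have h1 := Lp.coeFn_compMeasurePreserving (planeWavesL2 (K ∘ σ)) (measurePreserving_permute σ)
  have h2 := ContinuousMap.coeFn_toLp (p := 2) (𝕜 := ℂ) volume (planeWaves (K ∘ σ))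
  have h3 := ContinuousMap.coeFn_toLp (p := 2) (𝕜 := ℂ) volume (planeWaves K)
  have h4 := (measurePreserving_permute σ).quasiMeasurePreserving.ae_eq_comp h2
  refine (h1.trans (h4.trans ?_)).trans h3.symm
  refine Filter.Eventually.of_forall fun x => ?_
  simp only [planeWaves, Function.comp_apply, ContinuousMap.coe_mk]
  exact Equiv.prod_comp σ (fun j => planeWave (K j) (x j))

lemma sign_mul_self {n : ℕ} (σ : Equiv.Perm (Fin n)) :
    ((Equiv.Perm.sign σ : ℤ) : ℂ) * ((Equiv.Perm.sign σ : ℤ) : ℂ) = 1 := by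
  have : ((Equiv.Perm.sign σ : ℤ)) * ((Equiv.Perm.sign σ : ℤ)) = 1 := by
    rcases Int.units_eq_one_or (Equiv.Perm.sign σ) with h | h <;> simp [h]
  exact_mod_cast this

lemma inner_planeWaves_comp {n : ℕ} {ψ : L2 n} (hψ : ψ ∈ antisym n) (σ : Equiv.Perm (Fin n))
    (K : Fin n → Mom) :
    inner ℂ (planeWavesL2 (K ∘ σ)) ψ
      = ((Equiv.Perm.sign σ : ℤ) : ℂ) * inner ℂ (planeWavesL2 K) ψ := by
  rw [← (permute σ).inner_map_map, permute_planeWavesL2, hψ σ, inner_smul_right]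

/-- The Slater determinant `(n!)^{-1/2} det (e_{k_j}(x_l))`, where `k₁ < ⋯ < kₙ` are the elements
of `S`. -/
def slaterFun {n : ℕ} (S : Finset Mom) (h : S.card = n) : C(Config n, ℂ) :=
  ((Real.sqrt n.factorial : ℂ))⁻¹ • Matrix.det (Matrix.of fun j l : Fin n =>
    (planeWave (S.orderEmbOfFin h j)).comp ⟨fun x : Config n => x l, continuous_apply l⟩)

lemma slaterFun_eq {n : ℕ} (S : Finset Mom) (h : S.card = n) :
    slaterFun S h = ((Real.sqrt n.factorial : ℂ))⁻¹ • ∑ σ : Equiv.Perm (Fin n),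
      ((Equiv.Perm.sign σ : ℤ) : ℂ) • planeWaves (S.orderEmbOfFin h ∘ σ) := by
  rw [slaterFun, Matrix.det_apply']
  congr 1
  refine Finset.sum_congr rfl fun σ _ => ?_
  ext x
  simp [planeWaves, ContinuousMap.prod_apply]

/-- The Slater determinant as an element of `L²`. -/
def slaterL2 {n : ℕ} (S : Finset Mom) (h : S.card = n) : L2 n :=
  ContinuousMap.toLp (E := ℂ) 2 volume ℂ (slaterFun S h)

lemma slaterL2_eq {n : ℕ} (S : Finset Mom) (h : S.card = n) :
    slaterL2 S h = ((Real.sqrt n.factorial : ℂ))⁻¹ • ∑ σ : Equiv.Perm (Fin n),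
      ((Equiv.Perm.sign σ : ℤ) : ℂ) • planeWavesL2 (S.orderEmbOfFin h ∘ σ) := by
  rw [slaterL2, slaterFun_eq, map_smul, map_sum]
  simp only [map_smul, planeWavesL2]

lemma slaterL2_mem {n : ℕ} (S : Finset Mom) (h : S.card = n) : slaterL2 S h ∈ antisym n := by
  intro τ
  rw [slaterL2_eq, map_smul, smul_comm, map_sum]
  refine congrArg (fun v : L2 n => ((Real.sqrt n.factorial : ℂ))⁻¹ • v) ?_
  rw [Finset.smul_sum]
  refine (Equiv.sum_comp (Equiv.mulRight τ) _).symm.trans ?_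
  refine Finset.sum_congr rfl fun σ _ => ?_
  have : (S.orderEmbOfFin h ∘ (Equiv.mulRight τ σ : Equiv.Perm (Fin n)) : Fin n → Mom)
      = (S.orderEmbOfFin h ∘ σ) ∘ τ := by
    ext1 i; simp
  rw [map_smul, this, permute_planeWavesL2, smul_smul]
  congr 1
  simp [mul_comm]

/-- The Slater determinant as an element of the antisymmetric `n`-particle space. -/
def slater {n : ℕ} (S : Finset Mom) (h : S.card = n) : antisym n :=
  ⟨slaterL2 S h, slaterL2_mem S h⟩

lemma inner_slaterL2 {n : ℕ} (S : Finset Mom) (h : S.card = n) {ψ : L2 n} (hψ : ψ ∈ antisym n) :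
    inner ℂ (slaterL2 S h) ψ
      = (Real.sqrt n.factorial : ℂ) * inner ℂ (planeWavesL2 (S.orderEmbOfFin h)) ψ := by
  rw [slaterL2_eq, inner_smul_left, sum_inner]
  have : ∀ σ : Equiv.Perm (Fin n), inner ℂ (((Equiv.Perm.sign σ : ℤ) : ℂ) •
      planeWavesL2 (S.orderEmbOfFin h ∘ σ)) ψ
      = inner ℂ (planeWavesL2 (S.orderEmbOfFin h)) ψ := by
    intro σ
    rw [inner_smul_left, inner_planeWaves_comp hψ, map_intCast, ← mul_assoc, sign_mul_self, one_mul]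
  simp_rw [this]
  rw [Finset.sum_const, Finset.card_univ, Fintype.card_perm, Fintype.card_fin, nsmul_eq_mul,
    ← mul_assoc, map_inv₀, Complex.conj_ofReal]
  congr 1
  have h2 : (Real.sqrt n.factorial : ℂ) * (Real.sqrt n.factorial : ℂ) = (n.factorial : ℂ) := by
    rw [← Complex.ofReal_mul, Real.mul_self_sqrt (Nat.cast_nonneg _), Complex.ofReal_natCast]
  have h3 : (Real.sqrt n.factorial : ℂ) ≠ 0 := by
    rw [Complex.ofReal_ne_zero]
    exact (Real.sqrt_pos.mpr (by exact_mod_cast n.factorial_pos)).ne'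
  rw [← h2, ← mul_assoc, inv_mul_cancel₀ h3, one_mul]

lemma inner_slaterL2_slaterL2 {n : ℕ} (S S' : Finset Mom) (h : S.card = n) (h' : S'.card = n) :
    inner ℂ (slaterL2 S h) (slaterL2 S' h') = if S = S' then (1 : ℂ) else 0 := by
  have h3 : (Real.sqrt n.factorial : ℂ) ≠ 0 := by
    rw [Complex.ofReal_ne_zero]
    exact (Real.sqrt_pos.mpr (by exact_mod_cast n.factorial_pos)).ne'
  rw [inner_slaterL2 S h (slaterL2_mem S' h'), slaterL2_eq, inner_smul_right, ← mul_assoc,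
    mul_inv_cancel₀ h3, one_mul, inner_sum]
  simp only [inner_smul_right, orthonormal_iff_ite.mp (orthonormal_planeWavesL2 n)]
  by_cases hS : S = S'
  · subst hS
    rw [if_pos rfl, Finset.sum_eq_single 1]
    · simp
    · intro σ _ hσ
      rw [if_neg, mul_zero]
      intro heq
      apply hσ
      ext1 i
      have := congrFun heq i
      simpa using ((S.orderEmbOfFin h).injective this).symm
    · simp
  · rw [if_neg hS]
    refine Finset.sum_eq_zero fun σ _ => ?_
    rw [if_neg, mul_zero]
    intro heq
    apply hS
    have h4 := congrArg Set.range heq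
    rw [Set.range_comp, σ.surjective.range_eq, Set.image_univ, Finset.range_orderEmbOfFin,
      Finset.range_orderEmbOfFin] at h4
    exact_mod_cast h4

lemma inner_planeWaves_of_not_injective {n : ℕ} {ψ : L2 n} (hψ : ψ ∈ antisym n)
    {K : Fin n → Mom} (hK : ¬ Function.Injective K) :
    inner ℂ (planeWavesL2 K) ψ = (0 : ℂ) := by
  simp only [Function.Injective, not_forall] at hK
  obtain ⟨a, b, hab, hne⟩ := hK
  have h1 := inner_planeWaves_comp hψ (Equiv.swap a b) K
  have h2 : K ∘ (Equiv.swap a b) = K := by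
    ext1 i
    rw [Function.comp_apply]
    by_cases hia : i = a
    · rw [hia, Equiv.swap_apply_left, hab]
    · by_cases hib : i = b
      · rw [hib, Equiv.swap_apply_right, hab]
      · rw [Equiv.swap_apply_of_ne_of_ne hia hib]
  rw [h2, Equiv.Perm.sign_swap hne] at h1
  simp only [Units.val_neg, Units.val_one, Int.cast_neg, Int.cast_one, neg_mul, one_mul] at h1
  exact self_eq_neg.mp h1

lemma exists_orderEmb_comp {n : ℕ} {K : Fin n → Mom} (hK : Function.Injective K) :
    ∃ (S : Finset Mom) (h : S.card = n) (σ : Equiv.Perm (Fin n)), K = S.orderEmbOfFin h ∘ σ := by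
  have hc : (Finset.univ.image K).card = n := by
    rw [Finset.card_image_of_injective _ hK, Finset.card_univ, Fintype.card_fin]
  have hr : ∀ i, ∃ j, (Finset.univ.image K).orderEmbOfFin hc j = K i := by
    intro i
    have : K i ∈ Set.range ((Finset.univ.image K).orderEmbOfFin hc) := by
      rw [Finset.range_orderEmbOfFin]; simp
    exact this
  choose f hf using hr
  have hfi : Function.Injective f := by
    intro a b hab
    apply hK
    rw [← hf a, ← hf b, hab]
  exact ⟨_, hc, Equiv.ofBijective f (Finite.injective_iff_bijective.mp hfi),
    funext fun i => (hf i).symm⟩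

lemma inner_planeWaves_eq_zero {n : ℕ} {ψ : L2 n} (hψ : ψ ∈ antisym n)
    (h0 : ∀ (S : Finset Mom) (h : S.card = n), inner ℂ (slaterL2 S h) ψ = (0 : ℂ))
    (K : Fin n → Mom) : inner ℂ (planeWavesL2 K) ψ = (0 : ℂ) := by
  by_cases hK : Function.Injective K
  · obtain ⟨S, h, σ, rfl⟩ := exists_orderEmb_comp hK
    have h1 := h0 S h
    rw [inner_slaterL2 _ _ hψ] at h1
    have h3 : (Real.sqrt n.factorial : ℂ) ≠ 0 := by
      rw [Complex.ofReal_ne_zero]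
      exact (Real.sqrt_pos.mpr (by exact_mod_cast n.factorial_pos)).ne'
    rw [inner_planeWaves_comp hψ, (mul_eq_zero.mp h1).resolve_left h3, mul_zero]
  · exact inner_planeWaves_of_not_injective hψ hK

/-- The Slater determinant with momenta `S`, as a vector of Fock space. -/
def slaterFock (S : Finset Mom) : Fock := lp.single 2 S.card (slater S rfl)

lemma slaterFock_apply (S : Finset Mom) {n : ℕ} (h : S.card = n) : slaterFock S n = slater S h := by
  subst h
  exact lp.single_apply_self _ _ _

lemma inner_slaterFock (S : Finset Mom) (ξ : Fock) :
    inner ℂ (slaterFock S) ξ = inner ℂ (slaterL2 S rfl) (ξ S.card : L2 S.card) := by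
  rw [slaterFock, lp.inner_single_left]
  rfl

lemma orthonormal_slaterFock : Orthonormal ℂ slaterFock := by
  rw [orthonormal_iff_ite]
  intro S S'
  rw [inner_slaterFock]
  by_cases h : S'.card = S.card
  · rw [slaterFock_apply S' h]
    exact inner_slaterL2_slaterL2 S S' rfl h
  · have h0 : slaterFock S' S.card = 0 := lp.single_apply_ne _ _ _ (Ne.symm h)
    rw [h0, if_neg (fun e => h (by rw [e]))]
    simp

/-- The Slater determinants of plane waves form an orthonormal basis of Fock space. -/
def slaterBasis : HilbertBasis (Finset Mom) ℂ Fock :=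
  HilbertBasis.mkOfOrthogonalEqBot orthonormal_slaterFock (by
    rw [Submodule.eq_bot_iff]
    intro ξ hξ
    have h0 : ∀ S, inner ℂ (slaterFock S) ξ = (0 : ℂ) := fun S =>
      (Submodule.mem_orthogonal _ _).mp hξ _ (Submodule.subset_span ⟨S, rfl⟩)
    apply lp.ext
    funext n
    apply Subtype.ext
    have h1 : ∀ (S : Finset Mom) (h : S.card = n),
        inner ℂ (slaterL2 S h) (ξ n : L2 n) = (0 : ℂ) := by
      intro S h
      subst h
      rw [← inner_slaterFock, h0]
    have h2 := inner_planeWaves_eq_zero (ξ n).2 h1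
    have h3 : (Submodule.span ℂ (range (planeWavesL2 : (Fin n → Mom) → L2 n)))ᗮ = ⊥ :=
      (Submodule.topologicalClosure_eq_top_iff).mp (span_planeWavesL2 n)
    have h4 : (ξ n : L2 n) ∈ (Submodule.span ℂ (range (planeWavesL2 : (Fin n → Mom) → L2 n)))ᗮ := by
      rw [Submodule.mem_orthogonal]
      intro u hu
      induction hu using Submodule.span_induction with
      | mem x hx => obtain ⟨K, rfl⟩ := hx; exact h2 K
      | zero => exact inner_zero_left _
      | add x y _ _ hx hy => rw [inner_add_left, hx, hy, add_zero]
      | smul a x _ hx => rw [inner_smul_left, hx, mul_zero]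
    rw [h3] at h4
    exact (Submodule.mem_bot ℂ).mp h4)

lemma slaterBasis_apply (S : Finset Mom) : slaterBasis S = slaterFock S := by
  simp [slaterBasis]

/-! ### Annihilation operators and the particle-hole transformation -/

/-- The sign `(-1)^{#{q ∈ S : q < p}}`. -/
def orderSign (p : Mom) (S : Finset Mom) : ℂ := (-1) ^ (S.filter (· < p)).card

lemma orderSign_mul_self (p : Mom) (S : Finset Mom) : orderSign p S * orderSign p S = 1 := by
  rw [orderSign, ← mul_pow]; simp

lemma norm_orderSign (p : Mom) (S : Finset Mom) : ‖orderSign p S‖ = 1 := by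
  simp [orderSign]

lemma conj_orderSign (p : Mom) (S : Finset Mom) : conj (orderSign p S) = orderSign p S := by
  simp [orderSign]

lemma orderSign_erase (p : Mom) (S : Finset Mom) : orderSign p (S.erase p) = orderSign p S := by
  rw [orderSign, orderSign]
  congr 2
  ext q
  simp only [Finset.mem_filter, Finset.mem_erase]
  constructor
  · rintro ⟨⟨_, h⟩, h'⟩; exact ⟨h, h'⟩
  · rintro ⟨h, h'⟩; exact ⟨⟨h'.ne, h⟩, h'⟩

lemma orderSign_insert (p : Mom) (S : Finset Mom) : orderSign p (insert p S) = orderSign p S := by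
  rw [← orderSign_erase p (insert p S), ← orderSign_erase p S, Finset.erase_insert_eq_erase]

/-- The amplitudes of `a_p ξ` in terms of the amplitudes `f` of `ξ` in the Slater basis. -/
def annihCoeff (p : Mom) (f : Finset Mom → ℂ) (S : Finset Mom) : ℂ :=
  if p ∈ S then 0 else orderSign p S * f (insert p S)

lemma annihCoeff_sum_le (p : Mom) (f : lp (fun _ : Finset Mom => ℂ) 2)
    (s : Finset (Finset Mom)) :
    ∑ S ∈ s, ‖annihCoeff p f S‖ ^ (2 : ℝ≥0∞).toReal ≤ ‖f‖ ^ (2 : ℝ≥0∞).toReal := by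
  have h1 : ∑ S ∈ s, ‖annihCoeff p f S‖ ^ (2 : ℝ≥0∞).toReal
      = ∑ S ∈ s.filter (p ∉ ·), ‖f (insert p S)‖ ^ (2 : ℝ≥0∞).toReal := by
    rw [Finset.sum_filter]
    refine Finset.sum_congr rfl fun S _ => ?_
    by_cases hp : p ∈ S <;> simp [annihCoeff, hp, norm_orderSign]
  have h2 : ∑ S ∈ s.filter (p ∉ ·), ‖f (insert p S)‖ ^ (2 : ℝ≥0∞).toReal
      = ∑ T ∈ (s.filter (p ∉ ·)).image (insert p), ‖f T‖ ^ (2 : ℝ≥0∞).toReal := by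
    rw [Finset.sum_image]
    intro S hS T hT hST
    have hS' : p ∉ S := (Finset.mem_filter.mp hS).2
    have hT' : p ∉ T := (Finset.mem_filter.mp hT).2
    rw [← Finset.erase_insert hS', ← Finset.erase_insert hT']
    exact congrArg (fun U => Finset.erase U p) hST
  rw [h1, h2]
  exact lp.sum_rpow_le_norm_rpow (by simp) f _

/-- `a_p` in the occupation number representation. -/
def annihOcc (p : Mom) :
    lp (fun _ : Finset Mom => ℂ) 2 →L[ℂ] lp (fun _ : Finset Mom => ℂ) 2 :=
  LinearMap.mkContinuous
    { toFun := fun f => ⟨annihCoeff p f, memℓp_gen' (annihCoeff_sum_le p f)⟩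
      map_add' := by
        intro f g
        apply lp.ext
        funext S
        simp only [annihCoeff, lp.coeFn_add, Pi.add_apply]
        split_ifs <;> ring
      map_smul' := by
        intro c f
        apply lp.ext
        funext S
        simp only [annihCoeff, lp.coeFn_smul, Pi.smul_apply, smul_eq_mul, RingHom.id_apply]
        split_ifs <;> ring } 1 (by
    intro f
    rw [one_mul]
    exact lp.norm_le_of_forall_sum_le (by simp) (norm_nonneg f) (annihCoeff_sum_le p f))

/-- The annihilation operator `a_p = a(e_p)` on Fock space: `a_p` removes the plane wave `e_p` from
a Slater determinant, with the sign `(-1)^{j-1}` if `p` is the `j`-th momentum, and vanishes on it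
if `e_p` does not occur. The lemma `inner_planeWaves_annih` below is the usual formula
`(a_p ξ)⁽ⁿ⁾ = √(n+1) ∫ conj(e_p(x)) ξ⁽ⁿ⁺¹⁾(x, ·) dx`, tested against plane waves. -/
def annih (p : Mom) : Fock →L[ℂ] Fock :=
  (slaterBasis.repr.symm.toContinuousLinearEquiv : _ →L[ℂ] Fock) ∘L annihOcc p ∘L
    (slaterBasis.repr.toContinuousLinearEquiv : Fock →L[ℂ] _)

/-- The creation operator `a_p^*`. -/
def creat (p : Mom) : Fock →L[ℂ] Fock := ContinuousLinearMap.adjoint (annih p)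

lemma inner_slaterFock_annih (p : Mom) (S : Finset Mom) (ξ : Fock) :
    inner ℂ (slaterFock S) (annih p ξ)
      = if p ∈ S then 0 else orderSign p S * inner ℂ (slaterFock (insert p S)) ξ := by
  rw [← slaterBasis_apply, ← slaterBasis_apply, ← slaterBasis.repr_apply_apply,
    ← slaterBasis.repr_apply_apply]
  simp [annih, annihOcc, annihCoeff]

lemma Fock.ext_inner {ξ η : Fock}
    (h : ∀ S, inner ℂ (slaterFock S) ξ = (inner ℂ (slaterFock S) η : ℂ)) : ξ = η := by
  apply slaterBasis.repr.injective
  apply lp.ext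
  funext S
  rw [slaterBasis.repr_apply_apply, slaterBasis.repr_apply_apply, slaterBasis_apply, h S]

lemma inner_slaterFock_slaterFock (S T : Finset Mom) :
    inner ℂ (slaterFock S) (slaterFock T) = if S = T then (1 : ℂ) else 0 :=
  orthonormal_iff_ite.mp orthonormal_slaterFock S T

lemma annih_slaterFock (p : Mom) (S : Finset Mom) :
    annih p (slaterFock S) = if p ∈ S then orderSign p S • slaterFock (S.erase p) else 0 := by
  apply Fock.ext_inner
  intro T
  rw [inner_slaterFock_annih, inner_slaterFock_slaterFock]
  by_cases hT : p ∈ T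
  · rw [if_pos hT]
    split_ifs with hS
    · rw [inner_smul_right, inner_slaterFock_slaterFock, if_neg, mul_zero]
      rintro rfl
      simp at hT
    · simp
  · rw [if_neg hT]
    split_ifs with h1 h2 h2
    · subst h1
      rw [inner_smul_right, inner_slaterFock_slaterFock, Finset.erase_insert hT, if_pos rfl,
        orderSign_insert]
    · exact absurd (h1 ▸ Finset.mem_insert_self p T) h2
    · rw [inner_smul_right, inner_slaterFock_slaterFock, if_neg, mul_zero, mul_zero]
      rintro rfl
      exact h1 (Finset.insert_erase h2)
    · simp

lemma creat_slaterFock (p : Mom) (S : Finset Mom) :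
    creat p (slaterFock S) = if p ∈ S then 0 else orderSign p S • slaterFock (insert p S) := by
  apply Fock.ext_inner
  intro T
  rw [creat, ContinuousLinearMap.adjoint_inner_right, annih_slaterFock]
  by_cases hS : p ∈ S
  · rw [if_pos hS, inner_zero_right]
    split_ifs with hT
    · rw [inner_smul_left, inner_slaterFock_slaterFock, if_neg, mul_zero]
      rintro rfl
      simp at hS
    · simp
  · rw [if_neg hS, inner_smul_right, inner_slaterFock_slaterFock]
    split_ifs with hT h2 h2
    · subst h2
      rw [inner_smul_left, inner_slaterFock_slaterFock, Finset.erase_insert hS, if_pos rfl,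
        orderSign_insert, conj_orderSign]
    · rw [inner_smul_left, inner_slaterFock_slaterFock, if_neg, mul_zero, mul_zero]
      rintro rfl
      exact h2 (Finset.insert_erase hT).symm
    · exact absurd (h2 ▸ Finset.mem_insert_self p S) hT
    · simp

/-- The sign `∏_{p ∈ S} (-1)^{#{q ∈ B : q < p}}`. -/
def phSign (B S : Finset Mom) : ℂ := ∏ p ∈ S, orderSign p B

lemma phSign_mul_self (B S : Finset Mom) : phSign B S * phSign B S = 1 := by
  rw [phSign, ← Finset.prod_mul_distrib]
  exact Finset.prod_eq_one fun p _ => orderSign_mul_self p B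

lemma conj_phSign (B S : Finset Mom) : conj (phSign B S) = phSign B S := by
  rw [phSign, map_prod]
  exact Finset.prod_congr rfl fun p _ => conj_orderSign p B

lemma orthonormal_particleHole (B : Finset Mom) :
    Orthonormal ℂ (fun S => phSign B S • slaterFock (symmDiff S B)) := by
  rw [orthonormal_iff_ite]
  intro S T
  rw [inner_smul_left, inner_smul_right, inner_slaterFock_slaterFock, conj_phSign]
  by_cases h : S = T
  · subst h
    simp [phSign_mul_self]
  · rw [if_neg h, if_neg (fun e => h (symmDiff_left_injective B e)), mul_zero, mul_zero]

/-- The orthonormal basis of the images of Slater determinants under the particle-hole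
transformation. -/
def particleHoleBasis (B : Finset Mom) : HilbertBasis (Finset Mom) ℂ Fock :=
  HilbertBasis.mkOfOrthogonalEqBot (orthonormal_particleHole B) (by
    rw [Submodule.eq_bot_iff]
    intro ξ hξ
    apply Fock.ext_inner
    intro S
    have h := (Submodule.mem_orthogonal _ _).mp hξ _ (Submodule.subset_span ⟨symmDiff S B, rfl⟩)
    rw [inner_smul_left, symmDiff_symmDiff_cancel_right, conj_phSign] at h
    have h' := congrArg (phSign B (symmDiff S B) * ·) h
    simp only [← mul_assoc, phSign_mul_self, one_mul, mul_zero] at h'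
    rw [h', inner_zero_right])

/-- The particle-hole transformation `R` for the Fermi ball `B`: the unitary operator on Fock space
with `R Ω = ψ_FS` and `R^* a_p R = a_p` for `p ∉ B`, `R^* a_p R = a_p^*` for `p ∈ B`. -/
def particleHole (B : Finset Mom) : Fock ≃ₗᵢ[ℂ] Fock :=
  slaterBasis.repr.trans (particleHoleBasis B).repr.symm

lemma particleHole_slaterFock (B S : Finset Mom) :
    particleHole B (slaterFock S) = phSign B S • slaterFock (symmDiff S B) := by
  have h : slaterFock S = slaterBasis.repr.symm (lp.single 2 S 1) := by
    rw [slaterBasis.repr_symm_single, slaterBasis_apply]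
  rw [particleHole, LinearIsometryEquiv.trans_apply]
  rw [h, LinearIsometryEquiv.apply_symm_apply, HilbertBasis.repr_symm_single]
  simp [particleHoleBasis]

/-- `R Ω = ψ_FS` -/
lemma particleHole_vacuum (B : Finset Mom) : particleHole B (slaterFock ∅) = slaterFock B := by
  rw [particleHole_slaterFock, ← Finset.bot_eq_empty, bot_symmDiff]
  simp [phSign]

lemma orderSign_symmDiff (p : Mom) (S B : Finset Mom) :
    orderSign p (symmDiff S B) = orderSign p S * orderSign p B := by
  have h1 : (symmDiff S B).filter (· < p)
      = (S.filter (· < p) \ B.filter (· < p)) ∪ (B.filter (· < p) \ S.filter (· < p)) := by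
    ext q
    simp only [Finset.mem_filter, Finset.mem_symmDiff, Finset.mem_union, Finset.mem_sdiff]
    tauto
  rw [orderSign, orderSign, orderSign, h1,
    Finset.card_union_of_disjoint disjoint_sdiff_sdiff, ← pow_add]
  set A := S.filter (· < p)
  set C := B.filter (· < p)
  have h2 := Finset.card_sdiff_add_card_inter A C
  have h3 := Finset.card_sdiff_add_card_inter C A
  rw [Finset.inter_comm] at h3
  have h4 : A.card + C.card = (A \ C).card + (C \ A).card + 2 * (A ∩ C).card := by omega
  rw [h4, pow_add _ _ (2 * _), pow_mul, pow_add]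
  simp

/-- The defining property `a_p R = R a_p^*` for `p ∈ B` and `a_p R = R a_p` for `p ∉ B` of the
particle-hole transformation. -/
lemma annih_particleHole (B : Finset Mom) (p : Mom) (ξ : Fock) :
    annih p (particleHole B ξ)
      = particleHole B (if p ∈ B then creat p ξ else annih p ξ) := by
  let RL : Fock →L[ℂ] Fock := ((particleHole B).toContinuousLinearEquiv : Fock →L[ℂ] Fock)
  have hd : Dense (Submodule.span ℂ (range slaterFock) : Set Fock) := by
    rw [Submodule.dense_iff_topologicalClosure_eq_top]
    have := slaterBasis.dense_span
    rwa [show (⇑slaterBasis : Finset Mom → Fock) = slaterFock from funext slaterBasis_apply] at this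
  have key : annih p ∘L RL = RL ∘L (if p ∈ B then creat p else annih p) := by
    refine ContinuousLinearMap.ext_on hd ?_
    rintro _ ⟨S, rfl⟩
    change annih p (particleHole B (slaterFock S))
      = particleHole B ((if p ∈ B then creat p else annih p) (slaterFock S))
    rw [particleHole_slaterFock, map_smul, annih_slaterFock]
    by_cases hB : p ∈ B
    · rw [if_pos hB, creat_slaterFock]
      by_cases hS : p ∈ S
      · have h : p ∉ symmDiff S B := by simp [Finset.mem_symmDiff, hB, hS]
        simp [h, hS]
      · have h : p ∈ symmDiff S B := by simp [Finset.mem_symmDiff, hB, hS]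
        have h2 : symmDiff (insert p S) B = (symmDiff S B).erase p := by
          ext q
          by_cases hq : q = p
          · subst hq; simp [Finset.mem_symmDiff, hB]
          · simp [Finset.mem_symmDiff, hq]
        rw [if_pos h, if_neg hS, map_smul, particleHole_slaterFock, h2, smul_smul, smul_smul,
          orderSign_symmDiff]
        congr 1
        rw [phSign, phSign, Finset.prod_insert hS]
        ring
    · rw [if_neg hB, annih_slaterFock]
      by_cases hS : p ∈ S
      · have h : p ∈ symmDiff S B := by simp [Finset.mem_symmDiff, hB, hS]
        have h2 : symmDiff (S.erase p) B = (symmDiff S B).erase p := by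
          ext q
          by_cases hq : q = p
          · subst hq; simp [Finset.mem_symmDiff, hB]
          · simp [Finset.mem_symmDiff, hq]
        rw [if_pos h, if_pos hS, map_smul, particleHole_slaterFock, h2, smul_smul, smul_smul,
          orderSign_symmDiff]
        congr 1
        have h3 : phSign B S = orderSign p B * phSign B (S.erase p) := by
          rw [phSign, phSign, Finset.mul_prod_erase S (fun q => orderSign q B) hS]
        have h4 := orderSign_mul_self p B
        rw [h3]
        linear_combination (phSign B (S.erase p) * orderSign p S) * h4
      · have h : p ∉ symmDiff S B := by simp [Finset.mem_symmDiff, hB, hS]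
        simp [h, hS]
  have := congrArg (fun T : Fock →L[ℂ] Fock => T ξ) key
  simp only [ContinuousLinearMap.comp_apply] at this
  refine this.trans ?_
  change particleHole B _ = particleHole B _
  split_ifs <;> rfl

lemma inner_slaterFock_eq (S : Finset Mom) {n : ℕ} (h : S.card = n) (ξ : Fock) :
    inner ℂ (slaterFock S) ξ
      = (Real.sqrt n.factorial : ℂ) * inner ℂ (planeWavesL2 (S.orderEmbOfFin h)) (ξ n : L2 n) := by
  subst h
  rw [inner_slaterFock, inner_slaterL2 S rfl (ξ S.card).2]

lemma orderEmbOfFin_insert {n : ℕ} (S : Finset Mom) (h : S.card = n) {p : Mom} (hp : p ∉ S) :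
    ∃ c : Fin (n + 1), orderSign p S = (-1) ^ (c : ℕ) ∧
      (Fin.cons p (S.orderEmbOfFin h) : Fin (n + 1) → Mom)
        = (insert p S).orderEmbOfFin ((Finset.card_insert_of_notMem hp).trans (congrArg (· + 1) h))
          ∘ c.cycleRange.symm := by
  set T := insert p S
  have hT : T.card = n + 1 := (Finset.card_insert_of_notMem hp).trans (congrArg (· + 1) h)
  obtain ⟨c, hc⟩ : ∃ c, T.orderEmbOfFin hT c = p := by
    have : p ∈ Set.range (T.orderEmbOfFin hT) := by
      rw [Finset.range_orderEmbOfFin]; exact_mod_cast Finset.mem_insert_self p S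
    exact this
  refine ⟨c, ?_, ?_⟩
  · rw [orderSign]
    congr 1
    have : S.filter (· < p) = (Finset.univ.filter (· < c)).image (T.orderEmbOfFin hT) := by
      ext q
      simp only [Finset.mem_filter, Finset.mem_image, Finset.mem_univ, true_and]
      constructor
      · rintro ⟨hq, hqp⟩
        have : q ∈ Set.range (T.orderEmbOfFin hT) := by
          rw [Finset.range_orderEmbOfFin]; exact_mod_cast Finset.mem_insert_of_mem hq
        obtain ⟨j, rfl⟩ := this
        refine ⟨j, ?_, rfl⟩
        rw [← hc] at hqp
        exact (T.orderEmbOfFin hT).lt_iff_lt.mp hqp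
      · rintro ⟨j, hj, rfl⟩
        have hlt : T.orderEmbOfFin hT j < p := by
          rw [← hc]; exact (T.orderEmbOfFin hT).lt_iff_lt.mpr hj
        refine ⟨?_, hlt⟩
        exact (Finset.mem_insert.mp (T.orderEmbOfFin_mem hT j)).resolve_left hlt.ne
    rw [this, Finset.card_image_of_injective _ (T.orderEmbOfFin hT).injective,
      show (Finset.univ.filter (· < c)) = Finset.Iio c by ext j; simp, Fin.card_Iio]
  · rw [← Fin.cons_removeNth_eq_comp_cycleRange_symm, hc]
    congr 1
    symm
    apply Finset.orderEmbOfFin_unique h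
    · intro j
      refine (Finset.mem_insert.mp (T.orderEmbOfFin_mem hT (c.succAbove j))).resolve_left ?_
      intro e
      rw [← hc] at e
      exact Fin.succAbove_ne c j ((T.orderEmbOfFin hT).injective e)
    · intro i j hij
      exact (T.orderEmbOfFin hT).strictMono (Fin.strictMono_succAbove c hij)

/-- `(a_p ξ)⁽ⁿ⁾ = √(n+1) ∫ conj(e_p(x)) ξ⁽ⁿ⁺¹⁾(x, ·) dx`, tested against plane waves. -/
lemma inner_planeWaves_annih (p : Mom) (ξ : Fock) (n : ℕ) (K : Fin n → Mom) :
    inner ℂ (planeWavesL2 K) (annih p ξ n : L2 n)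
      = (Real.sqrt (n + 1) : ℂ) *
        inner ℂ (planeWavesL2 (Fin.cons p K : Fin (n + 1) → Mom)) (ξ (n + 1) : L2 (n + 1)) := by
  by_cases hK : Function.Injective K
  · obtain ⟨S, h, σ, rfl⟩ := exists_orderEmb_comp hK
    have hσ : (Fin.cons p (S.orderEmbOfFin h ∘ σ) : Fin (n + 1) → Mom)
        = (Fin.cons p (S.orderEmbOfFin h) : Fin (n + 1) → Mom)
          ∘ (Equiv.Perm.decomposeFin.symm (0, σ)) := by
      ext1 i
      refine Fin.cases ?_ (fun j => ?_) i
      · simp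
      · simp
    rw [hσ, inner_planeWaves_comp (annih p ξ n).2, inner_planeWaves_comp (ξ (n + 1)).2,
      Equiv.Perm.decomposeFin.symm_sign, if_pos rfl, one_mul]
    have hn : (Real.sqrt n.factorial : ℂ) ≠ 0 := by
      rw [Complex.ofReal_ne_zero]
      exact (Real.sqrt_pos.mpr (by exact_mod_cast n.factorial_pos)).ne'
    have h1 := inner_slaterFock_eq S h (annih p ξ)
    rw [inner_slaterFock_annih] at h1
    by_cases hp : p ∈ S
    · rw [if_pos hp] at h1
      rw [(mul_eq_zero.mp h1.symm).resolve_left hn, inner_planeWaves_of_not_injective (ξ (n + 1)).2]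
      · simp
      · intro hinj
        have : p ∈ Set.range (S.orderEmbOfFin h) := by
          rw [Finset.range_orderEmbOfFin]; exact_mod_cast hp
        obtain ⟨j, hj⟩ := this
        have h0 : (0 : Fin (n + 1)) = j.succ := hinj (by simp [hj])
        exact (Fin.succ_ne_zero j) h0.symm
    · obtain ⟨c, hc1, hc2⟩ := orderEmbOfFin_insert S h hp
      rw [if_neg hp, inner_slaterFock_eq (insert p S)
        ((Finset.card_insert_of_notMem hp).trans (congrArg (· + 1) h))] at h1
      rw [hc2, inner_planeWaves_comp (ξ (n + 1)).2, Equiv.Perm.sign_symm, Fin.sign_cycleRange]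
      have hs : (((((-1 : ℤˣ) ^ (c : ℕ) : ℤˣ)) : ℤ) : ℂ) = orderSign p S := by
        rw [hc1]; simp
      rw [hs]
      have hf : (Real.sqrt (n + 1).factorial : ℂ)
          = (Real.sqrt n.factorial : ℂ) * (Real.sqrt (n + 1) : ℂ) := by
        rw [← Complex.ofReal_mul, ← Real.sqrt_mul (Nat.cast_nonneg _), Nat.factorial_succ]
        push_cast
        rw [mul_comm]
      rw [hf] at h1
      apply mul_left_cancel₀ hn
      linear_combination (-((Equiv.Perm.sign σ : ℤ) : ℂ)) * h1
  · rw [inner_planeWaves_of_not_injective (annih p ξ n).2 hK,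
      inner_planeWaves_of_not_injective (ξ (n + 1)).2, mul_zero]
    intro hinj
    apply hK
    intro a b hab
    have : (a.succ : Fin (n + 1)) = b.succ := hinj (by simpa using hab)
    exact Fin.succ_injective _ this

/-! ### The Fermi ball, the Hamiltonian and the operators of the a priori bounds -/

lemma finite_ball (r : ℝ) : {p : Mom | normSq p < r ^ 2}.Finite := by
  have h : ((Finset.Icc (-⌈|r|⌉) ⌈|r|⌉ ×ˢ Finset.Icc (-⌈|r|⌉) ⌈|r|⌉ : Finset (ℤ × ℤ)) :
      Set (ℤ × ℤ)).Finite := Finset.finite_toSet _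
  refine (h.preimage (f := ofLex) ofLex.injective.injOn).subset ?_
  intro p hp
  have hp' : ((ofLex p).1 : ℝ) ^ 2 + ((ofLex p).2 : ℝ) ^ 2 < r ^ 2 := hp
  have h1 : |((ofLex p).1 : ℝ)| ≤ |r| := by
    apply sq_le_sq.mp; nlinarith [sq_nonneg ((ofLex p).2 : ℝ)]
  have h2 : |((ofLex p).2 : ℝ)| ≤ |r| := by
    apply sq_le_sq.mp; nlinarith [sq_nonneg ((ofLex p).1 : ℝ)]
  have key : ∀ a : ℤ, |(a : ℝ)| ≤ |r| → -⌈|r|⌉ ≤ a ∧ a ≤ ⌈|r|⌉ := by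
    intro a ha
    have h3 : |(a : ℝ)| ≤ (⌈|r|⌉ : ℝ) := ha.trans (Int.le_ceil _)
    rw [abs_le] at h3
    exact ⟨by exact_mod_cast h3.1, by exact_mod_cast h3.2⟩
  simp only [Set.mem_preimage, Finset.mem_coe, Finset.mem_product, Finset.mem_Icc]
  exact ⟨key _ h1, key _ h2⟩

/-- The Fermi ball `B_F = {p ∈ ℤ² : |p| < k_F}`. -/
def fermiBall (kF : ℝ) : Finset Mom := (finite_ball kF).toFinset

/-- `N` particles fill up the Fermi ball of radius `k_F`, and `k_F²` is the arithmetic mean of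
`inf {|p|² : p ∉ B_F}` and `sup {|q|² : q ∈ B_F}`. -/
structure IsFermiMomentum (N : ℕ) (kF : ℝ) : Prop where
  pos : 0 < kF
  card_eq : (fermiBall kF).card = N
  sq_eq : kF ^ 2 = (sInf (normSq '' {p | p ∉ fermiBall kF})
    + sSup (normSq '' {q | q ∈ fermiBall kF})) / 2

/-- The effective Planck constant `ħ = N^{-1/2}`. -/
def hbar (N : ℕ) : ℝ := (N : ℝ) ^ (-(1 / 2) : ℝ)

/-- `φ = ∑_j (-Δ_{x_j}) ψ` in `L²((𝕋²)ⁿ)`, that is, the Fourier coefficients of `φ` are those of `ψ`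
multiplied by `∑_j |K_j|²`. Given `ψ`, such a `φ` exists if and only if `ψ` belongs to the Sobolev
space `H²`, the domain of the Laplacian, and it is unique. -/
def IsNegLaplacian {n : ℕ} (ψ φ : L2 n) : Prop :=
  ∀ K : Fin n → Mom,
    inner ℂ (planeWavesL2 K) φ = ((∑ j, normSq (K j) : ℝ) : ℂ) * inner ℂ (planeWavesL2 K) ψ

/-- The interaction potential `∑_{i < j} V(x_i - x_j)`. -/
def pairPotential (V : Torus2 → ℝ) {n : ℕ} (x : Config n) : ℝ :=
  ∑ i : Fin n, ∑ j : Fin n, if i < j then V (x i - x j) else 0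

/-- `ψ` is an eigenvector of `H_N = ħ² ∑_j (-Δ_{x_j}) + N⁻¹ ∑_{i < j} V(x_i - x_j)`: it is nonzero,
lies in the domain of the Laplacian, and `H_N ψ = E ψ` for some `E`. -/
def IsEigenvector (V : Torus2 → ℝ) {N : ℕ} (ψ : L2 N) : Prop :=
  ψ ≠ 0 ∧ ∃ (E : ℂ) (φ : L2 N), IsNegLaplacian ψ φ ∧
    ∀ᵐ x : Config N, ((hbar N ^ 2 : ℝ) : ℂ) * φ x
      + (((N : ℝ)⁻¹ * pairPotential V x : ℝ) : ℂ) * ψ x = E * ψ x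

/-- The kinetic energy `⟨ψ, ∑_j (-Δ_{x_j}) ψ⟩` is finite, i.e. `ψ ∈ H¹((𝕋²)ⁿ)`. -/
def FiniteKinetic {n : ℕ} (ψ : L2 n) : Prop :=
  Summable fun K : Fin n → Mom => (∑ j, normSq (K j)) * ‖inner ℂ (planeWavesL2 K) ψ‖ ^ 2

/-- The energy `⟨ψ, H_N ψ⟩` as a quadratic form, for `ψ` of finite kinetic energy. -/
def energy (V : Torus2 → ℝ) {N : ℕ} (ψ : L2 N) : ℝ :=
  hbar N ^ 2 * ∑' K : Fin N → Mom, (∑ j, normSq (K j)) * ‖inner ℂ (planeWavesL2 K) ψ‖ ^ 2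
    + (N : ℝ)⁻¹ * ∫ x : Config N, pairPotential V x * ‖ψ x‖ ^ 2

/-- The energy `E_FS = ⟨ψ_FS, H_N ψ_FS⟩` of the Fermi sea, the Slater determinant of all plane waves
with momenta in the Fermi ball. -/
def energyFS (V : Torus2 → ℝ) {N : ℕ} {kF : ℝ} (hF : IsFermiMomentum N kF) : ℝ :=
  energy V (slaterL2 (fermiBall kF) hF.card_eq)

/-- `ξ` belongs to the approximate ground state `R ξ`, with constant `C₀`: `ξ` is normalized, `R ξ`
is an `N`-particle vector and `⟨R ξ, H_N R ξ⟩ - E_FS ≤ C₀ ħ`. -/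
structure BelongsToApproxGS (V : Torus2 → ℝ) (C₀ : ℝ) {N : ℕ} {kF : ℝ}
    (hF : IsFermiMomentum N kF) (ξ : Fock) : Prop where
  norm_eq : ‖ξ‖ = 1
  sector : ∀ n, n ≠ N → particleHole (fermiBall kF) ξ n = 0
  finite : FiniteKinetic (particleHole (fermiBall kF) ξ N : L2 N)
  energy_le : energy V (particleHole (fermiBall kF) ξ N : L2 N) - energyFS V hF ≤ C₀ * hbar N

/-- The expectation value `⟨ξ, 𝒩^m (∑_p w(p) a_p^* a_p) ξ⟩ ∈ [0, ∞]` for `w ≥ 0`. The number operator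
`𝒩 = ∑_p a_p^* a_p` acts as multiplication by `n` on the `n`-particle component of `ξ` (see
`tsum_norm_annih_sq`), hence the expectation value is `∑_n n^m ∑_p w(p) ‖a_p ξ⁽ⁿ⁾‖²`. -/
def expectation (m : ℕ) (w : Mom → ℝ) (ξ : Fock) : ℝ≥0∞ :=
  ∑' n : ℕ, (n : ℝ≥0∞) ^ m *
    ∑' p : Mom, ENNReal.ofReal (w p * ‖annih p (lp.single 2 n (ξ n))‖ ^ 2)

/-- `⟨ξ, 𝒩^m ξ⟩ ∈ [0, ∞]` -/
def expNumber (m : ℕ) (ξ : Fock) : ℝ≥0∞ :=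
  ∑' n : ℕ, (n : ℝ≥0∞) ^ m * ENNReal.ofReal (‖ξ n‖ ^ 2)

lemma ofReal_norm_sq (η : Fock) :
    ENNReal.ofReal (‖η‖ ^ 2) = ∑' T, ENNReal.ofReal (‖inner ℂ (slaterFock T) η‖ ^ 2) := by
  have h0 := lp.hasSum_norm (p := 2) (by simp) (slaterBasis.repr η)
  simp only [slaterBasis.repr_apply_apply, slaterBasis_apply, LinearIsometryEquiv.norm_map,
    ENNReal.toReal_ofNat, Real.rpow_ofNat] at h0
  rw [← h0.tsum_eq, ENNReal.ofReal_tsum_of_nonneg (fun _ => by positivity) h0.summable]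

lemma ofReal_norm_annih_sq (p : Mom) (η : Fock) :
    ENNReal.ofReal (‖annih p η‖ ^ 2)
      = ∑' T, if p ∈ T then ENNReal.ofReal (‖inner ℂ (slaterFock T) η‖ ^ 2) else 0 := by
  rw [ofReal_norm_sq]
  let g : Finset Mom → ℝ≥0∞ := fun T => ENNReal.ofReal (‖inner ℂ (slaterFock T) η‖ ^ 2)
  have h1 : ∀ S, ENNReal.ofReal (‖inner ℂ (slaterFock S) (annih p η)‖ ^ 2)
      = {S : Finset Mom | p ∉ S}.indicator (fun S => g (insert p S)) S := by
    intro S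
    rw [inner_slaterFock_annih]
    by_cases hp : p ∈ S <;> simp [hp, g, norm_orderSign]
  have h2 : ∀ T, (if p ∈ T then ENNReal.ofReal (‖inner ℂ (slaterFock T) η‖ ^ 2) else 0)
      = {T : Finset Mom | p ∈ T}.indicator g T := by
    intro T
    by_cases hp : p ∈ T <;> simp [hp, g]
  simp_rw [h1, h2]
  rw [← tsum_subtype, ← tsum_subtype]
  let e : {S : Finset Mom | p ∉ S} ≃ {T : Finset Mom | p ∈ T} :=
    { toFun := fun S => ⟨insert p S.1, Finset.mem_insert_self _ _⟩
      invFun := fun T => ⟨T.1.erase p, Finset.notMem_erase _ _⟩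
      left_inv := fun S => Subtype.ext (Finset.erase_insert S.2)
      right_inv := fun T => Subtype.ext (Finset.insert_erase T.2) }
  exact e.tsum_eq (fun T => g T.1)

/-- `⟨η, (∑_p w(p) a_p^* a_p) η⟩ = ∑_T (∑_{p ∈ T} w(p)) |⟨Slater_T, η⟩|²` -/
lemma tsum_norm_annih_sq_mul (w : Mom → ℝ) (η : Fock) :
    ∑' p : Mom, ENNReal.ofReal (w p * ‖annih p η‖ ^ 2)
      = ∑' T : Finset Mom, (∑ p ∈ T, ENNReal.ofReal (w p))
        * ENNReal.ofReal (‖inner ℂ (slaterFock T) η‖ ^ 2) := by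
  simp_rw [fun p => ENNReal.ofReal_mul' (p := w p) (sq_nonneg ‖annih p η‖), ofReal_norm_annih_sq,
    ← ENNReal.tsum_mul_left]
  rw [ENNReal.tsum_comm]
  refine tsum_congr fun T => ?_
  rw [tsum_eq_sum (s := T) (fun p hp => by rw [if_neg hp, mul_zero]), Finset.sum_mul]
  exact Finset.sum_congr rfl fun p hp => by rw [if_pos hp]

/-- `𝒩 = ∑_p a_p^* a_p` acts as multiplication by `n` on `n`-particle vectors. -/
lemma tsum_norm_annih_sq (n : ℕ) (ψ : antisym n) :
    ∑' p : Mom, ENNReal.ofReal (1 * ‖annih p (lp.single 2 n ψ)‖ ^ 2)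
      = n * ENNReal.ofReal (‖ψ‖ ^ 2) := by
  have hn : ‖ψ‖ = ‖(lp.single 2 n ψ : Fock)‖ :=
    (lp.norm_single (E := fun n : ℕ => antisym n) (p := 2) two_pos n ψ).symm
  rw [tsum_norm_annih_sq_mul (fun _ => 1), hn, ofReal_norm_sq, ← ENNReal.tsum_mul_left]
  refine tsum_congr fun T => ?_
  by_cases hT : T.card = n
  · simp [hT]
  · have : (lp.single 2 n ψ : Fock) T.card = 0 := lp.single_apply_ne _ _ _ hT
    rw [inner_slaterFock, this]
    simp

lemma expectation_one (m : ℕ) (ξ : Fock) : expectation m (fun _ => 1) ξ = expNumber (m + 1) ξ := by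
  rw [expectation, expNumber]
  refine tsum_congr fun n => ?_
  rw [tsum_norm_annih_sq, ← mul_assoc, ← pow_succ]

/-- The excitation energy `e(p) = ħ² ||p|² - k_F²|`. -/
def excitationEnergy (N : ℕ) (kF : ℝ) (p : Mom) : ℝ := hbar N ^ 2 * |normSq p - kF ^ 2|

/-- `⟨ξ, 𝒩^m ℍ₀ ξ⟩` with `ℍ₀ = ∑_p e(p) a_p^* a_p`. -/
def expH0 (N : ℕ) (kF : ℝ) (m : ℕ) (ξ : Fock) : ℝ≥0∞ :=
  expectation m (excitationEnergy N kF) ξ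

/-- The gap `𝒢_δ = {p : e(p) ≤ ħ N^{-δ}}`. -/
def gap (N : ℕ) (kF δ : ℝ) : Set Mom := {p | excitationEnergy N kF p ≤ hbar N * (N : ℝ) ^ (-δ)}

/-- `⟨ξ, 𝒩^m 𝒩_δ ξ⟩` with the gapped number operator `𝒩_δ = ∑_{p ∉ 𝒢_δ} a_p^* a_p`. -/
def expGapped (N : ℕ) (kF δ : ℝ) (m : ℕ) (ξ : Fock) : ℝ≥0∞ :=
  expectation m (Set.indicator (gap N kF δ)ᶜ fun _ => 1) ξ

end

end FermiGas

/-! ### Divisor bound in the Gaussian integers. -/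

namespace FermiGas
open UniqueFactorizationMonoid

/-! Everything is computed in the plane wave coefficients `c K` of the `N`-particle vector `ψ = R
ξ`. Since `R` maps the Slater determinant of `T` to that of the symmetric difference of `T` with the
Fermi ball `B`, up to a sign, both `𝒩` and `ℍ₀` become multiplication operators. For a configuration
with set of momenta `S`, `𝒩` is the cardinality of `S △ B`, which is twice the number of particles
outside `B`; `ℍ₀` is the kinetic energy minus that of the Fermi sea, because `S` and `B` have
equally many elements and the terms `k_F²` cancel (`excessKinetic_eq`).

First moment. Mode by mode, `∑_{i ≠ j} exp(i k·(x_i - x_j)) = |∑_j exp(i k·x_j)|² - N ≥ -N`. In the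
Fermi sea, for `k ≠ 0`, the expectation is `-N` plus the number of `p ∈ B` with `p + k ∉ B`, a
surface term of order `|k| √N` (`IsFermiMomentum.exitCount_le`). As the Fourier coefficients of `V`
are nonnegative and `∑ |k| V̂(k)` converges, the interaction falls below that of the Fermi sea by at
most `O(ħ)`, whence `⟨ℍ₀⟩ = O(ħ)` (`IsFermiMomentum.tsum_excessKinetic_le`). Outside the gap a
particle costs at least `ħ N^{-δ}`, which controls `𝒩_δ`. For `𝒩`, take the gap with `δ = 1/4`:
there `|p|²` takes `O(N^{1/4})` integer values, each on `O(N^ε)` lattice points by the divisor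
bound, and by the Pauli principle each momentum carries at most one excitation.

Higher moments. For an eigenvector the equation is tested against `g² ψ`, where `g` is `𝒩`. The
localization formula `re_hop_sq_ge` replaces the interaction by its expectation in `g ψ`, to which
the previous lower bound applies, at the cost of a double commutator. The latter is estimated by a
weighted Schur test (`double_commutator_le`): transfers of momentum `k` that lower `g` are few, of
order `g²`, while those that raise it can number about `|k|² N`; giving them the weights `λ` and
`1/λ` with `λ = |k| √N` makes both contributions of order `λ (g + 1)²`. This yields `⟨𝒩² ℍ₀⟩ ≤ C ħ
⟨(𝒩 + 1)²⟩`.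

The estimates close by a bootstrap (`moment_bootstrap`): the gap count bounds `⟨𝒩²⟩` by `⟨𝒩⟩` and
`⟨𝒩 ℍ₀⟩`, the latter is interpolated between `⟨ℍ₀⟩` and `⟨𝒩² ℍ₀⟩`, and the resulting fraction of
`⟨𝒩²⟩` is absorbed. -/

lemma add_one_le_mul_two_rpow {ε : ℝ} (hε : 0 < ε) (a : ℕ) :
    (a : ℝ) + 1 ≤ (1 + (ε * Real.log 2)⁻¹) * (2 : ℝ) ^ (ε * a) := by
  have hl : 0 < ε * Real.log 2 := mul_pos hε (Real.log_pos one_lt_two)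
  have h1 : 1 + ε * Real.log 2 * a ≤ (2 : ℝ) ^ (ε * a) := by
    rw [Real.rpow_def_of_pos two_pos]
    have := Real.add_one_le_exp (Real.log 2 * (ε * a))
    linarith
  have ha : (0 : ℝ) ≤ a := Nat.cast_nonneg a
  calc (a : ℝ) + 1 ≤ (1 + (ε * Real.log 2)⁻¹) * (1 + ε * Real.log 2 * a) := by
        have : (ε * Real.log 2)⁻¹ * (ε * Real.log 2) = 1 := inv_mul_cancel₀ hl.ne'
        have h3 : 0 < (ε * Real.log 2)⁻¹ := inv_pos.mpr hl
        have h4 : 0 ≤ ε * Real.log 2 * a := by positivity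
        nlinarith
    _ ≤ _ := by gcongr

/-- Gaussian integers with real and imaginary part at most `m` in absolute value. -/
noncomputable def gaussianBox (m : ℤ) : Finset GaussianInt :=
  (Finset.Icc (-m) m ×ˢ Finset.Icc (-m) m).image fun z => ⟨z.1, z.2⟩

/-- An integer satisfies `|a| ≤ a²`, so a bound on the norm bounds the coordinates directly, without
square roots. -/
lemma mem_gaussianBox {m : ℤ} {z : GaussianInt} (h : z.norm ≤ m) : z ∈ gaussianBox m := by
  have h0 : z.norm = z.re * z.re + z.im * z.im := by rw [Zsqrtd.norm_def]; ring
  refine Finset.mem_image.mpr ⟨(z.re, z.im), ?_, rfl⟩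
  have key : ∀ a b : ℤ, a * a + b * b ≤ m → -m ≤ a ∧ a ≤ m := fun a b hab => by
    constructor
    · rcases le_or_gt a 0 with h | h <;> nlinarith [mul_self_nonneg b]
    · rcases le_or_gt a 0 with h | h <;> nlinarith [mul_self_nonneg b]
  simp only [Finset.mem_product, Finset.mem_Icc]
  exact ⟨key _ _ (h0 ▸ h), key _ z.re (by linarith)⟩

lemma gaussian_norm_ge_two {z : GaussianInt} (hz : Prime z) : 2 ≤ z.norm := by
  have h1 : 0 < z.norm := GaussianInt.norm_pos.mpr hz.ne_zero
  have h2 : z.norm ≠ 1 := fun h => hz.not_isUnit ((Zsqrtd.norm_eq_one_iff' (by norm_num) z).mp h)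
  omega

/-- A divisor bound for multisets of Gaussian primes. -/
lemma exists_prod_count_le {ε : ℝ} (hε : 0 < ε) : ∃ C : ℝ, 1 ≤ C ∧
    ∀ s : Multiset GaussianInt, (∀ z ∈ s, Prime z) →
      ((∏ z ∈ s.toFinset, (s.count z + 1) : ℕ) : ℝ)
        ≤ C * (((s.map Zsqrtd.norm).prod : ℤ) : ℝ) ^ ε := by
  -- A prime of norm at least `m ≥ 2^{1/ε}` has norm to the power `ε` at least `2`, so its factor
  -- `count + 1 ≤ 2 ^ count` costs no constant. Only the boundedly many primes in `gaussianBox m`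
  -- cost a factor `K`.
  obtain ⟨m, hm⟩ := exists_nat_ge ((2 : ℝ) ^ ε⁻¹)
  set K : ℝ := 1 + (ε * Real.log 2)⁻¹ with hK
  have hK1 : 1 ≤ K := by
    have : 0 < ε * Real.log 2 := mul_pos hε (Real.log_pos one_lt_two)
    have := inv_pos.mpr this
    linarith
  refine ⟨K ^ (gaussianBox m).card, one_le_pow₀ hK1, fun s hs => ?_⟩
  have hterm : ∀ z ∈ s.toFinset, ((s.count z : ℝ) + 1)
      ≤ (if z ∈ gaussianBox m then K else 1) * ((z.norm : ℝ) ^ (s.count z)) ^ ε := by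
    intro z hz
    have h2 : (2 : ℝ) ≤ z.norm := by
      exact_mod_cast gaussian_norm_ge_two (hs z (Multiset.mem_toFinset.mp hz))
    have h0 : (0 : ℝ) ≤ z.norm := by linarith
    rw [← Real.rpow_natCast, ← Real.rpow_mul h0, mul_comm (s.count z : ℝ) ε]
    split_ifs with hb
    · refine (add_one_le_mul_two_rpow hε _).trans ?_
      gcongr
    · have h3 : (m : ℝ) ≤ z.norm := by
        by_contra hlt
        push Not at hlt
        exact hb (mem_gaussianBox (by exact_mod_cast hlt.le))
      have h4 : (2 : ℝ) ≤ (z.norm : ℝ) ^ ε := by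
        calc (2 : ℝ) = ((2 : ℝ) ^ ε⁻¹) ^ ε := by
              rw [← Real.rpow_mul two_pos.le, inv_mul_cancel₀ hε.ne', Real.rpow_one]
          _ ≤ _ := by
              apply Real.rpow_le_rpow (by positivity) (hm.trans h3) hε.le
      rw [one_mul, Real.rpow_mul h0, Real.rpow_natCast]
      calc ((s.count z : ℝ) + 1) ≤ 2 ^ (s.count z) := by
            exact_mod_cast Nat.succ_le_of_lt (Nat.lt_two_pow_self)
        _ ≤ _ := by gcongr
  rw [Nat.cast_prod]
  simp only [Nat.cast_add, Nat.cast_one]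
  refine (Finset.prod_le_prod (fun _ _ => by positivity) hterm).trans ?_
  rw [Finset.prod_mul_distrib]
  have hnn : ∀ z : GaussianInt, (0 : ℝ) ≤ z.norm := fun z => by
    exact_mod_cast GaussianInt.norm_nonneg z
  have hprod : ∏ z ∈ s.toFinset, ((z.norm : ℝ) ^ (s.count z)) ^ ε
      = (((s.map Zsqrtd.norm).prod : ℤ) : ℝ) ^ ε := by
    rw [Real.finsetProd_rpow _ _ (fun z _ => by have := hnn z; positivity),
      Finset.prod_multiset_map_count, Int.cast_prod]
    simp only [Int.cast_pow]
  rw [hprod]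
  have hpp : (0 : ℝ) ≤ (((s.map Zsqrtd.norm).prod : ℤ) : ℝ) ^ ε := by
    rw [← hprod]
    exact Finset.prod_nonneg fun z _ => by have := hnn z; positivity
  gcongr
  rw [Finset.prod_ite, Finset.prod_const_one, mul_one, Finset.prod_const]
  exact pow_le_pow_right₀ hK1 (Finset.card_le_card fun z hz => (Finset.mem_filter.mp hz).2)

/-- The number of Gaussian integers of norm `n` is `O(n^ε)`. -/
lemma exists_card_norm_eq_le {ε : ℝ} (hε : 0 < ε) : ∃ C : ℝ, 1 ≤ C ∧
    ∀ (n : ℕ), 0 < n → ∀ S : Finset GaussianInt, (∀ z ∈ S, z.norm = n) →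
      (S.card : ℝ) ≤ C * (n : ℝ) ^ ε := by
  classical
  let _ : StrongNormalizationMonoid GaussianInt :=
    UniqueFactorizationMonoid.strongNormalizationMonoid
  -- The exponent is halved because the Gaussian integer `n` has norm `n²`.
  obtain ⟨C, hC1, hC⟩ := exists_prod_count_le (half_pos hε)
  refine ⟨(gaussianBox 1).card * C, ?_, ?_⟩
  · have : 1 ≤ (gaussianBox 1).card := Finset.card_pos.mpr ⟨0, mem_gaussianBox (by simp)⟩
    have : (1 : ℝ) ≤ (gaussianBox 1).card := by exact_mod_cast this
    nlinarith
  intro n hn S hS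
  have hn0 : (n : GaussianInt) ≠ 0 := by exact_mod_cast hn.ne'
  set s := normalizedFactors (n : GaussianInt) with hs
  have hS0 : ∀ z ∈ S, z ≠ 0 := by
    rintro z hz rfl
    have := hS 0 hz
    simp at this
    omega
  -- From `z * star z = n`, `z` divides `n`, so its prime factors form a submultiset of those of
  -- `n`.
  have hmaps : ∀ z ∈ S, normalizedFactors z ∈ Finset.Iic s := by
    intro z hz
    rw [Finset.mem_Iic]
    have hd : z ∣ (n : GaussianInt) := ⟨star z, by
      rw [← Zsqrtd.norm_eq_mul_conj, hS z hz]; simp⟩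
    exact (dvd_iff_normalizedFactors_le_normalizedFactors (hS0 z hz) hn0).mp hd
  -- Elements with the same prime factors differ by a unit, and units lie in `gaussianBox 1`. The
  -- number of possible `t`, by `Multiset.card_Iic`, is the product bounded in
  -- `exists_prod_count_le`.
  have hfib : ∀ t ∈ Finset.Iic s, (S.filter fun z => normalizedFactors z = t).card
      ≤ (gaussianBox 1).card := by
    intro t _
    rcases (S.filter fun z => normalizedFactors z = t).eq_empty_or_nonempty with he | ⟨w, hw⟩
    · simp [he]
    have hw' := Finset.mem_filter.mp hw
    refine Finset.card_le_card_of_surjOn (fun u => w * u) ?_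
    intro z hz
    have hz' := Finset.mem_filter.mp hz
    have hassoc : Associated w z :=
      (associated_iff_normalizedFactors_eq_normalizedFactors (hS0 w hw'.1) (hS0 z hz'.1)).mpr
        (hw'.2.trans hz'.2.symm)
    obtain ⟨u, hu⟩ := hassoc
    refine ⟨u, ?_, hu⟩
    apply mem_gaussianBox
    exact ((Zsqrtd.norm_eq_one_iff' (by norm_num) _).mpr u.isUnit).le
  have h1 := Finset.card_le_mul_card_image_of_maps_to hmaps _ hfib
  rw [Multiset.card_Iic] at h1
  have hnorm : (((s.map Zsqrtd.norm).prod : ℤ) : ℝ) = (n : ℝ) ^ 2 := by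
    have h2 : (s.map Zsqrtd.norm).prod = Zsqrtd.norm s.prod :=
      (map_multiset_prod Zsqrtd.normMonoidHom s).symm
    have h3 : Zsqrtd.norm s.prod = Zsqrtd.norm (n : GaussianInt) :=
      Zsqrtd.norm_eq_of_associated (by norm_num) (prod_normalizedFactors hn0)
    rw [h2, h3]
    simp [Zsqrtd.norm_natCast]
    ring
  have h4 := hC s fun z hz => prime_of_normalized_factor z hz
  rw [hnorm, ← Real.rpow_natCast, ← Real.rpow_mul (Nat.cast_nonneg n)] at h4
  have h5 : ((2 : ℕ) : ℝ) * (ε / 2) = ε := by push_cast; ring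
  rw [h5] at h4
  calc (S.card : ℝ) ≤ ((gaussianBox 1).card * (∏ z ∈ s.toFinset, (s.count z + 1) : ℕ) : ℝ) := by
        exact_mod_cast h1
    _ ≤ (gaussianBox 1).card * (C * (n : ℝ) ^ ε) := by gcongr
    _ = _ := by ring

end FermiGas

/-! ### Lattice points of the Fermi ball: surface and gap counts. -/

namespace FermiGas

lemma mem_fermiBall {kF : ℝ} {p : Mom} : p ∈ fermiBall kF ↔ normSq p < kF ^ 2 := by
  simp [fermiBall]

lemma normSq_nonneg (p : Mom) : 0 ≤ normSq p := by
  unfold normSq; positivity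

/-- `|p|²` as a natural number. -/
def natNormSq (p : Mom) : ℕ := ((ofLex p).1 ^ 2 + (ofLex p).2 ^ 2).natAbs

lemma cast_natNormSq (p : Mom) : (natNormSq p : ℝ) = normSq p := by
  have h : ((natNormSq p : ℕ) : ℤ) = (ofLex p).1 ^ 2 + (ofLex p).2 ^ 2 := by
    rw [natNormSq]
    exact Int.natAbs_of_nonneg (by positivity)
  have h2 : ((natNormSq p : ℤ) : ℝ) = normSq p := by rw [h, normSq]; push_cast; rfl
  exact_mod_cast h2

lemma one_le_normSq {k : Mom} (hk : k ≠ 0) : 1 ≤ normSq k := by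
  rw [← cast_natNormSq]
  have : natNormSq k ≠ 0 := by
    intro h
    apply hk
    rw [natNormSq, Int.natAbs_eq_zero] at h
    have h1 : (ofLex k).1 = 0 := by nlinarith [sq_nonneg (ofLex k).1, sq_nonneg (ofLex k).2]
    have h2 : (ofLex k).2 = 0 := by nlinarith [sq_nonneg (ofLex k).1, sq_nonneg (ofLex k).2]
    exact ofLex.injective (Prod.ext h1 h2)
  exact_mod_cast Nat.one_le_iff_ne_zero.mpr this

lemma IsFermiMomentum.one_le {N : ℕ} {kF : ℝ} (hF : IsFermiMomentum N kF) : 1 ≤ N := by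
  rw [← hF.card_eq]
  refine Finset.card_pos.mpr ⟨0, mem_fermiBall.mpr ?_⟩
  have := hF.pos
  simp [normSq]
  positivity

/-- The lattice square with half side `m = ⌊k_F / 2⌋` fits into the Fermi ball, so `(2 m + 1)² ≤ N`,
while `k_F < 2 m + 2 ≤ 2 (2 m + 1)`. -/
lemma IsFermiMomentum.le_sqrt {N : ℕ} {kF : ℝ} (hF : IsFermiMomentum N kF) :
    kF ≤ 2 * Real.sqrt N := by
  set m := ⌊kF / 2⌋₊
  have hm : (m : ℝ) ≤ kF / 2 := Nat.floor_le (by linarith [hF.pos])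
  have hm' : kF / 2 < m + 1 := Nat.lt_floor_add_one _
  let Q : Finset (ℤ × ℤ) := Finset.Icc (-(m : ℤ)) m ×ˢ Finset.Icc (-(m : ℤ)) m
  have hQ : Q.card = (2 * m + 1) ^ 2 := by
    rw [Finset.card_product, Int.card_Icc]
    have : ((m : ℤ) + 1 - -(m : ℤ)).toNat = 2 * m + 1 := by omega
    rw [this]; ring
  have hle : Q.card ≤ (fermiBall kF).card := by
    refine Finset.card_le_card_of_injOn toLex ?_ toLex.injective.injOn
    intro z hz
    simp only [Q, Finset.coe_product, Set.mem_prod, Finset.mem_coe, Finset.mem_Icc] at hz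
    rw [Finset.mem_coe, mem_fermiBall, normSq]
    simp only [ofLex_toLex]
    have key : ∀ a : ℤ, -(m : ℤ) ≤ a ∧ a ≤ m → (a : ℝ) ^ 2 ≤ (kF / 2) ^ 2 := by
      intro a ha
      apply sq_le_sq'
      · have : (-(m : ℝ)) ≤ a := by exact_mod_cast ha.1
        linarith
      · have : (a : ℝ) ≤ m := by exact_mod_cast ha.2
        linarith
    nlinarith [key _ hz.1, key _ hz.2, hF.pos]
  rw [hQ, hF.card_eq] at hle
  have h1 : ((2 * (m : ℝ) + 1)) ^ 2 ≤ N := by exact_mod_cast hle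
  have h2 : 2 * (m : ℝ) + 1 ≤ Real.sqrt N := Real.le_sqrt_of_sq_le h1
  have : (0 : ℝ) ≤ m := Nat.cast_nonneg m
  linarith

/-- The number of `p ∈ B` with `p + k ∉ B`. -/
def exitCount (B : Finset Mom) (k : Mom) : ℕ := (B.filter fun p => p + k ∉ B).card

/-- If `p` leaves `B` under the shift by `k + l`, then either `p` leaves under `k`, or `p + k` is
still in `B` and leaves under `l`. -/
lemma exitCount_add (B : Finset Mom) (k l : Mom) :
    exitCount B (k + l) ≤ exitCount B k + exitCount B l := by
  have h1 : (B.filter fun p => p + (k + l) ∉ B) ⊆ (B.filter fun p => p + k ∉ B) ∪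
      ((B.filter fun p => p + l ∉ B).image fun p => p - k) := by
    intro p hp
    rw [Finset.mem_filter] at hp
    rw [Finset.mem_union, Finset.mem_filter, Finset.mem_image]
    by_cases h : p + k ∈ B
    · exact Or.inr ⟨p + k, Finset.mem_filter.mpr ⟨h, by rw [add_assoc]; exact hp.2⟩, by simp⟩
    · exact Or.inl ⟨hp.1, h⟩
  refine (Finset.card_le_card h1).trans ((Finset.card_union_le _ _).trans ?_)
  exact Nat.add_le_add_left Finset.card_image_le _

lemma exitCount_nsmul (B : Finset Mom) (k : Mom) (n : ℕ) :
    exitCount B (n • k) ≤ n * exitCount B k := by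
  induction n with
  | zero => simp [exitCount]
  | succ n ih =>
    rw [succ_nsmul]
    refine (exitCount_add B _ _).trans ?_
    rw [add_mul, one_mul]
    exact Nat.add_le_add_right ih _

/-- A line parallel to an axis meets the disc in a symmetric interval, and a unit step in a fixed
direction leads out of it only from its last point. -/
lemma eq_of_exit {r : ℝ} {s x x' c : ℤ} (hs : s = 1 ∨ s = -1)
    (h1 : (x : ℝ) ^ 2 + (c : ℝ) ^ 2 < r ^ 2) (h2 : r ^ 2 ≤ ((x + s : ℤ) : ℝ) ^ 2 + (c : ℝ) ^ 2)
    (h1' : (x' : ℝ) ^ 2 + (c : ℝ) ^ 2 < r ^ 2)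
    (h2' : r ^ 2 ≤ ((x' + s : ℤ) : ℝ) ^ 2 + (c : ℝ) ^ 2) : x = x' := by
  have e1 : (x : ℝ) ^ 2 < ((x + s : ℤ) : ℝ) ^ 2 := by linarith
  have e2 : (x' : ℝ) ^ 2 < ((x + s : ℤ) : ℝ) ^ 2 := by linarith
  have e3 : (x : ℝ) ^ 2 < ((x' + s : ℤ) : ℝ) ^ 2 := by linarith
  have e4 : (x' : ℝ) ^ 2 < ((x' + s : ℤ) : ℝ) ^ 2 := by linarith
  norm_cast at e1 e2 e3 e4
  rw [sq_lt_sq] at e1 e2 e3 e4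
  rcases hs with rfl | rfl <;> grind

/-- For a unit step `u`, `f` is the coordinate transversal to `u`. At most one point exits on each
line, and the lines are indexed by integers of modulus at most `⌊k_F⌋`. -/
lemma exitCount_le_of_injOn {kF : ℝ} (hk : 0 < kF) (u : Mom) (f : Mom → ℤ)
    (hf : ∀ p, (f p : ℝ) ^ 2 ≤ normSq p)
    (hinj : ∀ p q, normSq p < kF ^ 2 → kF ^ 2 ≤ normSq (p + u) → normSq q < kF ^ 2 →
      kF ^ 2 ≤ normSq (q + u) → f p = f q → p = q) :
    (exitCount (fermiBall kF) u : ℝ) ≤ 2 * kF + 1 := by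
  have h1 : exitCount (fermiBall kF) u ≤ (Finset.Icc (-(⌊kF⌋₊ : ℤ)) ⌊kF⌋₊).card := by
    refine Finset.card_le_card_of_injOn f ?_ ?_
    · intro p hp
      rw [Finset.mem_coe, Finset.mem_filter, mem_fermiBall] at hp
      have h2 : |(f p : ℝ)| < |kF| := sq_lt_sq.mp ((hf p).trans_lt hp.1)
      rw [abs_of_pos hk] at h2
      have h3 : (f p).natAbs ≤ ⌊kF⌋₊ := by
        apply Nat.le_floor
        rw [Nat.cast_natAbs, Int.cast_abs]
        exact h2.le
      rw [Finset.mem_coe, Finset.mem_Icc]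
      omega
    · intro p hp q hq hpq
      rw [Finset.mem_coe, Finset.mem_filter, mem_fermiBall, mem_fermiBall, not_lt] at hp hq
      exact hinj p q hp.1 hp.2 hq.1 hq.2 hpq
  rw [Int.card_Icc] at h1
  have h2 : exitCount (fermiBall kF) u ≤ 2 * ⌊kF⌋₊ + 1 := by omega
  have h3 : (exitCount (fermiBall kF) u : ℝ) ≤ 2 * ⌊kF⌋₊ + 1 := by exact_mod_cast h2
  have := Nat.floor_le hk.le
  linarith

lemma exitCount_fst {kF : ℝ} (hk : 0 < kF) {s : ℤ} (hs : s = 1 ∨ s = -1) :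
    (exitCount (fermiBall kF) (toLex (s, 0)) : ℝ) ≤ 2 * kF + 1 := by
  refine exitCount_le_of_injOn hk _ (fun p => (ofLex p).2) (fun p => ?_) ?_
  · rw [normSq]; nlinarith [sq_nonneg ((ofLex p).1 : ℝ)]
  · intro p q hp hp' hq hq' hpq
    simp only [normSq, ofLex_add, ofLex_toLex, Prod.fst_add, Prod.snd_add, add_zero] at *
    rw [← hpq] at hq hq'
    exact ofLex.injective (Prod.ext (eq_of_exit hs hp hp' hq hq') hpq)

lemma exitCount_snd {kF : ℝ} (hk : 0 < kF) {s : ℤ} (hs : s = 1 ∨ s = -1) :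
    (exitCount (fermiBall kF) (toLex (0, s)) : ℝ) ≤ 2 * kF + 1 := by
  refine exitCount_le_of_injOn hk _ (fun p => (ofLex p).1) (fun p => ?_) ?_
  · rw [normSq]; nlinarith [sq_nonneg ((ofLex p).2 : ℝ)]
  · intro p q hp hp' hq hq' hpq
    simp only [normSq, ofLex_add, ofLex_toLex, Prod.fst_add, Prod.snd_add, add_zero] at *
    rw [← hpq] at hq hq'
    rw [add_comm] at hp hp' hq hq'
    exact ofLex.injective (Prod.ext hpq (eq_of_exit hs hp hp' hq hq'))

/-- Write `k` as a sum of unit steps along the axes and use subadditivity. Each step costs `2 k_F +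
1 ≤ 5 √N`, and there are at most `|k|` of them in either direction. This surface estimate is the
source of the weight `|k|` in the hypothesis on the potential. -/
lemma IsFermiMomentum.exitCount_le {N : ℕ} {kF : ℝ} (hF : IsFermiMomentum N kF) (k : Mom) :
    (exitCount (fermiBall kF) k : ℝ) ≤ 10 * (Real.sqrt (normSq k) * Real.sqrt N) := by
  have hN : 1 ≤ Real.sqrt N := Real.one_le_sqrt.mpr (by exact_mod_cast hF.one_le)
  have hsign : ∀ a : ℤ, ∃ s : ℤ, (s = 1 ∨ s = -1) ∧ a = a.natAbs * s := by
    intro a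
    rcases le_total 0 a with h | h
    · exact ⟨1, Or.inl rfl, by omega⟩
    · exact ⟨-1, Or.inr rfl, by omega⟩
  obtain ⟨s, hs, h1⟩ := hsign (ofLex k).1
  obtain ⟨t, ht, h2⟩ := hsign (ofLex k).2
  set m := (ofLex k).1.natAbs with hm
  set n := (ofLex k).2.natAbs with hn
  have hk : k = m • (toLex (s, 0) : Mom) + n • (toLex (0, t) : Mom) := by
    apply ofLex.injective
    refine Prod.ext ?_ ?_
    · rw [h1]; simp
    · rw [h2]; simp
  have h3 : exitCount (fermiBall kF) k ≤ m * exitCount (fermiBall kF) (toLex (s, 0))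
      + n * exitCount (fermiBall kF) (toLex (0, t)) := by
    conv_lhs => rw [hk]
    exact (exitCount_add _ _ _).trans
      (Nat.add_le_add (exitCount_nsmul _ _ _) (exitCount_nsmul _ _ _))
  have h4 : (exitCount (fermiBall kF) k : ℝ) ≤ m * exitCount (fermiBall kF) (toLex (s, 0))
      + n * exitCount (fermiBall kF) (toLex (0, t)) := by exact_mod_cast h3
  have hle := hF.le_sqrt
  have hm' : (m : ℝ) ≤ Real.sqrt (normSq k) := by
    apply Real.le_sqrt_of_sq_le
    rw [hm, Nat.cast_natAbs, Int.cast_abs, sq_abs, normSq]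
    nlinarith [sq_nonneg ((ofLex k).2 : ℝ)]
  have hn' : (n : ℝ) ≤ Real.sqrt (normSq k) := by
    apply Real.le_sqrt_of_sq_le
    rw [hn, Nat.cast_natAbs, Int.cast_abs, sq_abs, normSq]
    nlinarith [sq_nonneg ((ofLex k).1 : ℝ)]
  have e1 := (exitCount_fst hF.pos hs).trans (show _ ≤ 5 * Real.sqrt N by linarith)
  have e2 := (exitCount_snd hF.pos ht).trans (show _ ≤ 5 * Real.sqrt N by linarith)
  calc (exitCount (fermiBall kF) k : ℝ) ≤ Real.sqrt (normSq k) * (5 * Real.sqrt N)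
        + Real.sqrt (normSq k) * (5 * Real.sqrt N) := by
        refine h4.trans ?_
        gcongr
    _ = _ := by ring

/-- Lattice points on a circle are Gaussian integers of given norm. The bound is in terms of an
upper bound `x ≥ 1` of `n`, so that it is uniform over a shell and covers `n = 0`, where the divisor
bound does not apply. -/
lemma exists_card_natNormSq_eq_le {ε : ℝ} (hε : 0 < ε) : ∃ C : ℝ, 1 ≤ C ∧
    ∀ (n : ℕ) (x : ℝ), (n : ℝ) ≤ x → 1 ≤ x → ∀ S : Finset Mom, (∀ p ∈ S, natNormSq p = n) →
      (S.card : ℝ) ≤ C * x ^ ε := by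
  classical
  obtain ⟨C, hC1, hC⟩ := exists_card_norm_eq_le hε
  refine ⟨C, hC1, fun n x hn hx S hS => ?_⟩
  have hx1 : 1 ≤ x ^ ε := Real.one_le_rpow hx hε.le
  rcases Nat.eq_zero_or_pos n with rfl | hpos
  · have : S.card ≤ 1 := by
      refine Finset.card_le_one.mpr fun p hp q hq => ?_
      have key : ∀ p ∈ S, p = 0 := by
        intro p hp
        by_contra h
        have h1 := one_le_normSq h
        rw [← cast_natNormSq, hS p hp] at h1
        norm_num at h1
      rw [key p hp, key q hq]
    have : (S.card : ℝ) ≤ 1 := by exact_mod_cast this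
    nlinarith
  · let f : Mom → GaussianInt := fun p => ⟨(ofLex p).1, (ofLex p).2⟩
    have hf : Function.Injective f := by
      intro p q h
      have h1 := congrArg Zsqrtd.re h
      have h2 := congrArg Zsqrtd.im h
      exact ofLex.injective (Prod.ext h1 h2)
    have h1 := hC n hpos (S.image f) (by
      intro z hz
      obtain ⟨p, hp, rfl⟩ := Finset.mem_image.mp hz
      rw [← hS p hp, natNormSq, Int.natAbs_of_nonneg (by positivity), Zsqrtd.norm_def]
      simp only [f]
      ring)
    rw [Finset.card_image_of_injective _ hf] at h1
    refine h1.trans ?_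
    gcongr

lemma hbar_sq {N : ℕ} : hbar N ^ 2 = (N : ℝ)⁻¹ := by
  rw [hbar, ← Real.rpow_natCast, ← Real.rpow_mul (Nat.cast_nonneg N)]
  norm_num
  exact Real.rpow_neg_one _

/-- There are `O(N^{1/4 + ε})` momenta `p` with `e(p) ≤ ħ N^{-1/4}`. -/
lemma exists_gap_card_le {ε : ℝ} (hε : 0 < ε) : ∃ C : ℝ, 1 ≤ C ∧
    ∀ (N : ℕ) (kF : ℝ), IsFermiMomentum N kF → ∃ G : Finset Mom,
      (∀ p, p ∉ G → hbar N * (N : ℝ) ^ (-(1 / 4) : ℝ) ≤ excitationEnergy N kF p) ∧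
      (G.card : ℝ) ≤ C * (N : ℝ) ^ (1 / 4 + ε) := by
  classical
  obtain ⟨C, hC1, hC⟩ := exists_card_natNormSq_eq_le hε
  refine ⟨3 * (C * 5 ^ ε), ?_, fun N kF hF => ?_⟩
  · have : (1 : ℝ) ≤ 5 ^ ε := Real.one_le_rpow (by norm_num) hε.le
    nlinarith
  have hN1 : (1 : ℝ) ≤ N := by exact_mod_cast hF.one_le
  have hN0 : (0 : ℝ) < N := by linarith
  -- As `ħ N^{-1/4} = ħ² b`, the condition `e(p) ≤ ħ N^{-1/4}` reads `||p|² - k_F²| ≤ b`.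
  set b : ℝ := (N : ℝ) ^ (1 / 4 : ℝ) with hb
  have hb1 : 1 ≤ b := Real.one_le_rpow hN1 (by norm_num)
  have hbN : b ≤ N := by
    calc b ≤ (N : ℝ) ^ (1 : ℝ) := Real.rpow_le_rpow_of_exponent_le hN1 (by norm_num)
      _ = N := Real.rpow_one _
  have hkF : kF ^ 2 ≤ 4 * N := by
    have h1 := hF.le_sqrt
    have h2 := Real.sq_sqrt hN0.le
    nlinarith [hF.pos, Real.sqrt_nonneg (N : ℝ)]
  -- The ball only provides finiteness; the `+ 1` makes up for its strict inequality.
  let G := (finite_ball (Real.sqrt (kF ^ 2 + b + 1))).toFinset.filter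
    fun p => |normSq p - kF ^ 2| ≤ b
  have hG : ∀ p ∈ G, |normSq p - kF ^ 2| ≤ b := fun p hp => (Finset.mem_filter.mp hp).2
  refine ⟨G, fun p hp => ?_, ?_⟩
  · have h1 : b < |normSq p - kF ^ 2| := by
      by_contra h
      push Not at h
      apply hp
      rw [Finset.mem_filter, Set.Finite.mem_toFinset, Set.mem_ofPred_eq,
        Real.sq_sqrt (by positivity)]
      exact ⟨by linarith [(abs_le.mp h).2], h⟩
    have h2 : hbar N * (N : ℝ) ^ (-(1 / 4) : ℝ) = hbar N ^ 2 * b := by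
      rw [hbar_sq, ← Real.rpow_neg_one, hbar, hb, ← Real.rpow_add hN0, ← Real.rpow_add hN0]
      norm_num
    rw [h2, excitationEnergy]
    gcongr
  -- Sort `G` by the integer `|p|²`. It takes at most `2 b + 1 ≤ 3 b` values, all bounded by `k_F² +
  -- b ≤ 5 N`, and each of them is attained `O(N^ε)` times.
  · have hmaps : ∀ p ∈ G, natNormSq p ∈ Finset.Icc ⌈kF ^ 2 - b⌉₊ ⌊kF ^ 2 + b⌋₊ := by
      intro p hp
      have h := abs_le.mp (hG p hp)
      rw [← cast_natNormSq] at h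
      rw [Finset.mem_Icc]
      exact ⟨Nat.ceil_le.mpr (by linarith [h.1]), Nat.le_floor (by linarith [h.2])⟩
    have hfib : ∀ n ∈ Finset.Icc ⌈kF ^ 2 - b⌉₊ ⌊kF ^ 2 + b⌋₊,
        (G.filter fun p => natNormSq p = n).card ≤ ⌊C * (5 * N : ℝ) ^ ε⌋₊ := by
      intro n hn
      apply Nat.le_floor
      refine hC n _ ?_ (by linarith) _ fun p hp => (Finset.mem_filter.mp hp).2
      have h1 : (n : ℝ) ≤ kF ^ 2 + b :=
        (Nat.le_floor_iff (by positivity)).mp (Finset.mem_Icc.mp hn).2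
      linarith
    have h1 := Finset.card_le_mul_card_image_of_maps_to hmaps _ hfib
    have h2 : ((Finset.Icc ⌈kF ^ 2 - b⌉₊ ⌊kF ^ 2 + b⌋₊).card : ℝ) ≤ 3 * b := by
      rw [Nat.card_Icc]
      have h3 := Nat.le_ceil (kF ^ 2 - b)
      have h4 := Nat.floor_le (show 0 ≤ kF ^ 2 + b by positivity)
      rcases le_total ⌈kF ^ 2 - b⌉₊ (⌊kF ^ 2 + b⌋₊ + 1) with h | h
      · rw [Nat.cast_sub h]
        push_cast
        linarith
      · rw [Nat.sub_eq_zero_of_le h]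
        push_cast
        linarith
    have h3 : (⌊C * (5 * N : ℝ) ^ ε⌋₊ : ℝ) ≤ C * (5 * N : ℝ) ^ ε := Nat.floor_le (by positivity)
    calc (G.card : ℝ) ≤ ⌊C * (5 * N : ℝ) ^ ε⌋₊ * (Finset.Icc ⌈kF ^ 2 - b⌉₊ ⌊kF ^ 2 + b⌋₊).card := by
          exact_mod_cast h1
      _ ≤ (C * (5 * N : ℝ) ^ ε) * (3 * b) := by gcongr
      _ = _ := by
          rw [Real.mul_rpow (by norm_num) hN0.le, Real.rpow_add hN0, hb]
          ring

end FermiGas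

/-! ### The interaction as momentum transfers: positivity and localization. -/

namespace FermiGas
open scoped ComplexConjugate

/-- The change of `n` momenta when the particle `q.1` gains and the particle `q.2` loses
momentum `k`. -/
def transfer {n : ℕ} (q : Fin n × Fin n) (k : Mom) : Fin n → Mom :=
  Pi.single q.1 k - Pi.single q.2 k

lemma transfer_swap {n : ℕ} (q : Fin n × Fin n) (k : Mom) : transfer q.swap k = -transfer q k := by
  simp [transfer]

lemma transfer_zero {n : ℕ} (q : Fin n × Fin n) : transfer q 0 = 0 := by
  simp [transfer]

lemma transfer_fst {n : ℕ} {q : Fin n × Fin n} (h : q.1 ≠ q.2) (k : Mom) (K : Fin n → Mom) :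
    (K + transfer q k) q.1 = K q.1 + k := by
  simp [transfer, Pi.single_eq_of_ne h]

lemma transfer_snd {n : ℕ} {q : Fin n × Fin n} (h : q.1 ≠ q.2) (k : Mom) (K : Fin n → Mom) :
    (K + transfer q k) q.2 = K q.2 - k := by
  simp [transfer, Pi.single_eq_of_ne h.symm, sub_eq_add_neg]

lemma transfer_of_ne {n : ℕ} {q : Fin n × Fin n} {l : Fin n} (h1 : l ≠ q.1) (h2 : l ≠ q.2)
    (k : Mom) (K : Fin n → Mom) : (K + transfer q k) l = K l := by
  simp [transfer, Pi.single_eq_of_ne h1, Pi.single_eq_of_ne h2]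

/-- The matrix element of `∑_{i ≠ j} exp(i k·(x_i - x_j))` between two vectors given by their
plane wave coefficients. -/
noncomputable def hop {n : ℕ} (k : Mom) (f c : (Fin n → Mom) → ℂ) : ℂ :=
  ∑ q ∈ Finset.univ.offDiag, ∑' K, conj (f K) * c (K + transfer q k)

section Sums
variable {n : ℕ}

lemma summable_shift {a : (Fin n → Mom) → ℝ} (ha : Summable a) (d : Fin n → Mom) :
    Summable fun K => a (K + d) :=
  (Equiv.addRight d).summable_iff.mpr ha

lemma tsum_shift {E : Type*} [AddCommMonoid E] [TopologicalSpace E] (a : (Fin n → Mom) → E)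
    (d : Fin n → Mom) : ∑' K, a (K + d) = ∑' K, a K :=
  (Equiv.addRight d).tsum_eq a

lemma summable_bdd_mul {ι : Type*} {F a : ι → ℝ} {M : ℝ} (hF : ∀ K, |F K| ≤ M)
    (ha0 : ∀ K, 0 ≤ a K) (ha : Summable a) : Summable fun K => F K * a K := by
  refine Summable.of_norm_bounded (ha.mul_left M) fun K => ?_
  rw [Real.norm_eq_abs, abs_mul, abs_of_nonneg (ha0 K)]
  exact mul_le_mul_of_nonneg_right (hF K) (ha0 K)

lemma summable_norm_mul_norm {f c : (Fin n → Mom) → ℂ} (hf : Summable fun K => ‖f K‖ ^ 2)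
    (hc : Summable fun K => ‖c K‖ ^ 2) (d e : Fin n → Mom) :
    Summable fun K => ‖f (K + d)‖ * ‖c (K + e)‖ := by
  refine Summable.of_nonneg_of_le (fun _ => by positivity) (fun K => ?_)
    ((summable_shift hf d).add (summable_shift hc e))
  nlinarith [sq_nonneg (‖f (K + d)‖ - ‖c (K + e)‖), sq_nonneg ‖f (K + d)‖, sq_nonneg ‖c (K + e)‖]

lemma summable_conj_mul {f c : (Fin n → Mom) → ℂ} (hf : Summable fun K => ‖f K‖ ^ 2)
    (hc : Summable fun K => ‖c K‖ ^ 2) (d e : Fin n → Mom) :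
    Summable fun K => conj (f (K + d)) * c (K + e) := by
  refine Summable.of_norm ?_
  simpa using summable_norm_mul_norm hf hc d e

lemma sum_offDiag_swap {E : Type*} [AddCommMonoid E] (F : Fin n × Fin n → E) :
    ∑ q ∈ Finset.univ.offDiag, F q.swap = ∑ q ∈ Finset.univ.offDiag, F q := by
  refine Finset.sum_nbij' Prod.swap Prod.swap ?_ ?_ ?_ ?_ ?_ <;> simp [Finset.mem_offDiag, eq_comm]

lemma re_tsum_conj_mul {f c : (Fin n → Mom) → ℂ} (hf : Summable fun K => ‖f K‖ ^ 2)
    (hc : Summable fun K => ‖c K‖ ^ 2) (d e : Fin n → Mom) :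
    (∑' K, conj (f (K + d)) * c (K + e)).re = ∑' K, (conj (f (K + d)) * c (K + e)).re :=
  Complex.re_tsum (summable_conj_mul hf hc d e)

/-- `⟨f, ∑_{i ≠ j} exp(i k·(x_i - x_j)) f⟩ = ‖∑_j exp(i k·x_j) f‖² - n ‖f‖² ≥ - n ‖f‖²` -/
lemma re_hop_self_ge {f : (Fin n → Mom) → ℂ} (hf : Summable fun K => ‖f K‖ ^ 2) (k : Mom) :
    -(n * ∑' K, ‖f K‖ ^ 2) ≤ (hop k f f).re := by
  -- After translating by the momentum of the second particle, each term is a product of a factor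
  -- depending on `q.2` and one depending on `q.1`. The sum over all pairs is then a square, and the
  -- diagonal pairs account for `n ‖f‖²`.
  have hP : ∀ q : Fin n × Fin n, ∑' K, conj (f K) * f (K + transfer q k)
      = ∑' K, conj (f (K + (Pi.single q.2 k : Fin n → Mom))) * f (K + (Pi.single q.1 k : Fin n → Mom)) := by
    intro q
    rw [← tsum_shift (fun K => conj (f K) * f (K + transfer q k)) (Pi.single q.2 k)]
    refine tsum_congr fun K => ?_
    congr 2
    rw [transfer]
    abel
  have hdiag : ∑ q ∈ (Finset.univ : Finset (Fin n)).diag,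
      ∑' K, conj (f K) * f (K + transfer q k) = ((n * ∑' K, ‖f K‖ ^ 2 : ℝ) : ℂ) := by
    rw [Finset.sum_diag]
    have : ∀ i : Fin n, ∑' K, conj (f K) * f (K + transfer (i, i) k)
        = ((∑' K, ‖f K‖ ^ 2 : ℝ) : ℂ) := by
      intro i
      rw [Complex.ofReal_tsum]
      refine tsum_congr fun K => ?_
      rw [show K + transfer (i, i) k = K by simp [transfer], Complex.conj_mul']
      norm_cast
    simp [this]
  have hall : 0 ≤ (∑ q : Fin n × Fin n, ∑' K, conj (f K) * f (K + transfer q k)).re := by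
    simp_rw [hP]
    rw [← Summable.tsum_finsetSum fun q _ => summable_conj_mul hf hf _ _]
    have : ∀ K : Fin n → Mom, ∑ q : Fin n × Fin n,
        conj (f (K + (Pi.single q.2 k : Fin n → Mom))) * f (K + (Pi.single q.1 k : Fin n → Mom))
          = ((‖∑ i, f (K + (Pi.single i k : Fin n → Mom))‖ ^ 2 : ℝ) : ℂ) := by
      intro K
      rw [Complex.ofReal_pow, ← Complex.conj_mul', map_sum, Finset.sum_mul_sum, ← Finset.sum_product',
        Finset.univ_product_univ]
      exact (Equiv.prodComm _ _).sum_comp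
        (fun q : Fin n × Fin n => conj (f (K + (Pi.single q.1 k : Fin n → Mom))) * f (K + (Pi.single q.2 k : Fin n → Mom)))
    simp_rw [this]
    rw [← Complex.ofReal_tsum, Complex.ofReal_re]
    exact tsum_nonneg fun _ => by positivity
  rw [← Finset.univ_product_univ, ← Finset.diag_union_offDiag,
    Finset.sum_union (Finset.disjoint_diag_offDiag _), hdiag, Complex.add_re,
    Complex.ofReal_re] at hall
  rw [hop]
  linarith

/-- For `k = 0` the operator is the constant `n² - n`, so this mode drops out of energy differences.
-/
lemma hop_zero {f : (Fin n → Mom) → ℂ} :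
    (hop 0 f f).re = (n * n - n) * ∑' K, ‖f K‖ ^ 2 := by
  rw [hop]
  have : ∀ q : Fin n × Fin n, ∑' K, conj (f K) * f (K + transfer q 0)
      = ((∑' K, ‖f K‖ ^ 2 : ℝ) : ℂ) := by
    intro q
    rw [Complex.ofReal_tsum]
    refine tsum_congr fun K => ?_
    rw [transfer_zero, add_zero, Complex.conj_mul']
    norm_cast
  simp_rw [this]
  rw [Finset.sum_const, Finset.offDiag_card, nsmul_eq_mul, ← Complex.ofReal_natCast,
    ← Complex.ofReal_mul, Complex.ofReal_re, Finset.card_univ, Fintype.card_fin,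
    Nat.cast_sub (Nat.le_mul_self n)]
  push_cast
  ring

/-- Localization: `Re ⟨g² c, U c⟩ ≥ ⟨g c, U g c⟩ - ½ ∑ (g - g')² |c| |c'|`. -/
lemma re_hop_sq_ge {c : (Fin n → Mom) → ℂ} (hc : Summable fun K => ‖c K‖ ^ 2)
    {g : (Fin n → Mom) → ℝ} {M : ℝ} (hg : ∀ K, |g K| ≤ M) (k : Mom) :
    (hop k (fun K => (g K : ℂ) * c K) (fun K => (g K : ℂ) * c K)).re
      - 1 / 2 * ∑ q ∈ Finset.univ.offDiag, ∑' K, (g K - g (K + transfer q k)) ^ 2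
        * (‖c K‖ * ‖c (K + transfer q k)‖)
      ≤ (hop k (fun K => ((g K ^ 2 : ℝ) : ℂ) * c K) c).re := by
  have hM : 0 ≤ M := (abs_nonneg _).trans (hg 0)
  have hgc : Summable fun K => ‖(g K : ℂ) * c K‖ ^ 2 := by
    refine Summable.of_nonneg_of_le (fun _ => by positivity) (fun K => ?_) (hc.mul_left (M ^ 2))
    rw [norm_mul, mul_pow, Complex.norm_real, Real.norm_eq_abs]
    have := hg K
    gcongr
  have hg2 : ∀ K, |g K ^ 2| ≤ M ^ 2 := fun K => by
    rw [abs_pow]; have := hg K; gcongr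
  have hg2c : Summable fun K => ‖((g K ^ 2 : ℝ) : ℂ) * c K‖ ^ 2 := by
    refine Summable.of_nonneg_of_le (fun _ => by positivity) (fun K => ?_)
      (hc.mul_left ((M ^ 2) ^ 2))
    rw [norm_mul, mul_pow, Complex.norm_real, Real.norm_eq_abs]
    have := hg2 K
    gcongr
  set R : Fin n × Fin n → (Fin n → Mom) → ℝ := fun q K => (conj (c K) * c (K + transfer q k)).re
  have hRle : ∀ q K, |R q K| ≤ ‖c K‖ * ‖c (K + transfer q k)‖ := fun q K => by
    refine (Complex.abs_re_le_norm _).trans ?_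
    simp
  have hnn : ∀ q : Fin n × Fin n, Summable fun K => ‖c K‖ * ‖c (K + transfer q k)‖ := fun q => by
    simpa using summable_norm_mul_norm hc hc 0 (transfer q k)
  have hbR : ∀ (q : Fin n × Fin n) (F : (Fin n → Mom) → ℝ) (M' : ℝ), (∀ K, |F K| ≤ M') →
      Summable fun K => F K * R q K := by
    intro q F M' hF
    refine Summable.of_norm_bounded ((hnn q).mul_left M') fun K => ?_
    rw [Real.norm_eq_abs, abs_mul]
    exact mul_le_mul (hF K) (hRle q K) (abs_nonneg _) ((abs_nonneg _).trans (hF K))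
  have e1 : (hop k (fun K => ((g K ^ 2 : ℝ) : ℂ) * c K) c).re
      = ∑ q ∈ Finset.univ.offDiag, ∑' K, g K ^ 2 * R q K := by
    rw [hop, Complex.re_sum]
    refine Finset.sum_congr rfl fun q _ => ?_
    have := re_tsum_conj_mul hg2c hc 0 (transfer q k)
    simp only [add_zero] at this
    rw [this]
    refine tsum_congr fun K => ?_
    rw [map_mul, Complex.conj_ofReal, mul_assoc, Complex.re_ofReal_mul]
  -- Reversing the transfer by swapping the pair and translating `K` puts the weight `g²` on the
  -- other configuration. The average of `e1` and `e2` has the symmetric weight `(g² + g'²) / 2 = g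
  -- g' + (g - g')² / 2`, whose last term is the localization error.
  have e2 : (hop k (fun K => ((g K ^ 2 : ℝ) : ℂ) * c K) c).re
      = ∑ q ∈ Finset.univ.offDiag, ∑' K, g (K + transfer q k) ^ 2 * R q K := by
    rw [e1, ← sum_offDiag_swap]
    refine Finset.sum_congr rfl fun q _ => ?_
    rw [← tsum_shift (fun K => g K ^ 2 * R q.swap K) (transfer q k)]
    refine tsum_congr fun K => ?_
    simp only [R, transfer_swap, add_neg_cancel_right]
    congr 1
    simp only [Complex.mul_re, Complex.conj_re, Complex.conj_im]
    ring
  have e3 : (hop k (fun K => (g K : ℂ) * c K) (fun K => (g K : ℂ) * c K)).re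
      = ∑ q ∈ Finset.univ.offDiag, ∑' K, (g K * g (K + transfer q k)) * R q K := by
    rw [hop, Complex.re_sum]
    refine Finset.sum_congr rfl fun q _ => ?_
    have := re_tsum_conj_mul hgc hgc 0 (transfer q k)
    simp only [add_zero] at this
    rw [this]
    refine tsum_congr fun K => ?_
    rw [map_mul, Complex.conj_ofReal, ← Complex.re_ofReal_mul]
    congr 1
    push_cast
    ring
  have hterm : ∀ q : Fin n × Fin n, ∑' K, (g K * g (K + transfer q k)) * R q K
      - 1 / 2 * ∑' K, (g K - g (K + transfer q k)) ^ 2 * (‖c K‖ * ‖c (K + transfer q k)‖)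
      ≤ 1 / 2 * (∑' K, g K ^ 2 * R q K) + 1 / 2 * ∑' K, g (K + transfer q k) ^ 2 * R q K := by
    intro q
    have s1 := hbR q (fun K => g K * g (K + transfer q k)) (M * M) fun K => by
      rw [abs_mul]; exact mul_le_mul (hg _) (hg _) (abs_nonneg _) hM
    have s2 : Summable fun K => (g K - g (K + transfer q k)) ^ 2
        * (‖c K‖ * ‖c (K + transfer q k)‖) := by
      refine summable_bdd_mul (M := (2 * M) ^ 2) (fun K => ?_) (fun _ => by positivity) (hnn q)
      rw [abs_pow]
      have := (abs_sub (g K) (g (K + transfer q k))).trans (add_le_add (hg _) (hg _))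
      have h2 : |g K - g (K + transfer q k)| ≤ 2 * M := by linarith
      gcongr
    have s3 := hbR q (fun K => g K ^ 2) (M ^ 2) hg2
    have s4 := hbR q (fun K => g (K + transfer q k) ^ 2) (M ^ 2) fun K => hg2 _
    rw [← tsum_mul_left, ← tsum_mul_left, ← tsum_mul_left,
      ← (s1.tsum_sub (s2.mul_left _)), ← (s3.mul_left _).tsum_add (s4.mul_left _)]
    refine (s1.sub (s2.mul_left _)).tsum_le_tsum (fun K => ?_) ((s3.mul_left _).add (s4.mul_left _))
    have h1 := (abs_le.mp (hRle q K)).1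
    nlinarith [mul_le_mul_of_nonneg_left h1 (sq_nonneg (g K - g (K + transfer q k)))]
  have hsum := Finset.sum_le_sum fun q (_ : q ∈ (Finset.univ : Finset (Fin n)).offDiag) => hterm q
  rw [Finset.sum_sub_distrib, Finset.sum_add_distrib, ← Finset.mul_sum, ← Finset.mul_sum,
    ← Finset.mul_sum, ← e1, ← e2, ← e3] at hsum
  linarith

end Sums
end FermiGas

/-! ### Counting momentum transfers between fermionic configurations. -/

namespace FermiGas
open scoped ComplexConjugate

section Counting
variable {n : ℕ}

/-- The coefficients `c` belong to an antisymmetric wave function. -/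
structure IsFermionic (c : (Fin n → Mom) → ℂ) : Prop where
  comp_perm : ∀ (σ : Equiv.Perm (Fin n)) K, c (K ∘ σ) = ((Equiv.Perm.sign σ : ℤ) : ℂ) * c K
  injective : ∀ K, c K ≠ 0 → Function.Injective K

/-- If the first particle lands on the momentum of the second, then the second lands on that of the
first: the transfer is an exchange. -/
lemma add_transfer_eq_comp_swap {q : Fin n × Fin n} (hq : q.1 ≠ q.2) {k : Mom} {K : Fin n → Mom}
    (h : K q.1 + k = K q.2) : K + transfer q k = K ∘ Equiv.swap q.1 q.2 := by
  funext l
  by_cases h1 : l = q.1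
  · rw [h1, transfer_fst hq, h]; simp
  by_cases h2 : l = q.2
  · rw [h2, transfer_snd hq, ← h]; simp
  rw [transfer_of_ne h1 h2, Function.comp_apply, Equiv.swap_apply_of_ne_of_ne h1 h2]

/-- If a particle moved by `transfer q k` lands on a momentum of the other configuration, it lands
on the initial momentum of its partner. -/
lemma eq_of_transfer_fst_eq {q : Fin n × Fin n} (hq : q.1 ≠ q.2) {k : Mom} (hk : k ≠ 0)
    {K : Fin n → Mom} (hinj : Function.Injective (K + transfer q k)) {l : Fin n}
    (hl : K q.1 + k = K l) : l = q.2 := by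
  by_contra h2
  by_cases h1 : l = q.1
  · rw [h1] at hl
    exact hk (by simpa using hl)
  · apply h1
    apply hinj
    rw [transfer_fst hq, transfer_of_ne h1 h2, hl]

lemma eq_of_transfer_snd_eq {q : Fin n × Fin n} (hq : q.1 ≠ q.2) {k : Mom} (hk : k ≠ 0)
    {K : Fin n → Mom} (hinj : Function.Injective (K + transfer q k)) {l : Fin n}
    (hl : K q.2 - k = K l) : l = q.1 := by
  by_contra h1
  by_cases h2 : l = q.2
  · rw [h2] at hl
    exact hk (by simpa using hl)
  · apply h2
    apply hinj
    rw [transfer_snd hq, transfer_of_ne h1 h2, hl]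

/-- The exchange energy of a filled set of momenta `B`. -/
lemma re_hop_filled {c : (Fin n → Mom) → ℂ} (hc : Summable fun K => ‖c K‖ ^ 2)
    (hferm : IsFermionic c) {B : Finset Mom}
    (hB : ∀ K, c K ≠ 0 → Finset.univ.image K = B) {k : Mom} (hk : k ≠ 0) :
    (hop k c c).re = -((n - exitCount B k) * ∑' K, ‖c K‖ ^ 2) := by
  -- Both configurations fill `B`, so the first particle lands on an occupied momentum. By
  -- injectivity of the new configuration this is the momentum of its partner, and antisymmetry
  -- gives the exchange the sign `-1`.
  have hterm : ∀ q ∈ (Finset.univ : Finset (Fin n)).offDiag, ∀ K,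
      conj (c K) * c (K + transfer q k)
        = ((-((if K q.1 + k = K q.2 then 1 else 0) * ‖c K‖ ^ 2) : ℝ) : ℂ) := by
    intro q hq K
    have hq' : q.1 ≠ q.2 := (Finset.mem_offDiag.mp hq).2.2
    split_ifs with h
    · rw [add_transfer_eq_comp_swap hq' h, hferm.comp_perm, Equiv.Perm.sign_swap hq']
      push_cast
      rw [one_mul, ← Complex.conj_mul']
      ring
    · rw [zero_mul, neg_zero, Complex.ofReal_zero]
      by_contra hne
      have h1 : c K ≠ 0 := fun h0 => hne (by rw [h0]; simp)
      have h2 : c (K + transfer q k) ≠ 0 := fun h0 => hne (by rw [h0]; simp)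
      have h3 : K q.1 + k ∈ Finset.univ.image K := by
        rw [hB K h1, ← hB _ h2, ← transfer_fst hq' k K]
        exact Finset.mem_image_of_mem _ (Finset.mem_univ _)
      obtain ⟨l, -, hl⟩ := Finset.mem_image.mp h3
      exact h (hl.symm.trans
        (congrArg K (eq_of_transfer_fst_eq hq' hk (hferm.injective _ h2) hl.symm)))
  -- Exchanges correspond to `p ∈ B` with `p + k ∈ B`; there are `n` minus `exitCount B k` of these.
  have hcount : ∀ K, c K ≠ 0 → ∑ q ∈ (Finset.univ : Finset (Fin n)).offDiag,
      (if K q.1 + k = K q.2 then (1 : ℝ) else 0) = n - exitCount B k := by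
    intro K hK
    have hinj := hferm.injective K hK
    rw [Finset.sum_boole]
    have h1 : ((Finset.univ : Finset (Fin n)).offDiag.filter
        fun q => K q.1 + k = K q.2).card = (B.filter fun p => p + k ∈ B).card := by
      refine Finset.card_nbij (fun q => K q.1) ?_ ?_ ?_
      · intro q hq
        have hq := Finset.mem_filter.mp hq
        have hm : ∀ i, K i ∈ B := fun i => by
          rw [← hB K hK]; exact Finset.mem_image_of_mem _ (Finset.mem_univ _)
        exact Finset.mem_filter.mpr ⟨hm _, by rw [hq.2]; exact hm _⟩
      · intro q hq q' hq' h
        have hq := (Finset.mem_filter.mp hq).2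
        have hq' := (Finset.mem_filter.mp hq').2
        have h1 : q.1 = q'.1 := hinj h
        refine Prod.ext h1 (hinj ?_)
        rw [← hq, ← hq', h1]
      · intro p hp
        obtain ⟨hp1, hp2⟩ := Finset.mem_filter.mp hp
        rw [← hB K hK] at hp1 hp2
        obtain ⟨i, -, hi⟩ := Finset.mem_image.mp hp1
        obtain ⟨j, -, hj⟩ := Finset.mem_image.mp hp2
        refine ⟨(i, j), ?_, hi⟩
        rw [Finset.mem_coe, Finset.mem_filter, Finset.mem_offDiag]
        refine ⟨⟨Finset.mem_univ _, Finset.mem_univ _, ?_⟩, by rw [hi, hj]⟩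
        intro hij
        rw [show i = j from hij, hj] at hi
        exact hk (by simpa using hi)
    have h2 := Finset.card_filter_add_card_filter_not (s := B) (fun p => p + k ∈ B)
    have h3 : B.card = n := by
      rw [← hB K hK, Finset.card_image_of_injective _ hinj, Finset.card_univ, Fintype.card_fin]
    rw [h1, exitCount, eq_sub_iff_add_eq]
    exact_mod_cast h2.trans h3
  have hs : ∀ q : Fin n × Fin n, Summable fun K : Fin n → Mom =>
      (if K q.1 + k = K q.2 then (1 : ℝ) else 0) * ‖c K‖ ^ 2 := fun q =>
    summable_bdd_mul (M := 1) (fun K => by split_ifs <;> simp) (fun _ => by positivity) hc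
  rw [hop, Finset.sum_congr rfl fun q hq => tsum_congr (hterm q hq)]
  simp_rw [← Complex.ofReal_tsum]
  rw [← Complex.ofReal_sum, Complex.ofReal_re]
  simp_rw [tsum_neg]
  rw [Finset.sum_neg_distrib, ← Summable.tsum_finsetSum fun q _ => hs q, ← tsum_mul_left]
  refine congrArg _ (tsum_congr fun K => ?_)
  rw [← Finset.sum_mul]
  by_cases hK : c K = 0
  · simp [hK]
  · rw [hcount K hK]

/-- The particles outside of `B`. -/
def outside (B : Finset Mom) (K : Fin n → Mom) : Finset (Fin n) :=
  Finset.univ.filter fun j => K j ∉ B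

/-- The particles that leave `B` when they gain momentum `k`. -/
def leaving (B : Finset Mom) (k : Mom) (K : Fin n → Mom) : Finset (Fin n) :=
  Finset.univ.filter fun j => K j ∈ B ∧ K j + k ∉ B

/-- The particles that fall into a hole in `B` when they gain momentum `k`. -/
def falling (B : Finset Mom) (k : Mom) (K : Fin n → Mom) : Finset (Fin n) :=
  Finset.univ.filter fun j => K j + k ∈ B \ Finset.univ.image K

/-- `B` and the set of occupied momenta both have `n` elements, hence there are as many holes as
particles outside. -/
lemma card_sdiff_image {B : Finset Mom} (hn : B.card = n) {K : Fin n → Mom}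
    (hK : Function.Injective K) : (B \ Finset.univ.image K).card = (outside B K).card := by
  have h1 : (Finset.univ.image K \ B).card = (outside B K).card := by
    rw [← Finset.card_image_of_injective (outside B K) hK]
    congr 1
    ext p
    simp only [outside, Finset.mem_sdiff, Finset.mem_image, Finset.mem_filter, Finset.mem_univ,
      true_and]
    constructor
    · rintro ⟨⟨j, rfl⟩, h⟩; exact ⟨j, h, rfl⟩
    · rintro ⟨j, h, rfl⟩; exact ⟨⟨j, rfl⟩, h⟩
  have h2 : (Finset.univ.image K).card = n := by
    rw [Finset.card_image_of_injective _ hK, Finset.card_univ, Fintype.card_fin]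
  rw [← h1]
  exact Finset.card_sdiff_comm (hn.trans h2.symm)

lemma card_leaving_le {B : Finset Mom} {K : Fin n → Mom} (hK : Function.Injective K) (k : Mom) :
    (leaving B k K).card ≤ exitCount B k := by
  refine Finset.card_le_card_of_injOn K (fun j hj => ?_) hK.injOn
  exact Finset.mem_filter.mpr (Finset.mem_filter.mp hj).2

/-- Different particles fall into different holes, and there are as many holes as particles outside
`B`. -/
lemma card_falling_le {B : Finset Mom} (hn : B.card = n) {K : Fin n → Mom}
    (hK : Function.Injective K) (k : Mom) : (falling B k K).card ≤ (outside B K).card := by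
  rw [← card_sdiff_image hn hK]
  refine Finset.card_le_card_of_injOn (fun j => K j + k) (fun j hj => ?_) ?_
  · exact (Finset.mem_filter.mp hj).2
  · intro i _ j _ hij
    exact hK (add_right_cancel hij)

/-- Only the two particles of the pair contribute to the change. The balance is stated additively to
avoid subtraction of natural numbers. -/
lemma outside_transfer {q : Fin n × Fin n} (hq : q.1 ≠ q.2) (B : Finset Mom) (k : Mom)
    (K : Fin n → Mom) :
    (outside B (K + transfer q k)).card
        + ((if K q.1 ∉ B then 1 else 0) + (if K q.2 ∉ B then 1 else 0))
      = (outside B K).card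
        + ((if K q.1 + k ∉ B then 1 else 0) + (if K q.2 - k ∉ B then 1 else 0)) := by
  have key : ∀ L : Fin n → Mom, (outside B L).card
      = ∑ l ∈ (Finset.univ.erase q.1).erase q.2, (if L l ∉ B then 1 else 0)
        + ((if L q.1 ∉ B then 1 else 0) + (if L q.2 ∉ B then 1 else 0)) := by
    intro L
    rw [outside, Finset.card_filter, ← Finset.add_sum_erase _ _ (Finset.mem_univ q.1),
      ← Finset.add_sum_erase (Finset.univ.erase q.1) _
        (Finset.mem_erase.mpr ⟨hq.symm, Finset.mem_univ q.2⟩)]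
    ring
  rw [key K, key (K + transfer q k), transfer_fst hq, transfer_snd hq,
    Finset.sum_congr rfl fun l hl => by
      rw [transfer_of_ne (Finset.ne_of_mem_erase (Finset.mem_of_mem_erase hl))
        (Finset.ne_of_mem_erase hl)]]
  ring

/-- Few transfers decrease the number of particles outside of `B`. -/
lemma card_lowering_le {B : Finset Mom} (hn : B.card = n) {K : Fin n → Mom}
    (hK : Function.Injective K) {k : Mom} (hk : k ≠ 0) (P : Finset (Fin n × Fin n))
    (hP : ∀ q ∈ P, q.1 ≠ q.2 ∧ Function.Injective (K + transfer q k) ∧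
      (outside B (K + transfer q k)).card < (outside B K).card) :
    P.card ≤ 4 * (outside B K).card ^ 2 := by
  -- If both particles start in `B`, the count cannot drop. If exactly one starts outside, both must
  -- end in `B`, and the one that started in `B` falls into a hole: the only occupied momentum it
  -- could hit is that of its partner, which is not in `B`.
  have hsub : P ⊆ (outside B K ×ˢ (outside B K ∪ falling B (-k) K))
      ∪ ((outside B K ∪ falling B k K) ×ˢ outside B K) := by
    intro q hq
    obtain ⟨hne, hinj, hlt⟩ := hP q hq
    have h := outside_transfer hne B k K
    have hsnd : ∀ l, K q.2 - k = K l → l = q.1 := fun l => eq_of_transfer_snd_eq hne hk hinj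
    have hfst : ∀ l, K q.1 + k = K l → l = q.2 := fun l => eq_of_transfer_fst_eq hne hk hinj
    simp only [outside, falling, Finset.mem_union, Finset.mem_product, Finset.mem_filter,
      Finset.mem_univ, true_and, Finset.mem_sdiff, Finset.mem_image, ← sub_eq_add_neg]
    by_cases h1 : K q.1 ∈ B <;> by_cases h2 : K q.2 ∈ B
    · simp only [h1, h2, not_true, if_false] at h
      omega
    · right
      refine ⟨Or.inr ⟨?_, ?_⟩, h2⟩
      · by_contra h3
        simp only [h1, h2, h3, not_true, not_false_eq_true, if_true, if_false] at h
        split_ifs at h <;> omega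
      · rintro ⟨l, hl⟩
        have hl' := hfst l hl.symm
        rw [hl'] at hl
        by_cases h3 : K q.1 + k ∈ B
        · exact h2 (hl ▸ h3)
        · simp only [h1, h2, h3, not_true, not_false_eq_true, if_true, if_false] at h
          split_ifs at h <;> omega
    · left
      refine ⟨h1, Or.inr ⟨?_, ?_⟩⟩
      · by_contra h3
        simp only [h1, h2, h3, not_true, not_false_eq_true, if_true, if_false] at h
        split_ifs at h <;> omega
      · rintro ⟨l, hl⟩
        have hl' := hsnd l hl.symm
        rw [hl'] at hl
        by_cases h3 : K q.2 - k ∈ B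
        · exact h1 (hl ▸ h3)
        · simp only [h1, h2, h3, not_true, not_false_eq_true, if_true, if_false] at h
          split_ifs at h <;> omega
    · exact Or.inl ⟨h1, Or.inl h2⟩
  have c1 := card_falling_le hn hK k
  have c2 := card_falling_le hn hK (-k)
  have c3 := Finset.card_union_le (outside B K) (falling B k K)
  have c4 := Finset.card_union_le (outside B K) (falling B (-k) K)
  have c5 := (Finset.card_le_card hsub).trans (Finset.card_union_le _ _)
  rw [Finset.card_product, Finset.card_product] at c5
  set o := (outside B K).card
  calc P.card ≤ o * (2 * o) + (2 * o) * o := by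
        refine c5.trans (Nat.add_le_add ?_ ?_)
        · exact Nat.mul_le_mul_left _ (by omega)
        · exact Nat.mul_le_mul_right _ (by omega)
    _ = _ := by ring

/-- Few transfers increase the number of particles outside of `B`. -/
lemma card_raising_le {B : Finset Mom} (hn : B.card = n) {K : Fin n → Mom}
    (hK : Function.Injective K) {k : Mom} (hk : k ≠ 0) (P : Finset (Fin n × Fin n))
    (hP : ∀ q ∈ P, q.1 ≠ q.2 ∧ Function.Injective (K + transfer q k) ∧
      (outside B K).card < (outside B (K + transfer q k)).card) :
    P.card ≤ exitCount B k * (exitCount B (-k) + 2 * (outside B K).card)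
      + (exitCount B k + 2 * (outside B K).card) * exitCount B (-k) := by
  -- At least one particle leaves `B`. The other one leaves too, or starts outside, or stays in `B`.
  -- In the last case it falls into a hole, since landing on the momentum of its partner would be an
  -- exchange, in which the partner does not leave `B`.
  have hsub : P ⊆ (leaving B k K ×ˢ (leaving B (-k) K ∪ (outside B K ∪ falling B (-k) K)))
      ∪ ((leaving B k K ∪ (outside B K ∪ falling B k K)) ×ˢ leaving B (-k) K) := by
    intro q hq
    obtain ⟨hne, hinj, hlt⟩ := hP q hq
    have h := outside_transfer hne B k K
    have hsnd : ∀ l, K q.2 - k = K l → l = q.1 := fun l => eq_of_transfer_snd_eq hne hk hinj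
    have hfst : ∀ l, K q.1 + k = K l → l = q.2 := fun l => eq_of_transfer_fst_eq hne hk hinj
    simp only [outside, falling, leaving, Finset.mem_union, Finset.mem_product, Finset.mem_filter,
      Finset.mem_univ, true_and, Finset.mem_sdiff, Finset.mem_image, ← sub_eq_add_neg]
    by_cases h1 : K q.1 ∈ B <;> by_cases h2 : K q.2 ∈ B <;>
      by_cases h3 : K q.1 + k ∈ B <;> by_cases h4 : K q.2 - k ∈ B <;>
      simp only [h1, h2, h3, h4, not_true, not_false_eq_true, if_true, if_false, true_and,
        and_true, false_and, and_false, false_or, or_false, true_or, or_true] at h ⊢ <;>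
      first
      | trivial
      | omega
      | skip
    · rintro ⟨l, hl⟩
      have hl' := hfst l hl.symm
      rw [hl'] at hl
      apply h4
      rw [hl, add_sub_cancel_right]
      exact h1
    · rintro ⟨l, hl⟩
      have hl' := hsnd l hl.symm
      rw [hl'] at hl
      apply h3
      rw [hl, sub_add_cancel]
      exact h2
  have c1 := card_falling_le hn hK k
  have c2 := card_falling_le hn hK (-k)
  have c3 := Finset.card_union_le (outside B K) (falling B k K)
  have c4 := Finset.card_union_le (outside B K) (falling B (-k) K)
  have c5 := (Finset.card_le_card hsub).trans (Finset.card_union_le _ _)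
  rw [Finset.card_product, Finset.card_product] at c5
  have c6 := card_leaving_le (B := B) hK k
  have c7 := card_leaving_le (B := B) hK (-k)
  have c8 := Finset.card_union_le (leaving B k K) (outside B K ∪ falling B k K)
  have c9 := Finset.card_union_le (leaving B (-k) K) (outside B K ∪ falling B (-k) K)
  refine c5.trans (Nat.add_le_add ?_ ?_)
  · exact Nat.mul_le_mul c6 (by omega)
  · exact Nat.mul_le_mul (by omega) c7

end Counting
end FermiGas

/-! ### The weighted Schur test for the double commutator. -/

namespace FermiGas
open scoped ComplexConjugate

section Schur
variable {n : ℕ}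

lemma card_outside_le (B : Finset Mom) (K : Fin n → Mom) : (outside B K).card ≤ n := by
  simpa using Finset.card_le_univ (outside B K)

open Classical in
/-- The weights of the Schur test for the double commutator with the number of excitations. -/
noncomputable def schurWeight (B : Finset Mom) (k : Mom) (lam : ℝ) (q : Fin n × Fin n)
    (K : Fin n → Mom) : ℝ :=
  if Function.Injective (K + transfer q k) then
    lam * (if (outside B (K + transfer q k)).card < (outside B K).card then 1 else 0)
      + lam⁻¹ * (if (outside B K).card < (outside B (K + transfer q k)).card then 1 else 0)
  else 0

lemma schurWeight_nonneg (B : Finset Mom) (k : Mom) {lam : ℝ} (hlam : 0 < lam)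
    (q : Fin n × Fin n) (K : Fin n → Mom) : 0 ≤ schurWeight B k lam q K := by
  unfold schurWeight
  split_ifs <;> positivity

lemma schurWeight_le (B : Finset Mom) (k : Mom) {lam : ℝ} (hlam : 0 < lam)
    (q : Fin n × Fin n) (K : Fin n → Mom) : schurWeight B k lam q K ≤ lam + lam⁻¹ := by
  have := inv_pos.mpr hlam
  unfold schurWeight
  split_ifs <;> linarith

/-- Lowering transfers have weight `lam` and number at most `4 o²`, where `o` particles are outside.
Raising transfers have weight `lam⁻¹` and their number is of order `lam² + lam o`, because
`exitCount` is at most `D lam`. Both contributions are therefore of order `lam (o + 1)²`. -/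
lemma sum_schurWeight_le {B : Finset Mom} (hn : B.card = n) {k : Mom} (hk : k ≠ 0) {lam D : ℝ}
    (hlam : 1 ≤ lam) (hD : 1 ≤ D) (h1 : exitCount B k ≤ D * lam)
    (h2 : exitCount B (-k) ≤ D * lam) {K : Fin n → Mom} (hK : Function.Injective K) :
    ∑ q ∈ Finset.univ.offDiag, schurWeight B k lam q K
      ≤ 2 * D ^ 2 * lam * (2 * (outside B K).card + 1) ^ 2 := by
  classical
  have hlam0 : 0 < lam := by linarith
  let P1 := (Finset.univ : Finset (Fin n)).offDiag.filter fun q =>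
    Function.Injective (K + transfer q k) ∧
      (outside B (K + transfer q k)).card < (outside B K).card
  let P2 := (Finset.univ : Finset (Fin n)).offDiag.filter fun q =>
    Function.Injective (K + transfer q k) ∧
      (outside B K).card < (outside B (K + transfer q k)).card
  have hsum : ∑ q ∈ Finset.univ.offDiag, schurWeight B k lam q K
      = lam * P1.card + lam⁻¹ * P2.card := by
    simp only [P1, P2, Finset.card_filter]
    push_cast
    rw [Finset.mul_sum, Finset.mul_sum, ← Finset.sum_add_distrib]
    refine Finset.sum_congr rfl fun q _ => ?_
    by_cases h : Function.Injective (K + transfer q k) <;> simp [schurWeight, h]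
  have c1 := card_lowering_le hn hK hk P1 fun q hq => by
    obtain ⟨h1, h2, h3⟩ := Finset.mem_filter.mp hq
    exact ⟨(Finset.mem_offDiag.mp h1).2.2, h2, h3⟩
  have c2 := card_raising_le hn hK hk P2 fun q hq => by
    obtain ⟨h1, h2, h3⟩ := Finset.mem_filter.mp hq
    exact ⟨(Finset.mem_offDiag.mp h1).2.2, h2, h3⟩
  rw [hsum]
  set o : ℝ := ((outside B K).card : ℝ) with ho
  have ho0 : 0 ≤ o := Nat.cast_nonneg _
  have d1 : (P1.card : ℝ) ≤ 4 * o ^ 2 := by rw [ho]; exact_mod_cast c1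
  have d2 : (P2.card : ℝ) ≤ exitCount B k * (exitCount B (-k) + 2 * o)
      + (exitCount B k + 2 * o) * exitCount B (-k) := by rw [ho]; exact_mod_cast c2
  have d3 : (P2.card : ℝ) ≤ lam * (2 * D * (D * lam + 2 * o)) := by
    refine d2.trans ?_
    calc _ ≤ (D * lam) * (D * lam + 2 * o) + (D * lam + 2 * o) * (D * lam) := by gcongr
      _ = _ := by ring
  have d4 : lam⁻¹ * P2.card ≤ 2 * D * (D * lam + 2 * o) := by
    rw [inv_mul_le_iff₀ hlam0]
    exact d3
  calc lam * P1.card + lam⁻¹ * P2.card ≤ lam * (4 * o ^ 2) + 2 * D * (D * lam + 2 * o) := by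
        gcongr
    -- The assumption `1 ≤ lam` allows a factor `lam` to be put in front of the term linear in `o`.
    _ ≤ lam * (4 * o ^ 2) + 2 * D * (D * lam + 2 * (lam * o)) := by
        gcongr
        nlinarith
    _ = lam * (4 * o ^ 2 + 2 * D ^ 2 + 4 * (D * o)) := by ring
    _ ≤ lam * (2 * D ^ 2 * (2 * o + 1) ^ 2) := by
        gcongr
        have : D ≤ D ^ 2 := by nlinarith
        nlinarith [mul_le_mul_of_nonneg_right this ho0, sq_nonneg o]
    _ = _ := by ring

/-- The reverse of a lowering transfer is raising, so the two ends carry the weights `lam` and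
`lam⁻¹` in one order or the other, and `2 x y ≤ lam x² + lam⁻¹ y²` applies. Transfers that do not
change the count contribute nothing. The others change it by at most `2`, so the square on the left
is at most `16`. -/
lemma schur_pointwise {c : (Fin n → Mom) → ℂ} (hferm : IsFermionic c) (B : Finset Mom) (k : Mom)
    {lam : ℝ} (hlam : 0 < lam) {q : Fin n × Fin n} (hq : q.1 ≠ q.2) (K : Fin n → Mom) :
    ((2 * (outside B K).card : ℝ) - 2 * (outside B (K + transfer q k)).card) ^ 2
        * (‖c K‖ * ‖c (K + transfer q k)‖)
      ≤ 8 * (schurWeight B k lam q K * ‖c K‖ ^ 2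
        + schurWeight B k lam q.swap (K + transfer q k) * ‖c (K + transfer q k)‖ ^ 2) := by
  have hw1 := schurWeight_nonneg B k hlam q K
  have hw2 := schurWeight_nonneg B k hlam q.swap (K + transfer q k)
  by_cases h1 : c K = 0
  · rw [h1, norm_zero, zero_mul, mul_zero]; positivity
  by_cases h2 : c (K + transfer q k) = 0
  · rw [h2, norm_zero, mul_zero, mul_zero]; positivity
  have hi1 := hferm.injective _ h1
  have hi2 := hferm.injective _ h2
  have hback : K + transfer q k + transfer q.swap k = K := by
    rw [transfer_swap, add_neg_cancel_right]
  have hout := outside_transfer hq B k K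
  rw [schurWeight, schurWeight, hback, if_pos hi1, if_pos hi2]
  set o := (outside B K).card
  set o' := (outside B (K + transfer q k)).card
  set x := ‖c K‖
  set y := ‖c (K + transfer q k)‖
  have hd : ((2 * o : ℝ) - 2 * o') ^ 2 ≤ 16 := by
    have h3 : o ≤ o' + 2 := by split_ifs at hout <;> omega
    have h4 : o' ≤ o + 2 := by split_ifs at hout <;> omega
    have h3' : (o : ℝ) ≤ o' + 2 := by exact_mod_cast h3
    have h4' : (o' : ℝ) ≤ o + 2 := by exact_mod_cast h4
    nlinarith
  have hx : 0 ≤ x := norm_nonneg _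
  have hy : 0 ≤ y := norm_nonneg _
  have hamgm : ∀ a b : ℝ, 2 * (a * b) ≤ lam * a ^ 2 + lam⁻¹ * b ^ 2 := by
    intro a b
    have h5 : 0 ≤ lam⁻¹ * (lam * a - b) ^ 2 := by positivity
    have h6 : lam⁻¹ * (lam * a - b) ^ 2 = lam * a ^ 2 + lam⁻¹ * b ^ 2 - 2 * (a * b) := by
      field_simp
      ring
    linarith
  have hle : ((2 * o : ℝ) - 2 * o') ^ 2 * (x * y) ≤ 16 * (x * y) := by gcongr
  rcases lt_trichotomy o o' with h | h | h
  · have := hamgm y x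
    simp only [h, not_lt_of_gt h, if_true, if_false, mul_one, mul_zero, zero_add, add_zero]
    linarith
  · rw [h]
    simp
  · have := hamgm x y
    simp only [h, not_lt_of_gt h, if_true, if_false, mul_one, mul_zero, zero_add, add_zero]
    linarith

/-- The double commutator of the interaction with the number of excitations. -/
lemma double_commutator_le {c : (Fin n → Mom) → ℂ} (hc : Summable fun K => ‖c K‖ ^ 2)
    (hferm : IsFermionic c) {B : Finset Mom} (hn : B.card = n) {k : Mom} (hk : k ≠ 0) {lam D : ℝ}
    (hlam : 1 ≤ lam) (hD : 1 ≤ D) (h1 : exitCount B k ≤ D * lam)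
    (h2 : exitCount B (-k) ≤ D * lam) :
    ∑ q ∈ Finset.univ.offDiag, ∑' K : Fin n → Mom,
      ((2 * (outside B K).card : ℝ) - 2 * (outside B (K + transfer q k)).card) ^ 2
        * (‖c K‖ * ‖c (K + transfer q k)‖)
      ≤ 32 * D ^ 2 * lam * ∑' K, (2 * (outside B K).card + 1) ^ 2 * ‖c K‖ ^ 2 := by
  have hlam0 : 0 < lam := by linarith
  have hw : ∀ q : Fin n × Fin n, Summable fun K => schurWeight B k lam q K * ‖c K‖ ^ 2 :=
    fun q => summable_bdd_mul (fun K => by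
      rw [abs_of_nonneg (schurWeight_nonneg B k hlam0 q K)]
      exact schurWeight_le B k hlam0 q K) (fun _ => by positivity) hc
  have hg : Summable fun K : Fin n → Mom => (2 * (outside B K).card + 1 : ℝ) ^ 2 * ‖c K‖ ^ 2 := by
    refine summable_bdd_mul (M := (2 * n + 1) ^ 2) (fun K => ?_) (fun _ => by positivity) hc
    rw [abs_of_nonneg (by positivity)]
    have : ((outside B K).card : ℝ) ≤ n := by exact_mod_cast card_outside_le B K
    gcongr
  -- The sum over the final configuration is translated back to `K`, with the pair swapped. After
  -- summing over pairs both halves coincide, and the constant is `(8 + 8) * 2 = 32`.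
  have hstep : ∀ q ∈ (Finset.univ : Finset (Fin n)).offDiag, ∑' K : Fin n → Mom,
      ((2 * (outside B K).card : ℝ) - 2 * (outside B (K + transfer q k)).card) ^ 2
        * (‖c K‖ * ‖c (K + transfer q k)‖)
      ≤ 8 * ∑' K, schurWeight B k lam q K * ‖c K‖ ^ 2
        + 8 * ∑' K, schurWeight B k lam q.swap K * ‖c K‖ ^ 2 := by
    intro q hq
    have hs := (hw q).add (summable_shift (hw q.swap) (transfer q k))
    rw [← tsum_shift (fun K => schurWeight B k lam q.swap K * ‖c K‖ ^ 2) (transfer q k),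
      ← mul_add, ← (hw q).tsum_add (summable_shift (hw q.swap) (transfer q k)), ← tsum_mul_left]
    have hp := schur_pointwise hferm B k hlam0 (Finset.mem_offDiag.mp hq).2.2
    exact Summable.tsum_le_tsum hp
      (Summable.of_nonneg_of_le (fun _ => by positivity) hp (hs.mul_left 8)) (hs.mul_left 8)
  refine (Finset.sum_le_sum hstep).trans ?_
  rw [Finset.sum_add_distrib, ← Finset.mul_sum, ← Finset.mul_sum,
    sum_offDiag_swap fun q => ∑' K, schurWeight B k lam q K * ‖c K‖ ^ 2, ← add_mul,
    ← Summable.tsum_finsetSum fun q _ => hw q]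
  have hfin : ∑' K, ∑ q ∈ Finset.univ.offDiag, schurWeight B k lam q K * ‖c K‖ ^ 2
      ≤ 2 * D ^ 2 * lam * ∑' K, (2 * (outside B K).card + 1 : ℝ) ^ 2 * ‖c K‖ ^ 2 := by
    rw [← tsum_mul_left]
    refine Summable.tsum_le_tsum (fun K => ?_) (summable_sum fun q _ => hw q) (hg.mul_left _)
    rw [← Finset.sum_mul, ← mul_assoc]
    by_cases hK : c K = 0
    · simp [hK]
    · have := sum_schurWeight_le hn hk hlam hD h1 h2 (hferm.injective K hK)
      gcongr
  linarith

end Schur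
end FermiGas

/-! ### Fourier series of the potential. -/

namespace FermiGas
open MeasureTheory Set Filter Topology
open scoped ComplexConjugate ENNReal NNReal

instance : Countable Mom := inferInstanceAs (Countable (ℤ × ℤ))

instance : (volume : Measure Torus2).IsAddHaarMeasure :=
  inferInstanceAs ((volume : Measure (AddCircle (2 * Real.pi))).prod
    (volume : Measure (AddCircle (2 * Real.pi)))).IsAddHaarMeasure

instance (n : ℕ) : BorelSpace (Config n) := Pi.borelSpace

instance (n : ℕ) : (volume : Measure (Config n)).IsAddHaarMeasure := by
  have h : MeasurableAdd Torus2 := inferInstance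
  refine @Measure.pi.isAddHaarMeasure (Fin n) (fun _ => Torus2) _ _
    (fun _ : Fin n => (volume : Measure Torus2)) ?_ ?_ ?_ ?_ ?_
  · intro _; infer_instance
  · intro _; infer_instance
  · intro _; exact h

lemma norm_character (k : Mom) (x : Torus2) : ‖character k x‖ = 1 := by
  simp [character, Circle.norm_coe]

/-- An integrable function on the torus all of whose Fourier coefficients vanish is zero. -/
lemma ae_eq_zero_of_forall_integral_character {f : Torus2 → ℂ} (hf : Integrable f)
    (h : ∀ k, ∫ x, f x * character k x = 0) : f =ᵐ[volume] 0 := by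
  have hbdd : ∀ g : C(Torus2, ℂ), Integrable fun x => f x * g x := fun g =>
    hf.mul_bdd (c := ‖g‖) g.continuous.aestronglyMeasurable
      (Eventually.of_forall fun x => g.norm_coe_le_norm x)
  -- Identifying the torus with configurations of one particle makes the density of the span of
  -- `characters` available for `n = 1`.
  let diag : C(Torus2, Config 1) := ⟨fun x _ => x, by fun_prop⟩
  let Φ : C(Config 1, ℂ) →ₗ[ℂ] ℂ :=
    { toFun := fun g => ∫ x, f x * g (diag x)
      map_add' := fun g g' => by
        refine (integral_congr_ae (Eventually.of_forall fun x => ?_)).trans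
          (integral_add (hbdd (g.comp diag)) (hbdd (g'.comp diag)))
        simp [mul_add]
      map_smul' := fun c g => by
        simp only [ContinuousMap.smul_apply, smul_eq_mul, RingHom.id_apply]
        rw [← integral_const_mul]
        exact integral_congr_ae (Eventually.of_forall fun x => by ring) }
  have hΦc : Continuous Φ := by
    refine (LinearMap.mkContinuous Φ (∫ x, ‖f x‖) fun g => ?_).continuous
    refine (norm_integral_le_integral_norm _).trans ?_
    rw [← integral_mul_const]
    refine integral_mono (hbdd (g.comp diag)).norm (hf.norm.mul_const _) fun x => ?_
    simp only [norm_mul]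
    gcongr
    exact g.norm_coe_le_norm _
  have hΦ0 : ∀ g, Φ g = 0 := by
    intro g
    have hdense : (Submodule.span ℂ (range (characters (n := 1)))).topologicalClosure = ⊤ := by
      rw [← charactersSubalgebra_coe]
      exact congr_arg (Subalgebra.toSubmodule <| StarSubalgebra.toSubalgebra ·)
        (ContinuousMap.starSubalgebra_topologicalClosure_eq_top_of_separatesPoints _
          (charactersSubalgebra_separatesPoints 1))
    have hle : (Submodule.span ℂ (range (characters (n := 1)))).topologicalClosure
        ≤ LinearMap.ker Φ := by
      refine Submodule.topologicalClosure_minimal _ ?_ (isClosed_singleton.preimage hΦc)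
      rw [Submodule.span_le]
      rintro _ ⟨K, rfl⟩
      change ∫ x, f x * characters K (diag x) = 0
      simpa [characters, diag] using h (K 0)
    exact hle (hdense ▸ Submodule.mem_top : g ∈ _)
  -- The functional vanishes on continuous functions. Indicators of closed sets are pointwise limits
  -- of continuous functions bounded by `1`, so dominated convergence extends this to integrals over
  -- closed sets.
  refine ae_eq_zero_of_forall_setIntegral_isClosed_eq_zero hf fun s hs => ?_
  have h0 : ∀ n, ∫ x, f x * ((hs.apprSeq n x : ℝ) : ℂ) = 0 := by
    intro n
    let g : C(Config 1, ℂ) := ⟨fun y => ((hs.apprSeq n (y 0) : ℝ) : ℂ), by fun_prop⟩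
    exact hΦ0 g
  have hlim : Tendsto (fun n => ∫ x, f x * ((hs.apprSeq n x : ℝ) : ℂ)) atTop
      (𝓝 (∫ x, s.indicator f x)) := by
    refine tendsto_integral_of_dominated_convergence (fun x => ‖f x‖) (fun n => ?_) hf.norm
      (fun n => Eventually.of_forall fun x => ?_) (Eventually.of_forall fun x => ?_)
    · refine hf.1.mul (Continuous.aestronglyMeasurable ?_)
      fun_prop
    · rw [norm_mul, Complex.norm_real, Real.norm_eq_abs, NNReal.abs_eq]
      have : (hs.apprSeq n x : ℝ) ≤ 1 := by
        exact_mod_cast HasOuterApproxClosed.apprSeq_apply_le_one hs n x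
      nlinarith [norm_nonneg (f x)]
    · have h1 := tendsto_pi_nhds.mp (HasOuterApproxClosed.tendsto_apprSeq hs) x
      have h2 : Tendsto (fun n => f x * ((hs.apprSeq n x : ℝ) : ℂ)) atTop
          (𝓝 (f x * (((s.indicator (fun _ => (1 : ℝ≥0)) x : ℝ≥0) : ℝ) : ℂ))) := by
        refine Tendsto.const_mul _ ?_
        exact (Complex.continuous_ofReal.tendsto _).comp ((NNReal.continuous_coe.tendsto _).comp h1)
      convert h2 using 2
      by_cases hx : x ∈ s <;> simp [hx]
  rw [integral_indicator hs.measurableSet] at hlim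
  refine tendsto_nhds_unique hlim ?_
  simp_rw [h0]
  exact tendsto_const_nhds

/-- The Fourier series of `V`. -/
noncomputable def fourierCoeffV (V : Torus2 → ℝ) (k : Mom) : ℝ :=
  (Vhat V k).re / (2 * Real.pi) ^ 2

lemma integral_character (k l : Mom) :
    ∫ x : Torus2, character l x * conj (character k x)
      = if k = l then ((2 * Real.pi) ^ 2 : ℂ) else 0 := by
  have hpi : (2 * Real.pi : ℂ) ≠ 0 := by
    exact_mod_cast (mul_ne_zero two_ne_zero Real.pi_ne_zero)
  have h := integral_planeWave k l
  have h1 : ∀ x : Torus2, planeWave l x * conj (planeWave k x)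
      = ((2 * Real.pi : ℂ) ^ 2)⁻¹ * (character l x * conj (character k x)) := by
    intro x
    simp only [planeWave, ContinuousMap.coe_smul, Pi.smul_apply, smul_eq_mul, map_mul, map_inv₀,
      map_ofNat, Complex.conj_ofReal]
    field_simp
  simp_rw [h1] at h
  rw [integral_const_mul] at h
  have h2 := congrArg (fun z => ((2 * Real.pi : ℂ) ^ 2) * z) h
  simp only [← mul_assoc] at h2
  rw [mul_inv_cancel₀ (pow_ne_zero 2 hpi), one_mul] at h2
  rw [h2]
  split_ifs <;> simp

/-- The Fourier series of the potential. -/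
noncomputable def fourierSeries (v : Mom → ℝ) (x : Torus2) : ℂ := ∑' k, (v k : ℂ) * character k x

lemma norm_mul_character (v : Mom → ℝ) (k : Mom) (x : Torus2) :
    ‖(v k : ℂ) * character k x‖ = |v k| := by
  rw [norm_mul, norm_character, mul_one, Complex.norm_real, Real.norm_eq_abs]

lemma continuous_fourierSeries {v : Mom → ℝ} (hv : Summable v) : Continuous (fourierSeries v) :=
  continuous_tsum (fun _ => by fun_prop) hv.abs fun k x => (norm_mul_character v k x).le

/-- Both sides are integrable and have the same Fourier coefficients; the series may be integrated
termwise by absolute summability. The coefficients of `V` being real, `fourierCoeffV` retains all of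
`Vhat`. -/
lemma ae_eq_fourierSeries {V : Torus2 → ℝ} (hV : Integrable V)
    (him : ∀ k, (Vhat V k).im = 0) (hs : Summable (fourierCoeffV V)) :
    ∀ᵐ x, (V x : ℂ) = fourierSeries (fourierCoeffV V) x := by
  set v := fourierCoeffV V with hv
  have hpi : ((2 * Real.pi) ^ 2 : ℝ) ≠ 0 := by positivity
  have hc := continuous_fourierSeries hs
  have hWint : Integrable (fourierSeries v) := by
    obtain ⟨M, hM⟩ := (isCompact_range hc).isBounded.exists_norm_le
    exact Integrable.of_bound hc.aestronglyMeasurable M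
      (Eventually.of_forall fun x => hM _ ⟨x, rfl⟩)
  have hd := ae_eq_zero_of_forall_integral_character (hV.ofReal.sub hWint) fun k => by
    have hVk : ∫ x, (V x : ℂ) * character k x = (v (-k) * (2 * Real.pi) ^ 2 : ℝ) := by
      have : ∫ x, (V x : ℂ) * character k x = Vhat V (-k) := by
        rw [Vhat]
        simp_rw [character_neg, Complex.conj_conj]
      rw [this, hv, fourierCoeffV, div_mul_cancel₀ _ hpi]
      exact Complex.ext (by simp) (by simp [him])
    have hWk : ∫ x, fourierSeries v x * character k x = (v (-k) * (2 * Real.pi) ^ 2 : ℝ) := by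
      have hF : ∀ x, fourierSeries v x * character k x
          = ∑' l, ((v l : ℂ) * character l x) * character k x := fun x => by
        rw [fourierSeries, tsum_mul_right]
      simp_rw [hF]
      have hint : ∀ l, Integrable fun x => (v l : ℂ) * character l x * character k x := fun l => by
        refine Integrable.of_bound (Continuous.aestronglyMeasurable (by fun_prop)) |v l|
          (Eventually.of_forall fun x => ?_)
        rw [norm_mul, norm_mul_character, norm_character, mul_one]
      rw [← integral_tsum_of_summable_integral_norm hint]
      · have hl : ∀ l, ∫ x, (v l : ℂ) * character l x * character k x
            = if l = -k then (v l : ℂ) * (2 * Real.pi) ^ 2 else 0 := by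
          intro l
          have := integral_character (-k) l
          simp_rw [character_neg, Complex.conj_conj] at this
          simp_rw [mul_assoc]
          rw [integral_const_mul, this]
          simp [eq_comm]
        simp_rw [hl]
        rw [tsum_ite_eq]
        push_cast
        rfl
      · simp_rw [norm_mul, norm_character, mul_one, Complex.norm_real, Real.norm_eq_abs]
        simp only [integral_const, smul_eq_mul]
        exact hs.abs.mul_left _
    have hb : ∀ f : Torus2 → ℂ, Integrable f → Integrable fun x => f x * character k x := fun f hf =>
      hf.mul_bdd (c := 1) (character k).continuous.aestronglyMeasurable
        (Eventually.of_forall fun x => (norm_character k x).le)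
    simp only [Pi.sub_apply, sub_mul]
    rw [integral_sub (hb _ hV.ofReal) (hb _ hWint), hWk]
    exact sub_eq_zero.mpr hVk
  filter_upwards [hd] with x hx
  exact sub_eq_zero.mp hx

lemma fourierCoeffV_neg (V : Torus2 → ℝ) (k : Mom) : fourierCoeffV V (-k) = fourierCoeffV V k := by
  have : Vhat V (-k) = conj (Vhat V k) := by
    rw [Vhat, Vhat, ← integral_conj]
    simp [character_neg]
  rw [fourierCoeffV, this, Complex.conj_re, fourierCoeffV]

/-- This evenness turns the sum over `i < j` into half the sum over ordered pairs. -/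
lemma fourierSeries_neg (V : Torus2 → ℝ) (x : Torus2) :
    fourierSeries (fourierCoeffV V) (-x) = fourierSeries (fourierCoeffV V) x := by
  have h : ∀ k : Mom, character k (-x) = character (-k) x := by
    intro k
    simp [character, fourier_apply]
  rw [fourierSeries, fourierSeries, ← (Equiv.neg Mom).tsum_eq]
  refine tsum_congr fun k => ?_
  rw [Equiv.neg_apply, fourierCoeffV_neg, h, neg_neg]

/-- The relative position of two particles has an absolutely continuous distribution. -/
lemma quasiMeasurePreserving_sub_coord {n : ℕ} {i j : Fin n} (hij : i ≠ j) :
    Measure.QuasiMeasurePreserving (fun x : Config n => x i - x j) volume volume := by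
  let φ : Config n →+ Torus2 :=
    { toFun := fun x => x i - x j
      map_zero' := by simp
      map_add' := fun x y => by simp only [Pi.add_apply]; abel }
  have hφ : Continuous φ := by
    change Continuous fun x : Config n => x i - x j
    fun_prop
  have hsurj : Function.Surjective φ := fun y => ⟨Pi.single i y, by
    change (Pi.single i y : Config n) i - (Pi.single i y : Config n) j = y
    simp [Pi.single_eq_of_ne hij.symm]⟩
  have h1 : (Measure.map φ (volume : Measure (Config n))).IsAddHaarMeasure :=
    Measure.isAddHaarMeasure_map_of_isFiniteMeasure _ φ hφ hsurj
  exact ⟨hφ.measurable, Measure.absolutelyContinuous_isAddHaarMeasure _ _⟩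

lemma sum_lt_eq_half_offDiag {n : ℕ} (F : Fin n × Fin n → ℂ) (hF : ∀ q, F q.swap = F q) :
    ∑ i, ∑ j, (if i < j then F (i, j) else 0) = (1 / 2) * ∑ q ∈ Finset.univ.offDiag, F q := by
  have h1 : ∑ i, ∑ j, (if i < j then F (i, j) else 0)
      = ∑ q ∈ Finset.univ.offDiag.filter fun q : Fin n × Fin n => q.1 < q.2, F q := by
    rw [← Fintype.sum_prod_type' (f := fun i j => if i < j then F (i, j) else 0),
      ← Finset.sum_filter]
    refine Finset.sum_congr ?_ fun _ _ => rfl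
    ext q
    simp only [Finset.mem_filter, Finset.mem_univ, true_and, Finset.mem_offDiag]
    exact ⟨fun h => ⟨h.ne, h⟩, fun h => h.2⟩
  have h2 : ∑ q ∈ Finset.univ.offDiag.filter (fun q : Fin n × Fin n => ¬ q.1 < q.2), F q
      = ∑ q ∈ Finset.univ.offDiag.filter (fun q : Fin n × Fin n => q.1 < q.2), F q := by
    refine Finset.sum_nbij' Prod.swap Prod.swap ?_ ?_ ?_ ?_ ?_
    · intro q hq
      simp only [Finset.mem_filter, Finset.mem_offDiag, Finset.mem_univ, true_and] at hq ⊢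
      exact ⟨fun h => hq.1 h.symm, lt_of_le_of_ne (not_lt.mp hq.2) fun h => hq.1 h.symm⟩
    · intro q hq
      simp only [Finset.mem_filter, Finset.mem_offDiag, Finset.mem_univ, true_and] at hq ⊢
      exact ⟨fun h => hq.1 h.symm, not_lt.mpr hq.2.le⟩
    · intro q _; simp
    · intro q _; simp
    · intro q _; exact (hF q).symm
  rw [h1, ← Finset.sum_filter_add_sum_filter_not Finset.univ.offDiag
    (fun q : Fin n × Fin n => q.1 < q.2), h2]
  ring

/-- `V` agrees with its series only off a null set of the torus, whose preimage under each `x_i -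
x_j` is again null. -/
lemma ae_pairPotential_eq {V : Torus2 → ℝ} (hV : Integrable V)
    (him : ∀ k, (Vhat V k).im = 0) (hs : Summable (fourierCoeffV V)) (n : ℕ) :
    ∀ᵐ x : Config n, (pairPotential V x : ℂ)
      = (1 / 2) * ∑ q ∈ Finset.univ.offDiag, fourierSeries (fourierCoeffV V) (x q.1 - x q.2) := by
  have h : ∀ᵐ x : Config n, ∀ q : Fin n × Fin n, q.1 ≠ q.2 →
      (V (x q.1 - x q.2) : ℂ) = fourierSeries (fourierCoeffV V) (x q.1 - x q.2) := by
    rw [ae_all_iff]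
    intro q
    by_cases hq : q.1 = q.2
    · exact Eventually.of_forall fun x h => absurd hq h
    · filter_upwards [(quasiMeasurePreserving_sub_coord hq).ae (ae_eq_fourierSeries hV him hs)]
        with x hx _ using hx
  filter_upwards [h] with x hx
  rw [← sum_lt_eq_half_offDiag (fun q => fourierSeries (fourierCoeffV V) (x q.1 - x q.2))
    fun q => by rw [← fourierSeries_neg]; simp, pairPotential]
  push_cast
  refine Finset.sum_congr rfl fun i _ => Finset.sum_congr rfl fun j _ => ?_
  split_ifs with hij
  · exact hx (i, j) hij.ne
  · simp

end FermiGas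

/-! ### Wave functions and the interaction in plane wave coefficients. -/

namespace FermiGas
open MeasureTheory Set Filter Topology
open scoped ComplexConjugate ENNReal NNReal

section Coefficients
variable {n : ℕ}

/-- The plane wave coefficients of a wave function. -/
noncomputable def coeff (ψ : L2 n) (K : Fin n → Mom) : ℂ := inner ℂ (planeWavesL2 K) ψ

/-- The Hilbert basis of plane waves. -/
noncomputable def planeWaveBasis (n : ℕ) : HilbertBasis (Fin n → Mom) ℂ (L2 n) :=
  HilbertBasis.mk (orthonormal_planeWavesL2 n) (span_planeWavesL2 n).ge

lemma planeWaveBasis_apply (K : Fin n → Mom) : planeWaveBasis n K = planeWavesL2 K := by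
  simp [planeWaveBasis]

lemma planeWaveBasis_repr (ψ : L2 n) (K : Fin n → Mom) :
    (planeWaveBasis n).repr ψ K = coeff ψ K := by
  rw [HilbertBasis.repr_apply_apply, planeWaveBasis_apply, coeff]

lemma hasSum_conj_coeff_mul (η ψ : L2 n) :
    HasSum (fun K => conj (coeff η K) * coeff ψ K) (inner ℂ η ψ) := by
  have h := (planeWaveBasis n).hasSum_inner_mul_inner η ψ
  simpa only [planeWaveBasis_apply, coeff, inner_conj_symm] using h

lemma hasSum_norm_coeff_sq (ψ : L2 n) : HasSum (fun K => ‖coeff ψ K‖ ^ 2) (‖ψ‖ ^ 2) := by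
  have h := hasSum_conj_coeff_mul ψ ψ
  rw [inner_self_eq_norm_sq_to_K] at h
  simp_rw [Complex.conj_mul'] at h
  have h2 := Complex.hasSum_re h
  simpa only [← Complex.ofReal_pow, Complex.ofReal_re, RCLike.ofReal_eq_complex_ofReal] using! h2

lemma isFermionic_coeff {ψ : L2 n} (hψ : ψ ∈ antisym n) : IsFermionic (coeff ψ) where
  comp_perm σ K := inner_planeWaves_comp hψ σ K
  injective K hK := by
    by_contra h
    exact hK (inner_planeWaves_of_not_injective hψ h)

/-- There is a wave function with given square summable coefficients. -/
lemma exists_coeff_eq {f : (Fin n → Mom) → ℂ} (hf : Summable fun K => ‖f K‖ ^ 2) :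
    ∃ η : L2 n, coeff η = f := by
  have hm : Memℓp f 2 := memℓp_gen (by simpa using hf)
  refine ⟨(planeWaveBasis n).repr.symm ⟨f, hm⟩, funext fun K => ?_⟩
  rw [← planeWaveBasis_repr, LinearIsometryEquiv.apply_symm_apply]

/-- The character `exp(i k·(x_i - x_j))`. -/
noncomputable def pairCharacter (q : Fin n × Fin n) (k : Mom) : C(Config n, ℂ) where
  toFun x := character k (x q.1 - x q.2)
  continuous_toFun := by fun_prop

lemma character_sub (k : Mom) (x y : Torus2) :
    character k (x - y) = character k x * conj (character k y) := by
  have h : ∀ (m : ℤ) (a b : AddCircle (2 * Real.pi)),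
      (fourier m (a - b) : ℂ) = fourier m a * conj (fourier m b) := by
    intro m a b
    rw [← fourier_neg, fourier_apply, fourier_apply, fourier_apply, smul_sub, sub_eq_add_neg,
      ← neg_smul, AddCircle.toCircle_add, Circle.coe_mul]
  simp only [character, ContinuousMap.coe_mk, Prod.fst_sub, Prod.snd_sub, map_mul, h]
  ring

lemma prod_character_single (i : Fin n) (k : Mom) (x : Config n) :
    ∏ j, character ((Pi.single i k : Fin n → Mom) j) (x j) = character k (x i) := by
  rw [Finset.prod_eq_single i]
  · simp
  · intro j _ hj
    rw [Pi.single_eq_of_ne hj, character_zero]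
  · simp

lemma characters_add (K L : Fin n → Mom) (x : Config n) :
    characters (K + L) x = characters K x * characters L x := by
  simp [characters, character_add, Finset.prod_mul_distrib]

/-- Multiplication by `exp(i k·(x_i - x_j))` thus moves a plane wave to another plane wave, with
momenta changed by `transfer`. -/
lemma characters_transfer (q : Fin n × Fin n) (k : Mom) (x : Config n) :
    characters (transfer q k) x = pairCharacter q k x := by
  have h1 : transfer q k = Pi.single q.1 k + Pi.single q.2 (-k) := by
    rw [transfer, sub_eq_add_neg, Pi.single_neg]
  rw [h1, characters_add]
  simp only [characters, pairCharacter, ContinuousMap.coe_mk]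
  rw [prod_character_single, prod_character_single, character_sub, character_neg]

lemma planeWaves_add_transfer (q : Fin n × Fin n) (k : Mom) (K : Fin n → Mom) (x : Config n) :
    planeWaves (K + transfer q k) x = planeWaves K x * pairCharacter q k x := by
  simp only [planeWaves_eq, ContinuousMap.coe_smul, Pi.smul_apply, smul_eq_mul, characters_add,
    characters_transfer]
  ring

lemma pairCharacter_swap (q : Fin n × Fin n) (k : Mom) (x : Config n) :
    pairCharacter q.swap k x = conj (pairCharacter q k x) := by
  simp only [pairCharacter, ContinuousMap.coe_mk, Prod.fst_swap, Prod.snd_swap, character_sub,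
    map_mul, Complex.conj_conj]
  ring

lemma norm_pairCharacter (q : Fin n × Fin n) (k : Mom) (x : Config n) :
    ‖pairCharacter q k x‖ = 1 := norm_character _ _

lemma memLp_pairCharacter_mul (q : Fin n × Fin n) (k : Mom) (ψ : L2 n) :
    MemLp (fun x => pairCharacter q k x * ψ x) 2 :=
  (Lp.memLp ψ).of_le
    ((pairCharacter q k).continuous.aestronglyMeasurable.mul (Lp.aestronglyMeasurable ψ))
    (Eventually.of_forall fun x => by rw [norm_mul, norm_pairCharacter, one_mul])

/-- Multiplication by a character of the relative position. -/
noncomputable def mulPairCharacter (q : Fin n × Fin n) (k : Mom) (ψ : L2 n) : L2 n :=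
  (memLp_pairCharacter_mul q k ψ).toLp

lemma inner_mulPairCharacter (q : Fin n × Fin n) (k : Mom) (η ψ : L2 n) :
    inner ℂ η (mulPairCharacter q k ψ) = ∫ x, pairCharacter q k x * (ψ x * conj (η x)) := by
  rw [L2.inner_def]
  refine integral_congr_ae ?_
  filter_upwards [(memLp_pairCharacter_mul q k ψ).coeFn_toLp] with x hx
  rw [mulPairCharacter, hx, RCLike.inner_apply]
  ring

lemma coeff_eq_integral (ψ : L2 n) (K : Fin n → Mom) :
    coeff ψ K = ∫ x, ψ x * conj (planeWaves K x) := by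
  rw [coeff, L2.inner_def]
  refine integral_congr_ae ?_
  filter_upwards [ContinuousMap.coeFn_toLp (p := 2) (𝕜 := ℂ) volume (planeWaves K)] with x hx
  rw [planeWavesL2, hx, RCLike.inner_apply]

/-- The character is moved onto the plane wave, where it appears conjugated; this reverses the pair.
-/
lemma coeff_mulPairCharacter (q : Fin n × Fin n) (k : Mom) (ψ : L2 n) (K : Fin n → Mom) :
    coeff (mulPairCharacter q k ψ) K = coeff ψ (K + transfer q.swap k) := by
  rw [coeff_eq_integral ψ, coeff, inner_mulPairCharacter]
  refine integral_congr_ae ?_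
  filter_upwards [ContinuousMap.coeFn_toLp (p := 2) (𝕜 := ℂ) volume (planeWaves K)] with x hx
  rw [planeWavesL2, hx, planeWaves_add_transfer, map_mul, pairCharacter_swap, Complex.conj_conj]
  ring

lemma integrable_mul_conj (η ψ : L2 n) : Integrable fun x => ψ x * conj (η x) := by
  have h := L2.integrable_inner (𝕜 := ℂ) η ψ
  exact h.congr (Eventually.of_forall fun x => RCLike.inner_apply _ _)

lemma integral_pairCharacter_mul (q : Fin n × Fin n) (k : Mom) (η ψ : L2 n) :
    ∫ x, pairCharacter q k x * (ψ x * conj (η x))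
      = ∑' K, conj (coeff η K) * coeff ψ (K + transfer q.swap k) := by
  rw [← inner_mulPairCharacter, ← (hasSum_conj_coeff_mul η _).tsum_eq]
  simp_rw [coeff_mulPairCharacter]

/-- The characters have modulus one, so the summability of `v` permits exchanging sum and integral.
-/
lemma hasSum_integral_fourierSeries {v : Mom → ℝ} (hv : Summable v) (q : Fin n × Fin n)
    {h : Config n → ℂ} (hh : Integrable h) :
    HasSum (fun k => (v k : ℂ) * ∫ x, pairCharacter q k x * h x)
      (∫ x, fourierSeries v (x q.1 - x q.2) * h x) := by
  have hint : ∀ k, Integrable fun x => (v k : ℂ) * (pairCharacter q k x * h x) := fun k =>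
    (hh.bdd_mul (c := 1) (pairCharacter q k).continuous.aestronglyMeasurable
      (Eventually.of_forall fun x => (norm_pairCharacter q k x).le)).const_mul _
  have hs := hasSum_integral_of_summable_integral_norm hint (by
    simp_rw [norm_mul, norm_pairCharacter, one_mul, Complex.norm_real, Real.norm_eq_abs,
      integral_const_mul]
    exact hv.abs.mul_right _)
  simp_rw [integral_const_mul] at hs
  have he : (fun x : Config n => fourierSeries v (x q.1 - x q.2) * h x)
      = fun x => ∑' k, (v k : ℂ) * (pairCharacter q k x * h x) := funext fun x => by
    rw [fourierSeries, ← tsum_mul_right]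
    exact tsum_congr fun k => mul_assoc _ _ _
  rw [he]
  exact hs

lemma integrable_fourierSeries_mul {v : Mom → ℝ} (hv : Summable v) (q : Fin n × Fin n)
    {h : Config n → ℂ} (hh : Integrable h) :
    Integrable fun x => fourierSeries v (x q.1 - x q.2) * h x := by
  have hc := continuous_fourierSeries hv
  refine hh.bdd_mul (c := ∑' k, |v k|) (Continuous.aestronglyMeasurable ?_)
    (Eventually.of_forall fun x => ?_)
  · exact hc.comp (by fun_prop)
  · refine tsum_of_norm_bounded hv.abs.hasSum fun k => (norm_mul_character v k _).le

/-- The interaction in terms of plane wave coefficients. -/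
lemma hasSum_hop {V : Torus2 → ℝ} (hV : Integrable V)
    (him : ∀ k, (Vhat V k).im = 0) (hs : Summable (fourierCoeffV V)) (η ψ : L2 n) :
    HasSum (fun k => (fourierCoeffV V k : ℂ) * hop k (coeff η) (coeff ψ))
      (2 * ∫ x, (pairPotential V x : ℂ) * (ψ x * conj (η x))) := by
  set v := fourierCoeffV V
  have hh := integrable_mul_conj η ψ
  have h1 : 2 * ∫ x, (pairPotential V x : ℂ) * (ψ x * conj (η x))
      = ∑ q ∈ Finset.univ.offDiag, ∫ x, fourierSeries v (x q.1 - x q.2) * (ψ x * conj (η x)) := by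
    rw [← integral_finsetSum _ fun q _ => integrable_fourierSeries_mul hs q hh,
      ← integral_const_mul]
    refine integral_congr_ae ?_
    filter_upwards [ae_pairPotential_eq hV him hs n] with x hx
    rw [hx, ← Finset.sum_mul]
    ring
  rw [h1]
  have h2 := hasSum_sum fun (q : Fin n × Fin n) (_ : q ∈ Finset.univ.offDiag) =>
    hasSum_integral_fourierSeries hs q hh
  convert h2 using 2 with k
  -- The reversal of the pair in `integral_pairCharacter_mul` is undone by reindexing the ordered
  -- pairs.
  rw [← Finset.mul_sum, hop, ← sum_offDiag_swap]
  simp_rw [integral_pairCharacter_mul]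

lemma hasSum_hop_self {V : Torus2 → ℝ} (hV : Integrable V)
    (him : ∀ k, (Vhat V k).im = 0) (hs : Summable (fourierCoeffV V)) (ψ : L2 n) :
    HasSum (fun k => fourierCoeffV V k * (hop k (coeff ψ) (coeff ψ)).re)
      (2 * ∫ x, pairPotential V x * ‖ψ x‖ ^ 2) := by
  have h := Complex.hasSum_re (hasSum_hop hV him hs ψ ψ)
  simp_rw [Complex.re_ofReal_mul] at h
  convert h using 1
  have h2 : ∀ x, (pairPotential V x : ℂ) * (ψ x * conj (ψ x))
      = ((pairPotential V x * ‖ψ x‖ ^ 2 : ℝ) : ℂ) := by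
    intro x
    rw [Complex.mul_conj']
    push_cast
    ring
  simp_rw [h2]
  rw [integral_complex_ofReal, ← Complex.ofReal_ofNat, ← Complex.ofReal_mul, Complex.ofReal_re]

end Coefficients
end FermiGas

/-! ### Energy bounds for approximate ground states and eigenvectors. -/

namespace FermiGas
open MeasureTheory Set Filter Topology
open scoped ComplexConjugate ENNReal NNReal

section Energy
variable {N : ℕ} {kF : ℝ}

lemma image_orderEmbOfFin_comp {n : ℕ} (S : Finset Mom) (h : S.card = n)
    (σ : Equiv.Perm (Fin n)) : Finset.univ.image (S.orderEmbOfFin h ∘ σ) = S := by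
  rw [← Finset.coe_inj, Finset.coe_image, Finset.coe_univ, Set.image_univ, Set.range_comp,
    σ.surjective.range_eq, Set.image_univ, Finset.range_orderEmbOfFin]

/-- A nonzero coefficient belongs to distinct momenta, hence to an ordering of some `S`. It is then
a multiple of the inner product of the Slater determinants of `S` and `B`, which vanishes unless `S
= B`. -/
lemma image_eq_of_coeff_slaterL2_ne_zero {n : ℕ} {B : Finset Mom} (h : B.card = n)
    {K : Fin n → Mom} (hK : coeff (slaterL2 B h) K ≠ 0) : Finset.univ.image K = B := by
  have hf := isFermionic_coeff (slaterL2_mem B h)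
  obtain ⟨S, hS, σ, rfl⟩ := exists_orderEmb_comp (hf.injective K hK)
  rw [image_orderEmbOfFin_comp]
  by_contra hne
  have h1 := inner_slaterL2_slaterL2 S B hS h
  rw [if_neg hne, inner_slaterL2 S hS (slaterL2_mem B h)] at h1
  have h2 : coeff (slaterL2 B h) (S.orderEmbOfFin hS) = 0 :=
    (mul_eq_zero.mp h1).resolve_left (by
      refine Complex.ofReal_ne_zero.mpr ?_
      exact (Real.sqrt_pos.mpr (by exact_mod_cast n.factorial_pos)).ne')
  rw [hf.comp_perm, h2, mul_zero] at hK
  exact hK rfl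

lemma norm_slaterL2 {n : ℕ} (B : Finset Mom) (h : B.card = n) : ‖slaterL2 B h‖ = 1 := by
  have h2 := inner_self_eq_norm_sq (𝕜 := ℂ) (slaterL2 B h)
  rw [inner_slaterL2_slaterL2, if_pos rfl, RCLike.one_re] at h2
  nlinarith [norm_nonneg (slaterL2 B h)]

/-- The kinetic energy `∑_j |K_j|²`. -/
noncomputable def kinetic {n : ℕ} (K : Fin n → Mom) : ℝ := ∑ j, normSq (K j)

/-- The kinetic excitation energy `ħ² (∑_j |K_j|² - ∑_{p ∈ B} |p|²)`. -/
noncomputable def excessKinetic (kF : ℝ) (K : Fin N → Mom) : ℝ :=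
  hbar N ^ 2 * (kinetic K - ∑ p ∈ fermiBall kF, normSq p)

lemma kinetic_nonneg {n : ℕ} (K : Fin n → Mom) : 0 ≤ kinetic K :=
  Finset.sum_nonneg fun _ _ => normSq_nonneg _

lemma kinetic_eq_sum_image {n : ℕ} {K : Fin n → Mom} (hK : Function.Injective K) :
    kinetic K = ∑ p ∈ Finset.univ.image K, normSq p := by
  rw [Finset.sum_image hK.injOn, kinetic]

/-- The excess kinetic energy is the sum of the energies of the excitations. -/
lemma excessKinetic_eq (hcard : (fermiBall kF).card = N) {K : Fin N → Mom}
    (hK : Function.Injective K) :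
    excessKinetic kF K
      = ∑ p ∈ symmDiff (Finset.univ.image K) (fermiBall kF), excitationEnergy N kF p := by
  set S := Finset.univ.image K with hS
  set B := fermiBall kF
  have hSc : S.card = N := by
    rw [hS, Finset.card_image_of_injective _ hK, Finset.card_univ, Fintype.card_fin]
  have h1 : ∑ p ∈ S \ B, excitationEnergy N kF p
      = hbar N ^ 2 * ∑ p ∈ S \ B, (normSq p - kF ^ 2) := by
    rw [Finset.mul_sum]
    refine Finset.sum_congr rfl fun p hp => ?_
    have : kF ^ 2 ≤ normSq p := not_lt.mp fun h =>
      (Finset.mem_sdiff.mp hp).2 (mem_fermiBall.mpr h)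
    rw [excitationEnergy, abs_of_nonneg (by linarith)]
  have h2 : ∑ p ∈ B \ S, excitationEnergy N kF p
      = -(hbar N ^ 2 * ∑ p ∈ B \ S, (normSq p - kF ^ 2)) := by
    rw [Finset.mul_sum, ← Finset.sum_neg_distrib]
    refine Finset.sum_congr rfl fun p hp => ?_
    have : normSq p < kF ^ 2 := mem_fermiBall.mp (Finset.mem_sdiff.mp hp).1
    rw [excitationEnergy, abs_of_neg (by linarith)]
    ring
  have h3 : symmDiff S B = (S \ B) ∪ (B \ S) := rfl
  rw [h3, Finset.sum_union disjoint_sdiff_sdiff, h1, h2, excessKinetic, kinetic_eq_sum_image hK]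
  -- The common part of `S` and `B` drops out of the difference, and so do the terms `k_F²`, as both
  -- sets have `N` elements.
  have h4 := Finset.sum_sdiff_sub_sum_sdiff (s₁ := B) (s₂ := S) (f := fun p => normSq p - kF ^ 2)
  rw [Finset.sum_sub_distrib _ _ (s := S), Finset.sum_sub_distrib _ _ (s := B), Finset.sum_const,
    Finset.sum_const, hSc, hcard] at h4
  linear_combination -(hbar N ^ 2) * h4

/-- `∑_k |k| v(k)` -/
noncomputable def gradNorm (v : Mom → ℝ) : ℝ := ∑' k, Real.sqrt (normSq k) * v k

/-- Nonzero momenta have `|k| ≥ 1`; the term `k = 0`, invisible to the weight, is added by hand. -/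
lemma summable_of_summable_grad {v : Mom → ℝ} (hv0 : ∀ k, 0 ≤ v k)
    (hv : Summable fun k => Real.sqrt (normSq k) * v k) : Summable v := by
  refine Summable.of_nonneg_of_le hv0 (fun k => ?_)
    (hv.add (summable_of_hasFiniteSupport (f := fun k => if k = 0 then v 0 else 0)
      ((Set.finite_singleton (0 : Mom)).subset fun k hk => by
        by_contra h
        exact hk (if_neg h))))
  have := hv0 k
  by_cases h : k = 0
  · simp [h, normSq]
  · have h1 : 1 ≤ Real.sqrt (normSq k) := Real.one_le_sqrt.mpr (one_le_normSq h)
    rw [if_neg h, add_zero]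
    nlinarith

lemma gradNorm_nonneg {v : Mom → ℝ} (hv0 : ∀ k, 0 ≤ v k) : 0 ≤ gradNorm v :=
  tsum_nonneg fun k => mul_nonneg (Real.sqrt_nonneg _) (hv0 k)

lemma sqrt_mul_inv (hN : 1 ≤ N) : Real.sqrt N * (N : ℝ)⁻¹ = hbar N := by
  have hN0 : (0 : ℝ) < N := by exact_mod_cast hN
  rw [Real.sqrt_eq_rpow, ← Real.rpow_neg_one, ← Real.rpow_add hN0, hbar]
  norm_num

/-- The interaction of any state is at least the one of the Fermi sea, up to `O(|k| √N)`. -/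
lemma IsFermiMomentum.re_hop_ge (hF : IsFermiMomentum N kF) {f : (Fin N → Mom) → ℂ}
    (hf : Summable fun K => ‖f K‖ ^ 2) (k : Mom) :
    ((hop k (coeff (slaterL2 (fermiBall kF) hF.card_eq))
        (coeff (slaterL2 (fermiBall kF) hF.card_eq))).re
      - 10 * (Real.sqrt (normSq k) * Real.sqrt N)) * ∑' K, ‖f K‖ ^ 2 ≤ (hop k f f).re := by
  have hs := hasSum_norm_coeff_sq (slaterL2 (fermiBall kF) hF.card_eq)
  rw [norm_slaterL2, one_pow] at hs
  have hf0 : 0 ≤ ∑' K, ‖f K‖ ^ 2 := tsum_nonneg fun _ => by positivity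
  by_cases hk : k = 0
  · subst hk
    rw [hop_zero, hop_zero, hs.tsum_eq]
    have : 0 ≤ Real.sqrt (normSq 0) * Real.sqrt N := by positivity
    nlinarith
  -- For `k ≠ 0` the filled ball attains the universal lower bound `-N` up to `exitCount`, which is
  -- the entire loss.
  · rw [re_hop_filled hs.summable (isFermionic_coeff (slaterL2_mem _ _))
      (fun K hK => image_eq_of_coeff_slaterL2_ne_zero hF.card_eq hK) hk, hs.tsum_eq]
    have h1 := re_hop_self_ge hf k
    have h2 := hF.exitCount_le k
    nlinarith

/-- The energy of the Fermi sea. -/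
lemma energyFS_eq (V : Torus2 → ℝ) (hF : IsFermiMomentum N kF) :
    energyFS V hF = hbar N ^ 2 * ∑ p ∈ fermiBall kF, normSq p
      + (N : ℝ)⁻¹ * ∫ x, pairPotential V x * ‖slaterL2 (fermiBall kF) hF.card_eq x‖ ^ 2 := by
  have hs := hasSum_norm_coeff_sq (slaterL2 (fermiBall kF) hF.card_eq)
  rw [norm_slaterL2, one_pow] at hs
  rw [energyFS, energy]
  congr 2
  calc _ = ∑' K, (∑ p ∈ fermiBall kF, normSq p)
        * ‖coeff (slaterL2 (fermiBall kF) hF.card_eq) K‖ ^ 2 := by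
        refine tsum_congr fun K => ?_
        change kinetic K * ‖coeff (slaterL2 (fermiBall kF) hF.card_eq) K‖ ^ 2 = _
        by_cases hK : coeff (slaterL2 (fermiBall kF) hF.card_eq) K = 0
        · simp [hK]
        · rw [kinetic_eq_sum_image
            ((isFermionic_coeff (slaterL2_mem _ _)).injective K hK),
            image_eq_of_coeff_slaterL2_ne_zero hF.card_eq hK]
    _ = _ := by rw [tsum_mul_left, hs.tsum_eq, mul_one]

variable {V : Torus2 → ℝ}

lemma summable_kinetic {ψ : L2 N} (hfin : FiniteKinetic ψ) :
    Summable fun K => kinetic K * ‖coeff ψ K‖ ^ 2 := hfin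

lemma summable_mul_excessKinetic {ψ : L2 N} (hfin : FiniteKinetic ψ) {F : (Fin N → Mom) → ℝ}
    {M : ℝ} (hF : ∀ K, |F K| ≤ M) (kF : ℝ) :
    Summable fun K => F K * (excessKinetic kF K * ‖coeff ψ K‖ ^ 2) := by
  have h1 := summable_bdd_mul hF (fun K => mul_nonneg (kinetic_nonneg K) (sq_nonneg _))
    (summable_kinetic hfin)
  have h2 := summable_bdd_mul hF (fun K => sq_nonneg _) (hasSum_norm_coeff_sq ψ).summable
  refine ((h1.sub (h2.mul_left (∑ p ∈ fermiBall kF, normSq p))).mul_left (hbar N ^ 2)).congr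
    fun K => ?_
  rw [excessKinetic]
  ring

lemma tsum_mul_excessKinetic {ψ : L2 N} (hfin : FiniteKinetic ψ) {F : (Fin N → Mom) → ℝ}
    {M : ℝ} (hF : ∀ K, |F K| ≤ M) (kF : ℝ) :
    ∑' K, F K * (excessKinetic kF K * ‖coeff ψ K‖ ^ 2)
      = hbar N ^ 2 * (∑' K, F K * (kinetic K * ‖coeff ψ K‖ ^ 2)
        - (∑ p ∈ fermiBall kF, normSq p) * ∑' K, F K * ‖coeff ψ K‖ ^ 2) := by
  have h1 := summable_bdd_mul hF (fun K => mul_nonneg (kinetic_nonneg K) (sq_nonneg _))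
    (summable_kinetic hfin)
  have h2 := summable_bdd_mul hF (fun K => sq_nonneg _) (hasSum_norm_coeff_sq ψ).summable
  rw [← tsum_mul_left, ← h1.tsum_sub (h2.mul_left _), ← tsum_mul_left]
  refine tsum_congr fun K => ?_
  rw [excessKinetic]
  ring

/-- The energy of any state bounds its excess kinetic energy. -/
lemma IsFermiMomentum.tsum_excessKinetic_le (hF : IsFermiMomentum N kF) (hV : Integrable V)
    (him : ∀ k, (Vhat V k).im = 0) (hv0 : ∀ k, 0 ≤ fourierCoeffV V k)
    (hsum : Summable fun k => Real.sqrt (normSq k) * fourierCoeffV V k)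
    {ψ : L2 N} (hnorm : ‖ψ‖ = 1) (hfin : FiniteKinetic ψ) :
    ∑' K, excessKinetic kF K * ‖coeff ψ K‖ ^ 2
      ≤ energy V ψ - energyFS V hF + 5 * gradNorm (fourierCoeffV V) * hbar N := by
  set v := fourierCoeffV V
  set φ := slaterL2 (fermiBall kF) hF.card_eq
  have hs := summable_of_summable_grad hv0 hsum
  have ha := hasSum_norm_coeff_sq ψ
  rw [hnorm, one_pow] at ha
  have h1 := hasSum_hop_self hV him hs ψ
  -- The loss `10 |k| √N` per mode is multiplied by `v k`, summed, divided by `N`, and halved since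
  -- `hop` counts ordered pairs: this gives `5 * gradNorm v * hbar N`.
  have h2 := (hasSum_hop_self hV him hs φ).sub (hsum.hasSum.mul_left (10 * Real.sqrt N))
  have h3 := hasSum_le (fun k => ?_) h2 h1
  · have h4 := tsum_mul_excessKinetic (F := fun _ => 1) hfin (M := 1) (fun _ => by simp) kF
    simp only [one_mul] at h4
    rw [ha.tsum_eq, mul_one] at h4
    rw [h4, energyFS_eq, energy]
    have h5 := mul_le_mul_of_nonneg_left h3 (inv_nonneg.mpr (Nat.cast_nonneg (α := ℝ) N))
    have h6 := sqrt_mul_inv hF.one_le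
    have h7 : (N : ℝ)⁻¹ * (10 * Real.sqrt N * gradNorm v) = 10 * gradNorm v * hbar N := by
      rw [← h6]; ring
    rw [mul_sub] at h5
    change _ - (N : ℝ)⁻¹ * (10 * Real.sqrt N * gradNorm v) ≤ _ at h5
    rw [h7] at h5
    change hbar N ^ 2 * (_ - _) ≤ hbar N ^ 2 * ∑' K, kinetic K * ‖coeff ψ K‖ ^ 2 + _ - _ + _
    linarith
  · have := hF.re_hop_ge ha.summable k
    rw [ha.tsum_eq, mul_one] at this
    nlinarith [hv0 k, mul_le_mul_of_nonneg_left this (hv0 k)]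

/-- Testing the eigenvalue equation. -/
lemma eigen_inner {ψ φ : L2 N} {E : ℂ} (hφ : IsNegLaplacian ψ φ)
    (hE : ∀ᵐ x : Config N, ((hbar N ^ 2 : ℝ) : ℂ) * φ x
      + (((N : ℝ)⁻¹ * pairPotential V x : ℝ) : ℂ) * ψ x = E * ψ x)
    {F : (Fin N → Mom) → ℝ} {η : L2 N}
    (hη : coeff η = fun K => (F K : ℂ) * coeff ψ K) :
    hbar N ^ 2 * ∑' K, F K * (kinetic K * ‖coeff ψ K‖ ^ 2)
      + (N : ℝ)⁻¹ * (∫ x, (pairPotential V x : ℂ) * (ψ x * conj (η x))).re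
      = E.re * ∑' K, F K * ‖coeff ψ K‖ ^ 2 := by
  have h1 : inner ℂ η φ = ((∑' K, F K * (kinetic K * ‖coeff ψ K‖ ^ 2) : ℝ) : ℂ) := by
    rw [← (hasSum_conj_coeff_mul η φ).tsum_eq, Complex.ofReal_tsum]
    refine tsum_congr fun K => ?_
    have : coeff φ K = (kinetic K : ℂ) * coeff ψ K := hφ K
    rw [this, hη]
    simp only [map_mul, Complex.conj_ofReal]
    push_cast
    rw [← Complex.conj_mul']
    ring
  have h2 : inner ℂ η ψ = ((∑' K, F K * ‖coeff ψ K‖ ^ 2 : ℝ) : ℂ) := by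
    rw [← (hasSum_conj_coeff_mul η ψ).tsum_eq, Complex.ofReal_tsum]
    refine tsum_congr fun K => ?_
    rw [hη]
    simp only [map_mul, Complex.conj_ofReal]
    push_cast
    rw [← Complex.conj_mul']
    ring
  have hin : ∀ χ : L2 N, inner ℂ η χ = ∫ x, χ x * conj (η x) := fun χ => by
    rw [L2.inner_def]
    exact integral_congr_ae (Eventually.of_forall fun x => RCLike.inner_apply _ _)
  have h3 : ((N : ℝ)⁻¹ : ℂ) * ∫ x, (pairPotential V x : ℂ) * (ψ x * conj (η x))
      = E * inner ℂ η ψ - ((hbar N ^ 2 : ℝ) : ℂ) * inner ℂ η φ := by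
    rw [hin, hin, ← integral_const_mul, ← integral_const_mul, ← integral_const_mul,
      ← integral_sub ((integrable_mul_conj η ψ).const_mul _)
        ((integrable_mul_conj η φ).const_mul _)]
    refine integral_congr_ae ?_
    filter_upwards [hE] with x hx
    push_cast at hx ⊢
    linear_combination conj (η x) * hx
  rw [h1, h2] at h3
  have h4 := congrArg Complex.re h3
  rw [Complex.sub_re, Complex.re_ofReal_mul, Complex.re_mul_ofReal, ← Complex.ofReal_inv,
    Complex.re_ofReal_mul, Complex.ofReal_re] at h4
  linarith

/-- Propagation of the a priori bounds for eigenvectors: `⟨g² ℍ₀⟩ ≤ C ħ ⟨(g + 1)²⟩`, where `g`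
is the number of excitations. -/
lemma IsFermiMomentum.tsum_sq_mul_excessKinetic_le (hF : IsFermiMomentum N kF)
    (hV : Integrable V)
    (him : ∀ k, (Vhat V k).im = 0) (hv0 : ∀ k, 0 ≤ fourierCoeffV V k)
    (hsum : Summable fun k => Real.sqrt (normSq k) * fourierCoeffV V k)
    {ψ : L2 N} (hanti : ψ ∈ antisym N) (hnorm : ‖ψ‖ = 1) (hfin : FiniteKinetic ψ)
    (heig : IsEigenvector V ψ) {C₀ : ℝ} (hC₀ : energy V ψ - energyFS V hF ≤ C₀ * hbar N) :
    ∑' K, (2 * (outside (fermiBall kF) K).card : ℝ) ^ 2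
        * (excessKinetic kF K * ‖coeff ψ K‖ ^ 2)
      ≤ (|C₀| + 805 * gradNorm (fourierCoeffV V)) * hbar N
        * ∑' K, (2 * (outside (fermiBall kF) K).card + 1 : ℝ) ^ 2 * ‖coeff ψ K‖ ^ 2 := by
  set v := fourierCoeffV V
  set χ := slaterL2 (fermiBall kF) hF.card_eq with hχ
  set g : (Fin N → Mom) → ℝ := fun K => 2 * (outside (fermiBall kF) K).card with hg
  obtain ⟨-, E, φ, hφ, hE⟩ := heig
  have hs := summable_of_summable_grad hv0 hsum
  have ha := hasSum_norm_coeff_sq ψ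
  rw [hnorm, one_pow] at ha
  have hferm := isFermionic_coeff hanti
  have hg0 : ∀ K, 0 ≤ g K := fun K => by simp only [hg]; positivity
  have hgN : ∀ K, g K ≤ 2 * N := fun K => by
    have : ((outside (fermiBall kF) K).card : ℝ) ≤ N := by exact_mod_cast card_outside_le _ K
    simp only [hg]
    linarith
  have hgabs : ∀ K, |g K| ≤ 2 * N := fun K => by rw [abs_of_nonneg (hg0 K)]; exact hgN K
  have hg2abs : ∀ K, |g K ^ 2| ≤ (2 * N) ^ 2 := fun K => by
    rw [abs_pow]; have := hgabs K; gcongr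
  have hsq : ∀ (F : (Fin N → Mom) → ℝ) (M : ℝ), (∀ K, |F K| ≤ M) →
      Summable fun K => ‖(F K : ℂ) * coeff ψ K‖ ^ 2 := fun F M hFM => by
    have hM : 0 ≤ M := (abs_nonneg _).trans (hFM 0)
    refine Summable.of_nonneg_of_le (fun _ => by positivity) (fun K => ?_)
      (ha.summable.mul_left (M ^ 2))
    rw [norm_mul, mul_pow, Complex.norm_real, Real.norm_eq_abs]
    have := hFM K
    gcongr
  -- The test vector is `g² ψ`; it is square integrable because `g ≤ 2 N` is bounded.
  obtain ⟨η, hη⟩ := exists_coeff_eq (hsq _ _ hg2abs)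
  -- the eigenvalue
  have hEre : E.re = energy V ψ := by
    have h := eigen_inner (F := fun _ => 1) hφ hE (η := ψ)
      (by simp)
    simp only [one_mul] at h
    rw [ha.tsum_eq, mul_one] at h
    rw [← h, energy]
    congr 2
    have h2 : ∀ x, (pairPotential V x : ℂ) * (ψ x * conj (ψ x))
        = ((pairPotential V x * ‖ψ x‖ ^ 2 : ℝ) : ℂ) := by
      intro x
      rw [Complex.mul_conj']
      push_cast
      ring
    simp_rw [h2]
    rw [integral_complex_ofReal, Complex.ofReal_re]
  -- the localized interaction
  set G2 := ∑' K, g K ^ 2 * ‖coeff ψ K‖ ^ 2 with hG2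
  set M1 := ∑' K, (g K + 1) ^ 2 * ‖coeff ψ K‖ ^ 2 with hM1
  have hsG2 : Summable fun K => g K ^ 2 * ‖coeff ψ K‖ ^ 2 :=
    summable_bdd_mul hg2abs (fun _ => sq_nonneg _) ha.summable
  have hsM1 : Summable fun K => (g K + 1) ^ 2 * ‖coeff ψ K‖ ^ 2 :=
    summable_bdd_mul (M := (2 * N + 1) ^ 2) (fun K => by
      have h1 := hg0 K
      have h2 := hgN K
      rw [abs_of_nonneg (by positivity)]
      gcongr) (fun _ => sq_nonneg _) ha.summable
  have hG2M1 : G2 ≤ M1 := hsG2.tsum_le_tsum (fun K => by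
    have := hg0 K
    gcongr
    linarith) hsM1
  have hG20 : 0 ≤ G2 := tsum_nonneg fun _ => by positivity
  -- Localization reduces to the lower bound in the state `g ψ`, whose squared norm is `G2`. The
  -- error is half of the double commutator, taken with `lam = |k| √N` and `D = 10` from the surface
  -- estimate, hence `1600 = 32 * 10² / 2`.
  have hop_ge : ∀ k, ((hop k (coeff χ) (coeff χ)).re
        - 10 * (Real.sqrt (normSq k) * Real.sqrt N)) * G2
        - 1600 * (Real.sqrt (normSq k) * Real.sqrt N) * M1
      ≤ (hop k (coeff η) (coeff ψ)).re := by
    intro k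
    have h1 := re_hop_sq_ge ha.summable hgabs k
    have h2 := hF.re_hop_ge (hsq _ _ hgabs) k
    have h3 : ∑' K, ‖(g K : ℂ) * coeff ψ K‖ ^ 2 = G2 := tsum_congr fun K => by
      rw [norm_mul, mul_pow, Complex.norm_real, Real.norm_eq_abs, sq_abs]
    rw [h3] at h2
    have h4 : ∑ q ∈ Finset.univ.offDiag, ∑' K, (g K - g (K + transfer q k)) ^ 2
        * (‖coeff ψ K‖ * ‖coeff ψ (K + transfer q k)‖)
        ≤ 32 * 10 ^ 2 * (Real.sqrt (normSq k) * Real.sqrt N) * M1 := by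
      by_cases hk : k = 0
      · subst hk
        simp only [transfer_zero, add_zero, sub_self]
        have : normSq 0 = 0 := by simp [normSq]
        simp [this]
      · have hlam : 1 ≤ Real.sqrt (normSq k) * Real.sqrt N :=
          one_le_mul_of_one_le_of_one_le (Real.one_le_sqrt.mpr (one_le_normSq hk))
            (Real.one_le_sqrt.mpr (by exact_mod_cast hF.one_le))
        refine double_commutator_le ha.summable hferm hF.card_eq hk hlam (by norm_num)
          (hF.exitCount_le k) ?_
        have := hF.exitCount_le (-k)
        have hneg : normSq (-k) = normSq k := by simp [normSq]
        rwa [hneg] at this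
    rw [hη]
    linarith
  have h1 := Complex.hasSum_re (hasSum_hop hV him hs η ψ)
  simp_rw [Complex.re_ofReal_mul] at h1
  -- Halving for ordered pairs leaves `5 G2 + 800 M1`, and `G2 ≤ M1` produces the constant `805`.
  have h2 := ((hasSum_hop_self hV him hs χ).mul_right G2).sub
    (hsum.hasSum.mul_left ((10 * G2 + 1600 * M1) * Real.sqrt N))
  have h3 := hasSum_le (fun k => ?_) h2 h1
  · have h4 := eigen_inner hφ hE hη
    rw [hEre] at h4
    rw [tsum_mul_excessKinetic hfin hg2abs kF]
    have h5 := mul_le_mul_of_nonneg_left h3 (inv_nonneg.mpr (Nat.cast_nonneg (α := ℝ) N))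
    have h6 : ((2 : ℂ) * ∫ x, (pairPotential V x : ℂ) * (ψ x * conj (η x))).re
        = 2 * (∫ x, (pairPotential V x : ℂ) * (ψ x * conj (η x))).re := by
      rw [← Complex.ofReal_ofNat, Complex.re_ofReal_mul]
    rw [h6] at h5
    have h7 := sqrt_mul_inv hF.one_le
    have h8 := gradNorm_nonneg hv0
    have hh : 0 ≤ hbar N := Real.rpow_nonneg (Nat.cast_nonneg _) _
    have h9 : (N : ℝ)⁻¹ * ((10 * G2 + 1600 * M1) * Real.sqrt N * gradNorm v)
        = (10 * G2 + 1600 * M1) * gradNorm v * hbar N := by rw [← h7]; ring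
    have h10 : (energy V ψ - energyFS V hF) * G2 ≤ |C₀| * hbar N * M1 := by
      calc _ ≤ (C₀ * hbar N) * G2 := by gcongr
        _ ≤ (|C₀| * hbar N) * G2 := by gcongr; exact le_abs_self _
        _ ≤ _ := by gcongr
    have h11 : gradNorm v * hbar N * G2 ≤ gradNorm v * hbar N * M1 := by gcongr
    rw [energyFS_eq] at h10
    change _ ≤ (|C₀| + 805 * gradNorm v) * hbar N * M1
    rw [← hG2] at h4 ⊢
    rw [mul_sub] at h5
    change _ - (N : ℝ)⁻¹ * ((10 * G2 + 1600 * M1) * Real.sqrt N * gradNorm v) ≤ _ at h5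
    rw [h9] at h5
    linarith
  · nlinarith [mul_le_mul_of_nonneg_left (hop_ge k) (hv0 k)]

end Energy
end FermiGas

/-! ### Fock space expectation values as sums over plane wave coefficients. -/

namespace FermiGas
open MeasureTheory Set Filter Topology
open scoped ComplexConjugate ENNReal NNReal

section Expectation
variable {N : ℕ}

lemma inner_slaterFock_single (T : Finset Mom) (n : ℕ) (ξ : Fock) :
    inner ℂ (slaterFock T) (lp.single 2 n (ξ n) : Fock)
      = if T.card = n then (inner ℂ (slaterFock T) ξ : ℂ) else 0 := by
  rw [inner_slaterFock]
  split_ifs with h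
  · subst h
    rw [lp.single_apply_self, inner_slaterFock]
  · have : (lp.single 2 n (ξ n) : Fock) T.card = 0 := lp.single_apply_ne _ _ _ h
    rw [this]
    simp

/-- Both factors of the observable are diagonal in the Slater basis: `𝒩` has the value `T.card` and
`∑ w(p) a_p^* a_p` the value `∑_{p ∈ T} w(p)`. -/
lemma expectation_eq_tsum_slater (m : ℕ) (w : Mom → ℝ) (ξ : Fock) :
    expectation m w ξ = ∑' T : Finset Mom, (T.card : ℝ≥0∞) ^ m *
      (∑ p ∈ T, ENNReal.ofReal (w p)) * ENNReal.ofReal (‖inner ℂ (slaterFock T) ξ‖ ^ 2) := by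
  rw [expectation]
  simp_rw [tsum_norm_annih_sq_mul, inner_slaterFock_single, ← ENNReal.tsum_mul_left]
  rw [ENNReal.tsum_comm]
  refine tsum_congr fun T => ?_
  rw [tsum_eq_single T.card fun n hn => by rw [if_neg (Ne.symm hn)]; simp, if_pos rfl, mul_assoc]

lemma norm_phSign (B S : Finset Mom) : ‖phSign B S‖ = 1 := by
  rw [phSign, norm_prod]
  exact Finset.prod_eq_one fun p _ => norm_orderSign p B

lemma norm_inner_particleHole (B T : Finset Mom) (ξ : Fock) :
    ‖(inner ℂ (slaterFock (symmDiff T B)) (particleHole B ξ) : ℂ)‖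
      = ‖(inner ℂ (slaterFock T) ξ : ℂ)‖ := by
  rw [← (particleHole B).inner_map_map (slaterFock T) ξ, particleHole_slaterFock, inner_smul_left,
    norm_mul, RCLike.norm_conj, norm_phSign, one_mul]

/-- Sums over Slater determinants in terms of plane wave coefficients. -/
lemma tsum_slater_eq_tsum_coeff {ζ : Fock} (hsec : ∀ n, n ≠ N → ζ n = 0)
    (F : Finset Mom → ℝ≥0∞) :
    ∑' S, F S * ENNReal.ofReal (‖inner ℂ (slaterFock S) ζ‖ ^ 2)
      = ∑' K : Fin N → Mom, F (Finset.univ.image K)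
        * ENNReal.ofReal (‖coeff (ζ N : L2 N) K‖ ^ 2) := by
  have hferm := isFermionic_coeff (ζ N).2
  have hS : ∀ S, ENNReal.ofReal (‖(inner ℂ (slaterFock S) ζ : ℂ)‖ ^ 2)
      = ∑' K : Fin N → Mom, if S = Finset.univ.image K then
        ENNReal.ofReal (‖coeff (ζ N : L2 N) K‖ ^ 2) else 0 := by
    intro S
    by_cases hc : S.card = N
    -- The `N!` orderings of `S` have coefficients of equal modulus, each being the Slater amplitude
    -- divided by `√N!` up to a sign. All other configurations with image `S` have coefficient zero.
    · have hinj : Function.Injective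
          fun σ : Equiv.Perm (Fin N) => (S.orderEmbOfFin hc ∘ σ : Fin N → Mom) := by
        intro σ τ h
        ext1 i
        exact (S.orderEmbOfFin hc).injective (congrFun h i)
      rw [tsum_eq_sum (s := Finset.univ.image
        fun σ : Equiv.Perm (Fin N) => (S.orderEmbOfFin hc ∘ σ : Fin N → Mom))]
      · rw [Finset.sum_image hinj.injOn]
        have : ∀ σ : Equiv.Perm (Fin N), (if S = Finset.univ.image (S.orderEmbOfFin hc ∘ σ) then
            ENNReal.ofReal (‖coeff (ζ N : L2 N) (S.orderEmbOfFin hc ∘ σ)‖ ^ 2) else 0)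
            = ENNReal.ofReal (‖coeff (ζ N : L2 N) (S.orderEmbOfFin hc)‖ ^ 2) := by
          intro σ
          rw [if_pos (image_orderEmbOfFin_comp S hc σ).symm, hferm.comp_perm, norm_mul]
          have : ‖((Equiv.Perm.sign σ : ℤ) : ℂ)‖ = 1 := by
            rcases Int.units_eq_one_or (Equiv.Perm.sign σ) with h | h <;> simp [h]
          rw [this, one_mul]
        simp_rw [this]
        rw [Finset.sum_const, Finset.card_univ, Fintype.card_perm, Fintype.card_fin,
          inner_slaterFock_eq S hc, norm_mul, mul_pow, Complex.norm_real, Real.norm_eq_abs, sq_abs,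
          Real.sq_sqrt (Nat.cast_nonneg _), ENNReal.ofReal_mul (Nat.cast_nonneg _),
          ENNReal.ofReal_natCast, nsmul_eq_mul]
        rfl
      · intro K hK
        rw [ite_eq_right_iff]
        intro hSK
        by_cases hK0 : coeff (ζ N : L2 N) K = 0
        · simp [hK0]
        · exfalso
          obtain ⟨S', hc', σ, rfl⟩ := exists_orderEmb_comp (hferm.injective K hK0)
          rw [image_orderEmbOfFin_comp] at hSK
          subst hSK
          exact hK (Finset.mem_image_of_mem _ (Finset.mem_univ σ))
    · have h0 : (inner ℂ (slaterFock S) ζ : ℂ) = 0 := by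
        rw [inner_slaterFock, hsec _ hc]
        simp
      rw [h0, eq_comm]
      simp only [norm_zero, ne_eq, OfNat.ofNat_ne_zero, not_false_eq_true, zero_pow,
        ENNReal.ofReal_zero, ENNReal.tsum_eq_zero, ite_eq_right_iff]
      intro K hSK
      by_cases hK0 : coeff (ζ N : L2 N) K = 0
      · simp [hK0]
      · exfalso
        apply hc
        rw [hSK, Finset.card_image_of_injective _ (hferm.injective K hK0), Finset.card_univ,
          Fintype.card_fin]
  simp_rw [hS, ← ENNReal.tsum_mul_left]
  rw [ENNReal.tsum_comm]
  refine tsum_congr fun K => ?_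
  rw [tsum_eq_single (Finset.univ.image K) fun S hne => by rw [if_neg hne, mul_zero], if_pos rfl]

/-- The particle-hole transformation replaces `T` by `symmDiff T B` and preserves the modulus of
amplitudes. Reindexing by this involution moves the symmetric difference into the observable. -/
lemma expectation_eq_tsum_coeff (m : ℕ) (w : Mom → ℝ) {ξ : Fock} (B : Finset Mom)
    (hsec : ∀ n, n ≠ N → particleHole B ξ n = 0) :
    expectation m w ξ = ∑' K : Fin N → Mom,
      (((symmDiff (Finset.univ.image K) B).card : ℝ≥0∞) ^ m *
        ∑ p ∈ symmDiff (Finset.univ.image K) B, ENNReal.ofReal (w p))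
        * ENNReal.ofReal (‖coeff (particleHole B ξ N : L2 N) K‖ ^ 2) := by
  rw [expectation_eq_tsum_slater, ← tsum_slater_eq_tsum_coeff hsec fun S =>
    ((symmDiff S B).card : ℝ≥0∞) ^ m * ∑ p ∈ symmDiff S B, ENNReal.ofReal (w p)]
  have hinv : Function.Involutive fun T : Finset Mom => symmDiff T B :=
    fun T => symmDiff_symmDiff_cancel_right B T
  rw [← (hinv.toPerm _).tsum_eq]
  refine tsum_congr fun T => ?_
  simp only [Function.Involutive.coe_toPerm]
  rw [← norm_inner_particleHole B (symmDiff T B) ξ, symmDiff_symmDiff_cancel_right]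

/-- The symmetric difference consists of the particles outside `B` and of equally many holes. -/
lemma card_symmDiff_image {B : Finset Mom} (hB : B.card = N) {K : Fin N → Mom}
    (hK : Function.Injective K) :
    (symmDiff (Finset.univ.image K) B).card = 2 * (outside B K).card := by
  have h1 := card_sdiff_image hB hK
  have h2 : (Finset.univ.image K).card = N := by
    rw [Finset.card_image_of_injective _ hK, Finset.card_univ, Fintype.card_fin]
  have h3 := Finset.card_sdiff_comm (hB.trans h2.symm)
  rw [show symmDiff (Finset.univ.image K) B
    = (Finset.univ.image K \ B) ∪ (B \ Finset.univ.image K) from rfl,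
    Finset.card_union_of_disjoint disjoint_sdiff_sdiff, ← h3, h1]
  ring

/-- The moments of the number of excitations in the plane wave representation. -/
noncomputable def numberMoment (B : Finset Mom) (m : ℕ) (ψ : L2 N) : ℝ :=
  ∑' K, (2 * (outside B K).card : ℝ) ^ m * ‖coeff ψ K‖ ^ 2

/-- The expectation values `⟨𝒩^m ℍ₀⟩` in the plane wave representation. -/
noncomputable def kineticMoment (kF : ℝ) (m : ℕ) (ψ : L2 N) : ℝ :=
  ∑' K, (2 * (outside (fermiBall kF) K).card : ℝ) ^ m * (excessKinetic kF K * ‖coeff ψ K‖ ^ 2)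

lemma abs_pow_outside_le (B : Finset Mom) (m : ℕ) (K : Fin N → Mom) :
    |(2 * (outside B K).card : ℝ) ^ m| ≤ (2 * N) ^ m := by
  have : ((outside B K).card : ℝ) ≤ N := by exact_mod_cast card_outside_le B K
  rw [abs_of_nonneg (by positivity)]
  gcongr

lemma summable_numberMoment (B : Finset Mom) (m : ℕ) (ψ : L2 N) :
    Summable fun K => (2 * (outside B K).card : ℝ) ^ m * ‖coeff ψ K‖ ^ 2 :=
  summable_bdd_mul (abs_pow_outside_le B m) (fun _ => sq_nonneg _)
    (hasSum_norm_coeff_sq ψ).summable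

lemma summable_kineticMoment (kF : ℝ) (m : ℕ) {ψ : L2 N} (hfin : FiniteKinetic ψ) :
    Summable fun K => (2 * (outside (fermiBall kF) K).card : ℝ) ^ m
      * (excessKinetic kF K * ‖coeff ψ K‖ ^ 2) :=
  summable_mul_excessKinetic hfin (abs_pow_outside_le _ m) kF

variable {kF : ℝ} {ξ : Fock}

/-- For configurations with repeated momenta the excess itself can be negative, but there the
coefficient vanishes; otherwise the excess is a sum of excitation energies. -/
lemma excessKinetic_mul_nonneg (hF : IsFermiMomentum N kF) {ψ : L2 N} (hψ : ψ ∈ antisym N)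
    (K : Fin N → Mom) : 0 ≤ excessKinetic kF K * ‖coeff ψ K‖ ^ 2 := by
  by_cases hK : coeff ψ K = 0
  · simp [hK]
  · rw [excessKinetic_eq hF.card_eq ((isFermionic_coeff hψ).injective K hK)]
    refine mul_nonneg (Finset.sum_nonneg fun p _ => ?_) (sq_nonneg _)
    rw [excitationEnergy]
    positivity

lemma expNumber_succ_eq (hF : IsFermiMomentum N kF) (m : ℕ)
    (hsec : ∀ n, n ≠ N → particleHole (fermiBall kF) ξ n = 0) :
    expNumber (m + 1) ξ = ENNReal.ofReal
      (numberMoment (fermiBall kF) (m + 1) (particleHole (fermiBall kF) ξ N : L2 N)) := by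
  rw [← expectation_one, expectation_eq_tsum_coeff m _ _ hsec, numberMoment,
    ENNReal.ofReal_tsum_of_nonneg (fun _ => by positivity) (summable_numberMoment _ _ _)]
  refine tsum_congr fun K => ?_
  by_cases hK : coeff (particleHole (fermiBall kF) ξ N : L2 N) K = 0
  · simp [hK]
  · have hinj := (isFermionic_coeff (particleHole (fermiBall kF) ξ N).2).injective K hK
    rw [Finset.sum_const, card_symmDiff_image hF.card_eq hinj, ENNReal.ofReal_one, nsmul_eq_mul,
      mul_one, ← pow_succ, ENNReal.ofReal_mul (by positivity)]
    congr 1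
    rw [ENNReal.ofReal_pow (by positivity), ← ENNReal.ofReal_natCast]
    push_cast
    rfl

/-- Finite kinetic energy makes the real series summable, so that its `tsum` is the value in `[0,
∞]` and not a default zero. -/
lemma expH0_eq (hF : IsFermiMomentum N kF) (m : ℕ)
    (hsec : ∀ n, n ≠ N → particleHole (fermiBall kF) ξ n = 0)
    (hfin : FiniteKinetic (particleHole (fermiBall kF) ξ N : L2 N)) :
    expH0 N kF m ξ = ENNReal.ofReal
      (kineticMoment kF m (particleHole (fermiBall kF) ξ N : L2 N)) := by
  have hanti := (particleHole (fermiBall kF) ξ N).2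
  rw [expH0, expectation_eq_tsum_coeff m _ _ hsec, kineticMoment, ENNReal.ofReal_tsum_of_nonneg
    (fun K => mul_nonneg (by positivity) (excessKinetic_mul_nonneg hF hanti K))
    (summable_kineticMoment kF m hfin)]
  refine tsum_congr fun K => ?_
  by_cases hK : coeff (particleHole (fermiBall kF) ξ N : L2 N) K = 0
  · simp [hK]
  · have hinj := (isFermionic_coeff hanti).injective K hK
    have he : ∀ p, 0 ≤ excitationEnergy N kF p := fun p => by
      rw [excitationEnergy]; positivity
    rw [excessKinetic_eq hF.card_eq hinj, card_symmDiff_image hF.card_eq hinj,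
      ENNReal.ofReal_mul (by positivity),
      ENNReal.ofReal_mul (Finset.sum_nonneg fun p _ => he p),
      ENNReal.ofReal_sum_of_nonneg (fun p _ => he p), mul_assoc]
    congr 1
    rw [ENNReal.ofReal_pow (by positivity), ← ENNReal.ofReal_natCast]
    push_cast
    rfl

/-- Outside the gap, `1 ≤ N^{1/2 + δ} e(p)`, since `N^{1/2 + δ}` is the reciprocal of the threshold
`ħ N^{-δ}`. -/
lemma expGapped_le (hN : 1 ≤ N) (δ : ℝ) (m : ℕ) :
    expGapped N kF δ m ξ ≤ ENNReal.ofReal ((N : ℝ) ^ (1 / 2 + δ)) * expH0 N kF m ξ := by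
  have hN0 : (0 : ℝ) < N := by exact_mod_cast hN
  rw [expGapped, expH0, expectation, expectation, ← ENNReal.tsum_mul_left]
  refine ENNReal.tsum_le_tsum fun n => ?_
  rw [mul_left_comm, ← ENNReal.tsum_mul_left (a := ENNReal.ofReal ((N : ℝ) ^ (1 / 2 + δ)))]
  gcongr with p
  rw [← ENNReal.ofReal_mul (by positivity), ← mul_assoc]
  refine ENNReal.ofReal_le_ofReal (mul_le_mul_of_nonneg_right ?_ (sq_nonneg _))
  have he : 0 ≤ excitationEnergy N kF p := by rw [excitationEnergy]; positivity
  by_cases hp : p ∈ (gap N kF δ)ᶜ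
  · rw [Set.indicator_of_mem hp]
    have hlt : hbar N * (N : ℝ) ^ (-δ) < excitationEnergy N kF p := not_le.mp hp
    have h1 : (N : ℝ) ^ (1 / 2 + δ) * (hbar N * (N : ℝ) ^ (-δ)) = 1 := by
      rw [hbar, ← Real.rpow_add hN0, ← Real.rpow_add hN0]
      ring_nf
      exact Real.rpow_zero _
    exact h1.symm.le.trans (mul_le_mul_of_nonneg_left hlt.le (by positivity))
  · rw [Set.indicator_of_notMem hp]
    positivity

lemma norm_particleHole_apply {B : Finset Mom} (hnorm : ‖ξ‖ = 1)
    (hsec : ∀ n, n ≠ N → particleHole B ξ n = 0) : ‖(particleHole B ξ N : L2 N)‖ = 1 := by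
  have h : particleHole B ξ = lp.single 2 N (particleHole B ξ N) := by
    apply lp.ext
    funext n
    by_cases hn : n = N
    · subst hn
      rw [lp.single_apply_self]
    · rw [hsec n hn, lp.single_apply_ne _ _ _ hn]
  have h2 := congrArg norm h
  rw [LinearIsometryEquiv.norm_map, hnorm, lp.norm_single two_pos] at h2
  exact h2.symm

end Expectation

/-! ### Moment inequalities and their bootstrap. -/

section Moments
variable {N : ℕ} {kF : ℝ} {ψ : L2 N}

lemma numberMoment_zero (B : Finset Mom) (hnorm : ‖ψ‖ = 1) : numberMoment B 0 ψ = 1 := by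
  have ha := hasSum_norm_coeff_sq ψ
  rw [hnorm, one_pow] at ha
  simpa [numberMoment] using ha.tsum_eq

lemma kineticMoment_nonneg (hF : IsFermiMomentum N kF) (hψ : ψ ∈ antisym N) (m : ℕ) :
    0 ≤ kineticMoment kF m ψ :=
  tsum_nonneg fun K => mul_nonneg (by positivity) (excessKinetic_mul_nonneg hF hψ K)

lemma numberMoment_nonneg (B : Finset Mom) (m : ℕ) : 0 ≤ numberMoment B m ψ :=
  tsum_nonneg fun K => by positivity

/-- Few excitations are possible within the gap, and those outside of it cost energy. -/
lemma numberMoment_succ_le (hF : IsFermiMomentum N kF) (hψ : ψ ∈ antisym N)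
    (hfin : FiniteKinetic ψ) {G : Finset Mom} {t : ℝ} (ht : 0 < t)
    (hG : ∀ p, p ∉ G → t ≤ excitationEnergy N kF p) (m : ℕ) :
    numberMoment (fermiBall kF) (m + 1) ψ
      ≤ G.card * numberMoment (fermiBall kF) m ψ + t⁻¹ * kineticMoment kF m ψ := by
  rw [numberMoment, numberMoment, kineticMoment, ← tsum_mul_left, ← tsum_mul_left,
    ← ((summable_numberMoment _ m ψ).mul_left _).tsum_add
      ((summable_kineticMoment kF m hfin).mul_left _)]
  refine (summable_numberMoment _ (m + 1) ψ).tsum_le_tsum (fun K => ?_)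
    (((summable_numberMoment _ m ψ).mul_left _).add
      ((summable_kineticMoment kF m hfin).mul_left _))
  by_cases hK : coeff ψ K = 0
  · simp [hK]
  have hinj := (isFermionic_coeff hψ).injective K hK
  set D := symmDiff (Finset.univ.image K) (fermiBall kF)
  have hD : (D.card : ℝ) = 2 * (outside (fermiBall kF) K).card := by
    rw [card_symmDiff_image hF.card_eq hinj]; push_cast; rfl
  -- Pauli principle: the excitations form a set of momenta, so at most `G.card` of them lie in `G`.
  have h1 : (D.card : ℝ) ≤ G.card + (D \ G).card := by
    have h := Finset.card_le_card_sdiff_add_card (s := D) (t := G)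
    rw [add_comm] at h
    exact_mod_cast h
  have h2 : t * (D \ G).card ≤ excessKinetic kF K := by
    rw [excessKinetic_eq hF.card_eq hinj]
    calc t * (D \ G).card = ∑ _p ∈ D \ G, t := by rw [Finset.sum_const, nsmul_eq_mul, mul_comm]
      _ ≤ ∑ p ∈ D \ G, excitationEnergy N kF p :=
          Finset.sum_le_sum fun p hp => hG p (Finset.mem_sdiff.mp hp).2
      _ ≤ _ := Finset.sum_le_sum_of_subset_of_nonneg Finset.sdiff_subset fun p _ _ => by
          rw [excitationEnergy]; positivity
  have h3 : ((D \ G).card : ℝ) ≤ t⁻¹ * excessKinetic kF K := by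
    rw [← div_eq_inv_mul, le_div_iff₀' ht]; exact h2
  rw [← hD, pow_succ]
  calc (D.card : ℝ) ^ m * D.card * ‖coeff ψ K‖ ^ 2
      ≤ (D.card : ℝ) ^ m * (G.card + t⁻¹ * excessKinetic kF K) * ‖coeff ψ K‖ ^ 2 := by
        gcongr
        linarith
    _ = _ := by ring

/-- Cauchy–Schwarz in the form `(s g - 1)² ≥ 0`, weighted by the kinetic excess. The parameter `s`
stays free because the bootstrap uses two different values. -/
lemma two_mul_kineticMoment_one_le (hF : IsFermiMomentum N kF) (hψ : ψ ∈ antisym N)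
    (hfin : FiniteKinetic ψ) (s : ℝ) :
    2 * s * kineticMoment kF 1 ψ ≤ s ^ 2 * kineticMoment kF 2 ψ + kineticMoment kF 0 ψ := by
  rw [kineticMoment, kineticMoment, kineticMoment, ← tsum_mul_left, ← tsum_mul_left,
    ← ((summable_kineticMoment kF 2 hfin).mul_left _).tsum_add (summable_kineticMoment kF 0 hfin)]
  refine ((summable_kineticMoment kF 1 hfin).mul_left _).tsum_le_tsum (fun K => ?_)
    (((summable_kineticMoment kF 2 hfin).mul_left _).add (summable_kineticMoment kF 0 hfin))
  have h := excessKinetic_mul_nonneg hF hψ K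
  set g : ℝ := 2 * ((outside (fermiBall kF) K).card : ℝ)
  nlinarith [mul_nonneg (sq_nonneg (s * g - 1)) h]

/-- This is `(g + 1)² ≤ 2 g² + 2`, integrated against a normalized state. -/
lemma tsum_add_one_sq_le (B : Finset Mom) (hnorm : ‖ψ‖ = 1) :
    ∑' K, (2 * (outside B K).card + 1 : ℝ) ^ 2 * ‖coeff ψ K‖ ^ 2
      ≤ 2 * numberMoment B 2 ψ + 2 := by
  have hs := ((summable_numberMoment B 2 ψ).mul_left 2).add
    ((summable_numberMoment B 0 ψ).mul_left 2)
  have h : 2 * numberMoment B 2 ψ + 2 = ∑' K, (2 * ((2 * (outside B K).card : ℝ) ^ 2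
      * ‖coeff ψ K‖ ^ 2) + 2 * ((2 * (outside B K).card : ℝ) ^ 0 * ‖coeff ψ K‖ ^ 2)) := by
    rw [((summable_numberMoment B 2 ψ).mul_left 2).tsum_add
      ((summable_numberMoment B 0 ψ).mul_left 2), tsum_mul_left, tsum_mul_left,
      ← numberMoment, ← numberMoment, numberMoment_zero B hnorm, mul_one]
  rw [h]
  have hp : ∀ K, (2 * (outside B K).card + 1 : ℝ) ^ 2 * ‖coeff ψ K‖ ^ 2
      ≤ 2 * ((2 * (outside B K).card : ℝ) ^ 2 * ‖coeff ψ K‖ ^ 2)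
        + 2 * ((2 * (outside B K).card : ℝ) ^ 0 * ‖coeff ψ K‖ ^ 2) := fun K => by
    nlinarith [mul_nonneg (sq_nonneg (2 * (outside B K).card - 1 : ℝ)) (sq_nonneg ‖coeff ψ K‖)]
  exact (Summable.of_nonneg_of_le (fun _ => by positivity) hp hs).tsum_le_tsum hp hs

/-- The bootstrap closing the estimates of the moments. -/
lemma moment_bootstrap {q r g c₁ c₂ G A₁ A₂ H₀ H₁ H₂ : ℝ} (hq : 1 ≤ q) (hr : 1 ≤ r) (hg : 0 ≤ g)
    (hc₁ : 0 ≤ c₁) (hc₂ : 1 ≤ c₂) (hG0 : 0 ≤ G) (hG : G ≤ g * (q * r)) (h0 : q ^ 2 * H₀ ≤ c₁)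
    (hA₁ : A₁ ≤ G + q ^ 3 * H₀) (hA₂ : A₂ ≤ G * A₁ + q ^ 3 * H₁)
    (hH₁ : ∀ s, 2 * s * H₁ ≤ s ^ 2 * H₂ + H₀) (hH₂ : q ^ 2 * H₂ ≤ c₂ * (2 * A₂ + 2)) :
    A₂ ≤ (2 * (g * (g + c₁)) + 1 + 2 * (c₁ * c₂)) * (q ^ 2 * r ^ 2) ∧
    H₂ ≤ c₂ * (2 * (2 * (g * (g + c₁)) + 1 + 2 * (c₁ * c₂)) + 2) * r ^ 2 ∧
    q * H₁ ≤ (c₂ * (2 * (2 * (g * (g + c₁)) + 1 + 2 * (c₁ * c₂)) + 2) + c₁) * r ^ 2 := by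
  -- In the application `q = N^{1/4}` and `r = N^{ε/2}`, so `q² ħ = 1` and `q³` is the reciprocal of
  -- the gap energy. `A_i` and `H_i` stand for `⟨𝒩^i⟩` and `⟨𝒩^i ℍ₀⟩`, and `G` is the number of
  -- momenta in the gap.
  have hq0 : 0 < q := by linarith
  have hr2 : 1 ≤ r ^ 2 := one_le_pow₀ hr
  have hq2 : 1 ≤ q ^ 2 := one_le_pow₀ hq
  have hqr : 1 ≤ q ^ 2 * r ^ 2 := one_le_mul_of_one_le_of_one_le hq2 hr2
  have e1 : q ^ 3 * H₀ ≤ c₁ * q := by nlinarith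
  have e2 : A₁ ≤ (g + c₁) * (q * r) := by
    have : c₁ * q ≤ c₁ * (q * r) := by
      gcongr
      nlinarith
    linarith
  have e3 : G * A₁ ≤ g * (g + c₁) * (q ^ 2 * r ^ 2) := by
    calc G * A₁ ≤ G * ((g + c₁) * (q * r)) := by gcongr
      _ ≤ (g * (q * r)) * ((g + c₁) * (q * r)) := by gcongr
      _ = _ := by ring
  -- optimize the interpolation
  have e4 : q ^ 3 * H₁ ≤ (A₂ + 1) / 2 + c₁ * c₂ * q ^ 2 := by
    -- With this `s`, the contribution of `H₂` is at most half of `A₂ + 1`, which can be absorbed on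
    -- the left of the bound for `A₂`.
    have h := mul_le_mul_of_nonneg_left (hH₁ (1 / (2 * c₂ * q))) (by positivity : 0 ≤ c₂ * q ^ 4)
    have h1 : c₂ * q ^ 4 * (2 * (1 / (2 * c₂ * q)) * H₁) = q ^ 3 * H₁ := by field_simp
    have h2 : c₂ * q ^ 4 * ((1 / (2 * c₂ * q)) ^ 2 * H₂ + H₀)
        = q ^ 2 * H₂ / (4 * c₂) + c₂ * q ^ 2 * (q ^ 2 * H₀) := by
      field_simp
      ring
    rw [h1, h2] at h
    have h3 : q ^ 2 * H₂ / (4 * c₂) ≤ (A₂ + 1) / 2 := by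
      rw [div_le_iff₀ (by positivity)]
      nlinarith
    have h4 : c₂ * q ^ 2 * (q ^ 2 * H₀) ≤ c₂ * q ^ 2 * c₁ := by gcongr
    linarith
  have f1 : A₂ ≤ (2 * (g * (g + c₁)) + 1 + 2 * (c₁ * c₂)) * (q ^ 2 * r ^ 2) := by
    have h1 : c₁ * c₂ * q ^ 2 ≤ c₁ * c₂ * (q ^ 2 * r ^ 2) := by
      gcongr
      nlinarith
    nlinarith
  set c₄ := 2 * (g * (g + c₁)) + 1 + 2 * (c₁ * c₂)
  have f2 : H₂ ≤ c₂ * (2 * c₄ + 2) * r ^ 2 := by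
    have h1 : q ^ 2 * H₂ ≤ q ^ 2 * (c₂ * (2 * c₄ + 2) * r ^ 2) := by
      calc q ^ 2 * H₂ ≤ c₂ * (2 * A₂ + 2) := hH₂
        _ ≤ c₂ * (2 * (c₄ * (q ^ 2 * r ^ 2)) + 2 * (q ^ 2 * r ^ 2)) := by
            gcongr
            linarith
        _ = _ := by ring
    exact le_of_mul_le_mul_left h1 (by positivity)
  refine ⟨f1, f2, ?_⟩
  -- Now that `H₂` is bounded, `s = 1 / q` balances it against `q² H₀`.
  have h := mul_le_mul_of_nonneg_left (hH₁ q⁻¹) (by positivity : 0 ≤ q ^ 2)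
  have h1 : q ^ 2 * (2 * q⁻¹ * H₁) = 2 * (q * H₁) := by field_simp
  have h2 : q ^ 2 * (q⁻¹ ^ 2 * H₂ + H₀) = H₂ + q ^ 2 * H₀ := by field_simp
  rw [h1, h2] at h
  have h5 : 0 ≤ c₂ * (2 * c₄ + 2) * r ^ 2 := by positivity
  have h6 : c₁ ≤ c₁ * r ^ 2 := by nlinarith
  linarith

end Moments
end FermiGas

/-! ### The a priori bounds. -/

namespace FermiGas
open MeasureTheory Set Filter Topology
open scoped ENNReal

section APriori
variable {N : ℕ} {kF : ℝ} {ξ : Fock} {V : Torus2 → ℝ} {C₀ : ℝ} {hF : IsFermiMomentum N kF}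

lemma BelongsToApproxGS.kineticMoment_zero_le (hξ : BelongsToApproxGS V C₀ hF ξ)
    (hV : Integrable V) (him : ∀ k, (Vhat V k).im = 0) (hv0 : ∀ k, 0 ≤ fourierCoeffV V k)
    (hsum : Summable fun k => Real.sqrt (normSq k) * fourierCoeffV V k) :
    kineticMoment kF 0 (particleHole (fermiBall kF) ξ N : L2 N)
      ≤ (|C₀| + 5 * gradNorm (fourierCoeffV V)) * hbar N := by
  have h := hF.tsum_excessKinetic_le hV him hv0 hsum
    (norm_particleHole_apply hξ.norm_eq hξ.sector) hξ.finite
  simp only [kineticMoment, pow_zero, one_mul]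
  have hh : 0 ≤ hbar N := by rw [hbar]; positivity
  nlinarith [hξ.energy_le, le_abs_self C₀]

/-- The `+ 1` in the constant makes it at least `1`, as `moment_bootstrap` requires. -/
lemma BelongsToApproxGS.kineticMoment_two_le (hξ : BelongsToApproxGS V C₀ hF ξ)
    (hV : Integrable V) (him : ∀ k, (Vhat V k).im = 0) (hv0 : ∀ k, 0 ≤ fourierCoeffV V k)
    (hsum : Summable fun k => Real.sqrt (normSq k) * fourierCoeffV V k)
    (heig : IsEigenvector V (particleHole (fermiBall kF) ξ N : L2 N)) :
    kineticMoment kF 2 (particleHole (fermiBall kF) ξ N : L2 N)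
      ≤ (|C₀| + 805 * gradNorm (fourierCoeffV V) + 1) * hbar N
        * (2 * numberMoment (fermiBall kF) 2 (particleHole (fermiBall kF) ξ N : L2 N) + 2) := by
  have hnorm := norm_particleHole_apply hξ.norm_eq hξ.sector
  have h := hF.tsum_sq_mul_excessKinetic_le hV him hv0 hsum (particleHole (fermiBall kF) ξ N).2
    hnorm hξ.finite heig hξ.energy_le
  have hh : 0 ≤ hbar N := by rw [hbar]; positivity
  have hW := gradNorm_nonneg hv0
  have hn := numberMoment_nonneg (ψ := (particleHole (fermiBall kF) ξ N : L2 N)) (fermiBall kF) 2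
  refine h.trans ((mul_le_mul_of_nonneg_left (tsum_add_one_sq_le _ hnorm) (by positivity)).trans ?_)
  exact mul_le_mul_of_nonneg_right (mul_le_mul_of_nonneg_right (by linarith) hh) (by positivity)

lemma expGapped_le_of_expH0_le (hN : 1 ≤ N) {δ a C : ℝ} {m : ℕ}
    (h : expH0 N kF m ξ ≤ ENNReal.ofReal (C * (N : ℝ) ^ a)) :
    expGapped N kF δ m ξ ≤ ENNReal.ofReal (C * (N : ℝ) ^ (1 / 2 + δ + a)) := by
  have hN0 : (0 : ℝ) < N := by exact_mod_cast hN
  refine (expGapped_le hN δ m).trans ((mul_le_mul_right h _).trans_eq ?_)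
  rw [← ENNReal.ofReal_mul (by positivity), Real.rpow_add hN0 (1 / 2 + δ)]
  congr 1
  ring

end APriori
end FermiGas

open FermiGas in
theorem mainTheorem2 (V : FermiGas.Torus2 → ℝ) (hV : MeasureTheory.Integrable V)
    (hVhat : ∀ k, (FermiGas.Vhat V k).im = 0 ∧ 0 ≤ (FermiGas.Vhat V k).re)
    (hsum : Summable fun k => Real.sqrt (FermiGas.normSq k) * (FermiGas.Vhat V k).re) (C₀ : ℝ) :
    (∃ C : ℝ, 0 < C ∧
      ∀ (N : ℕ) (kF : ℝ) (hF : FermiGas.IsFermiMomentum N kF) (ξ : FermiGas.Fock),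
        FermiGas.BelongsToApproxGS V C₀ hF ξ →
        ∀ δ ∈ Set.Icc (0 : ℝ) (1 / 2),
          FermiGas.expGapped N kF δ 0 ξ ≤ ENNReal.ofReal (C * (N : ℝ) ^ δ)) ∧
    (∀ ε : ℝ, 0 < ε → ∃ C : ℝ, 0 < C ∧
      ∀ (N : ℕ) (kF : ℝ) (hF : FermiGas.IsFermiMomentum N kF) (ξ : FermiGas.Fock),
        FermiGas.BelongsToApproxGS V C₀ hF ξ →
        FermiGas.expNumber 1 ξ ≤ ENNReal.ofReal (C * (N : ℝ) ^ (1 / 4 + ε)) ∧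
        (FermiGas.IsEigenvector V
            (FermiGas.particleHole (FermiGas.fermiBall kF) ξ N : FermiGas.L2 N) →
          FermiGas.expNumber 2 ξ ≤ ENNReal.ofReal (C * (N : ℝ) ^ (1 / 2 + ε)) ∧
          FermiGas.expH0 N kF 1 ξ ≤ ENNReal.ofReal (C * (N : ℝ) ^ (-(1 / 4) + ε)) ∧
          FermiGas.expH0 N kF 2 ξ ≤ ENNReal.ofReal (C * (N : ℝ) ^ ε) ∧
          ∀ δ ∈ Set.Icc (0 : ℝ) (1 / 2),
            FermiGas.expGapped N kF δ 1 ξ ≤ ENNReal.ofReal (C * (N : ℝ) ^ (1 / 4 + δ + ε)) ∧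
            FermiGas.expGapped N kF δ 2 ξ
              ≤ ENNReal.ofReal (C * (N : ℝ) ^ (1 / 2 + δ + ε)))) := by
  have him : ∀ k, (Vhat V k).im = 0 := fun k => (hVhat k).1
  have hv0 : ∀ k, 0 ≤ fourierCoeffV V k := fun k => by
    rw [fourierCoeffV]; exact div_nonneg (hVhat k).2 (by positivity)
  have hs : Summable fun k => Real.sqrt (normSq k) * fourierCoeffV V k := by
    simpa only [fourierCoeffV, mul_div_assoc] using hsum.div_const ((2 * Real.pi) ^ 2)
  have hW := gradNorm_nonneg hv0
  set c₁ := |C₀| + 5 * gradNorm (fourierCoeffV V) with hc₁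
  set c₂ := |C₀| + 805 * gradNorm (fourierCoeffV V) + 1 with hc₂
  have hc₁0 : 0 ≤ c₁ := by positivity
  have hc₂1 : 1 ≤ c₂ := by linarith [abs_nonneg C₀]
  constructor
  · refine ⟨c₁ + 1, by positivity, fun N kF hF ξ hξ δ _ => ?_⟩
    -- The bound `⟨ℍ₀⟩ = O(N^{-1/2})` cancels the `N^{1/2}` lost in passing to `𝒩_δ`, which leaves
    -- `N^δ`.
    have h0 : expH0 N kF 0 ξ ≤ ENNReal.ofReal ((c₁ + 1) * (N : ℝ) ^ (-(1 / 2) : ℝ)) := by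
      rw [expH0_eq hF 0 hξ.sector hξ.finite]
      refine ENNReal.ofReal_le_ofReal ((hξ.kineticMoment_zero_le hV him hv0 hs).trans ?_)
      exact mul_le_mul_of_nonneg_right (by linarith) (Real.rpow_nonneg (Nat.cast_nonneg N) _)
    convert expGapped_le_of_expH0_le hF.one_le (δ := δ) h0 using 4
    ring
  · intro ε hε
    -- The size of the gap enters the second moment squared, hence `ε / 2`.
    obtain ⟨g, hg, hgap⟩ := exists_gap_card_le (half_pos hε)
    set c₄ := 2 * (g * (g + c₁)) + 1 + 2 * (c₁ * c₂)
    set c₅ := c₂ * (2 * c₄ + 2)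
    have hg0 : 0 ≤ g := by linarith
    have hc₄ : 0 ≤ c₄ := by positivity
    have hc₅ : 0 ≤ c₅ := by positivity
    -- The summands are the constants for `⟨𝒩⟩`, `⟨𝒩²⟩`, `⟨𝒩² ℍ₀⟩` and `⟨𝒩 ℍ₀⟩`. The bounds with
    -- `𝒩_δ` inherit those of `ℍ₀`.
    refine ⟨(g + c₁) + c₄ + c₅ + (c₅ + c₁), by positivity, fun N kF hF ξ hξ => ?_⟩
    set C := (g + c₁) + c₄ + c₅ + (c₅ + c₁) with hC
    have hC0 : 0 ≤ C := by positivity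
    obtain ⟨G, hG, hGcard⟩ := hgap N kF hF
    have hN1 : (1 : ℝ) ≤ N := by exact_mod_cast hF.one_le
    have hN0 : (0 : ℝ) < N := by linarith
    have hanti := (particleHole (fermiBall kF) ξ N).2
    set ψ := (particleHole (fermiBall kF) ξ N : L2 N) with hψ
    have hnorm : ‖ψ‖ = 1 := norm_particleHole_apply hξ.norm_eq hξ.sector
    set q : ℝ := (N : ℝ) ^ (1 / 4 : ℝ) with hq
    set r : ℝ := (N : ℝ) ^ (ε / 2) with hr
    have hq1 : 1 ≤ q := Real.one_le_rpow hN1 (by norm_num)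
    have hr1 : 1 ≤ r := Real.one_le_rpow hN1 (by positivity)
    have hq0 : 0 < q := by linarith
    have hqr : (N : ℝ) ^ (1 / 4 + ε / 2) = q * r := Real.rpow_add hN0 _ _
    have hr2 : r ^ 2 = (N : ℝ) ^ ε := by
      rw [hr, ← Real.rpow_natCast, ← Real.rpow_mul hN0.le]
      congr 1
      push_cast
      ring
    have hq2 : q ^ 2 = (N : ℝ) ^ (1 / 2 : ℝ) := by
      rw [hq, ← Real.rpow_natCast, ← Real.rpow_mul hN0.le]
      congr 1
      push_cast
      ring
    have hqh : q ^ 2 * hbar N = 1 := by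
      rw [hq2, hbar, ← Real.rpow_add hN0]
      norm_num
    have ht : hbar N * (N : ℝ) ^ (-(1 / 4) : ℝ) = (q ^ 3)⁻¹ := by
      rw [hbar, ← Real.rpow_add hN0, hq, ← Real.rpow_natCast, ← Real.rpow_mul hN0.le,
        ← Real.rpow_neg hN0.le]
      norm_num
    rw [ht] at hG
    rw [hqr] at hGcard
    have hA := numberMoment_succ_le hF hanti hξ.finite (by positivity) hG
    simp only [inv_inv] at hA
    have hA₁ := hA 0
    rw [zero_add, numberMoment_zero _ hnorm, mul_one] at hA₁
    have h0 : q ^ 2 * kineticMoment kF 0 ψ ≤ c₁ := by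
      calc q ^ 2 * kineticMoment kF 0 ψ ≤ q ^ 2 * (c₁ * hbar N) := by
            gcongr
            exact hξ.kineticMoment_zero_le hV him hv0 hs
        _ = c₁ * (q ^ 2 * hbar N) := by ring
        _ = c₁ := by rw [hqh, mul_one]
    constructor
    · rw [expNumber_succ_eq hF 0 hξ.sector]
      apply ENNReal.ofReal_le_ofReal
      calc numberMoment (fermiBall kF) 1 ψ ≤ G.card + q ^ 3 * kineticMoment kF 0 ψ := hA₁
        _ = G.card + q * (q ^ 2 * kineticMoment kF 0 ψ) := by ring
        _ ≤ g * (q * r) + (q * r) * c₁ := by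
            gcongr
            exact mul_nonneg (by positivity) (kineticMoment_nonneg hF hanti 0)
            nlinarith
        _ = (g + c₁) * (N : ℝ) ^ (1 / 4 + ε / 2) := by rw [hqr]; ring
        _ ≤ C * (N : ℝ) ^ (1 / 4 + ε) := by
            gcongr
            · linarith
            · linarith
    · intro heig
      have hH₂ : q ^ 2 * kineticMoment kF 2 ψ ≤ c₂ * (2 * numberMoment (fermiBall kF) 2 ψ + 2) := by
        calc q ^ 2 * kineticMoment kF 2 ψ
            ≤ q ^ 2 * (c₂ * hbar N * (2 * numberMoment (fermiBall kF) 2 ψ + 2)) := by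
              gcongr
              exact hξ.kineticMoment_two_le hV him hv0 hs heig
          _ = c₂ * (2 * numberMoment (fermiBall kF) 2 ψ + 2) * (q ^ 2 * hbar N) := by ring
          _ = _ := by rw [hqh, mul_one]
      obtain ⟨b₁, b₂, b₃⟩ := moment_bootstrap hq1 hr1 hg0 hc₁0 hc₂1 (Nat.cast_nonneg _) hGcard h0
        hA₁ (hA 1) (two_mul_kineticMoment_one_le hF hanti hξ.finite) hH₂
      have k₁ : expH0 N kF 1 ξ ≤ ENNReal.ofReal (C * (N : ℝ) ^ (-(1 / 4) + ε)) := by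
        rw [expH0_eq hF 1 hξ.sector hξ.finite]
        apply ENNReal.ofReal_le_ofReal
        rw [Real.rpow_add hN0, Real.rpow_neg hN0.le, ← hr2, mul_left_comm, ← div_eq_inv_mul,
          le_div_iff₀' hq0]
        refine b₃.trans ?_
        gcongr
        linarith
      have k₂ : expH0 N kF 2 ξ ≤ ENNReal.ofReal (C * (N : ℝ) ^ ε) := by
        rw [expH0_eq hF 2 hξ.sector hξ.finite, ← hr2]
        apply ENNReal.ofReal_le_ofReal
        refine b₂.trans ?_
        gcongr
        linarith
      refine ⟨?_, k₁, k₂, fun δ _ => ⟨?_, expGapped_le_of_expH0_le hF.one_le k₂⟩⟩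
      · rw [expNumber_succ_eq hF 1 hξ.sector, Real.rpow_add hN0, ← hq2, ← hr2]
        apply ENNReal.ofReal_le_ofReal
        refine b₁.trans ?_
        gcongr
        linarith
      · convert expGapped_le_of_expH0_le hF.one_le (δ := δ) k₁ using 4
        ring
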